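/- Let $G=(V,E)$ be a finite simple graph and $M$ a matching in $G$. Edges in $M$ are matched, the others unmatched; a vertex is unmatched if no edge of $M$ meets it. An alternating path is a simple path (possibly of length $0$) whose edges alternate between $M$ and $E\setminus M$; an augmenting path is an alternating path joining two distinct unmatched vertices, and $l_m\in\mathbb N\cup\{\infty\}$ is the minimum length of one ($\infty$ if there is none). *Levels.* $\mathrm{evenlevel}(v)$ (resp. $\mathrm{oddlevel}(v)$) is the minimum length of an even (resp. odd) length alternating path from an unmatched vertex to $v$, or $\infty$ if there is none; the paths attaining it are the evenlevel$(v)$ (oddlevel$(v)$) paths. $\mathrm{minlevel}(v)$ and $\mathrm{maxlevel}(v)$ are the smaller and the larger of the two levels, and the paths from unmatched vertices attaining them are the minlevel$(v)$ and maxlevel$(v)$ paths. $v$ is outer if $\mathrm{evenlevel}(v)<\mathrm{oddlevel}(v)$. *Tenacity and bridges.* $\tau(v)=\mathrm{evenlevel}(v)+\mathrm{oddlevel}(v)$; for an edge, $\tau(u,v)=\mathrm{evenlevel}(u)+\mathrm{evenlevel}(v)+1$ if it is unmatched and $\tau(u,v)=\mathrm{oddlevel}(u)+\mathrm{oddlevel}(v)+1$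 if it is matched. $t_m=\min_v\tau(v)$; $t$ is an eligible tenacity if it is an odd natural number with $t_m\le t<l_m$. An edge is a prop if it is the last edge of a minlevel$(w)$ path for some vertex $w$, and a bridge otherwise. *Bases and blossoms.* For a vertex $v$ of eligible tenacity and an evenlevel$(v)$ or oddlevel$(v)$ path $p$, let $F(p,v)$ be the vertex farthest along $p$ among the vertices of $p$ of tenacity $>\tau(v)$, and let $B(v)$ be the set of all $F(p,v)$. If $B(v)$ is a singleton, $\mathrm{base}(v)$ is its element. For odd $t<l_m$ and an outer vertex $b$ with $\tau(b)>t$ the blossom of tenacity $t$ and base $b$ is defined recursively by $\mathcal B_{b,1}=\emptyset$ and $$\mathcal B_{b,t}=S_{b,t}\cup\bigcup_{w\in S_{b,t}\cup\{b\},\ w\text{ outer}}\mathcal B_{w,t-2},\qquad S_{b,t}=\{w:\tau(w)=t,\ \mathrm{base}(w)=b\}\qquad(t\ge 3).$$ An evenlevel$(b;u)$ (oddlevel$(b;u)$) path is a path of minimum length among the even (odd) length alternating paths from $b$ to $u$ that start with an unmatched edge. **Theorem.** Let $t$ be an eligible tenacity and $v$ a vertex with $\tau(v)=t$. Then: 1.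 $F(p,v)$ exists for every evenlevel$(v)$ or oddlevel$(v)$ path $p$, and $B(v)$ is a singleton. 2. Every maxlevel$(v)$ path contains a unique bridge of tenacity $t$. 3. The blossoms of tenacity at most $t$ form a laminar family: any two of them are disjoint or one contains the other. 4. Let $b=\mathrm{base}(v)$ and $u\in\mathcal B_{b,t}$. Every evenlevel$(u)$ (resp. oddlevel$(u)$) path is the concatenation of an evenlevel$(b)$ path and an evenlevel$(b;u)$ (resp. oddlevel$(b;u)$) path. Moreover, every evenlevel$(b;u)$ and every oddlevel$(b;u)$ path lies in $\mathcal B_{b,t}\cup\{b\}$, and all its edges have tenacity $\le t$. 5. Let $b=\mathrm{base}(v)$ and let $p$ be an evenlevel$(v)$ or oddlevel$(v)$ path. Then $b$ lies on $p$, and for every vertex $u\ne b$ on the part $p[b\text{ to }v]$ of $p$ from $b$ to $v$, $\mathrm{base}(u)$ is defined and lies on $p[b\text{ to }v]$. Additionally, for every vertex $v$ of tenacity $l_m$, every maxlevel$(v)$ path contains a unique bridge of tenacity $l_m$. -/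

import Mathlib

namespace MV

variable {V : Type*} {G : SimpleGraph V}

/-- `p` is an alternating path: it is simple and its consecutive edges alternate between matched
and unmatched. A path of length zero is alternating. -/
def IsAltPath (M : G.Subgraph) {u v : V} (p : G.Walk u v) : Prop :=
  p.IsPath ∧ p.edges.IsChain (fun e e' => e ∈ M.edgeSet ↔ e' ∉ M.edgeSet)

/-- The vertex `v` is unmatched. -/
def IsUnmatched (M : G.Subgraph) (v : V) : Prop := ∀ w, ¬ M.Adj v w

/-- `p` is an alternating path starting at an unmatched vertex. -/
def IsAltPathFromFree (M : G.Subgraph) {f v : V} (p : G.Walk f v) : Prop :=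
  IsUnmatched M f ∧ IsAltPath M p

/-- `p` is an augmenting path: it joins two distinct unmatched vertices. -/
def IsAugmentingPath (M : G.Subgraph) {f g : V} (p : G.Walk f g) : Prop :=
  IsAltPath M p ∧ IsUnmatched M f ∧ IsUnmatched M g ∧ f ≠ g

/-- `l_m`, the length of a minimum length augmenting path, `⊤` if there is none. -/
noncomputable def lm (M : G.Subgraph) : ℕ∞ :=
  sInf {l | ∃ (f g : V) (p : G.Walk f g), IsAugmentingPath M p ∧ l = p.length}

noncomputable def evenlevel (M : G.Subgraph) (v : V) : ℕ∞ :=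
  sInf {l | ∃ (f : V) (p : G.Walk f v), IsAltPathFromFree M p ∧ Even p.length ∧ l = p.length}

noncomputable def oddlevel (M : G.Subgraph) (v : V) : ℕ∞ :=
  sInf {l | ∃ (f : V) (p : G.Walk f v), IsAltPathFromFree M p ∧ Odd p.length ∧ l = p.length}

/-- `p` is an `evenlevel(v)` path. -/
def IsEvenlevelPath (M : G.Subgraph) {f v : V} (p : G.Walk f v) : Prop :=
  IsAltPathFromFree M p ∧ Even p.length ∧ (p.length : ℕ∞) = evenlevel M v

/-- `p` is an `oddlevel(v)` path. -/
def IsOddlevelPath (M : G.Subgraph) {f v : V} (p : G.Walk f v) : Prop :=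
  IsAltPathFromFree M p ∧ Odd p.length ∧ (p.length : ℕ∞) = oddlevel M v

/-- `p` is an `evenlevel(v)` or `oddlevel(v)` path. -/
def IsLevelPath (M : G.Subgraph) {f v : V} (p : G.Walk f v) : Prop :=
  IsEvenlevelPath M p ∨ IsOddlevelPath M p

noncomputable def minlevel (M : G.Subgraph) (v : V) : ℕ∞ := min (evenlevel M v) (oddlevel M v)

noncomputable def maxlevel (M : G.Subgraph) (v : V) : ℕ∞ := max (evenlevel M v) (oddlevel M v)

/-- `p` is a `minlevel(v)` path. -/
def IsMinlevelPath (M : G.Subgraph) {f v : V} (p : G.Walk f v) : Prop :=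
  IsLevelPath M p ∧ (p.length : ℕ∞) = minlevel M v

/-- `p` is a `maxlevel(v)` path. -/
def IsMaxlevelPath (M : G.Subgraph) {f v : V} (p : G.Walk f v) : Prop :=
  IsLevelPath M p ∧ (p.length : ℕ∞) = maxlevel M v

/-- The vertex `v` is outer. (The inequality forces `evenlevel(v)` to be finite.) -/
def IsOuter (M : G.Subgraph) (v : V) : Prop := evenlevel M v < oddlevel M v

/-- The tenacity of a vertex. -/
noncomputable def tenacity (M : G.Subgraph) (v : V) : ℕ∞ := evenlevel M v + oddlevel M v

open Classical in
/-- The tenacity of an edge. -/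
noncomputable def edgeTenacity (M : G.Subgraph) (e : Sym2 V) : ℕ∞ :=
  if e ∈ M.edgeSet then
    Sym2.lift ⟨fun u v => oddlevel M u + oddlevel M v + 1, fun u v => by
      simp only [add_comm]⟩ e
  else
    Sym2.lift ⟨fun u v => evenlevel M u + evenlevel M v + 1, fun u v => by
      simp only [add_comm]⟩ e

/-- `t_m`, the minimum tenacity of a vertex. -/
noncomputable def tm (M : G.Subgraph) : ℕ∞ := ⨅ v, tenacity M v

/-- `t` is an eligible tenacity. -/
def Eligible (M : G.Subgraph) (t : ℕ) : Prop := Odd t ∧ tm M ≤ t ∧ (t : ℕ∞) < lm M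

/-- `u` is a predecessor of `v`: some `minlevel(v)` path has `(u, v)` as its last edge. -/
def IsPredecessor (M : G.Subgraph) (u v : V) : Prop :=
  ∃ (f : V) (p : G.Walk f v), IsMinlevelPath M p ∧ ¬ p.Nil ∧ p.penultimate = u

/-- The edge `e` is a prop. -/
def IsPropEdge (M : G.Subgraph) (e : Sym2 V) : Prop :=
  ∃ u v, IsPredecessor M u v ∧ e = s(u, v)

/-- The edge `e` is a bridge, i.e. not a prop. -/
def IsBridgeEdge (M : G.Subgraph) (e : Sym2 V) : Prop :=
  e ∈ G.edgeSet ∧ ¬ IsPropEdge M e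

/-- `F(p, v) = b`: `b` is the highest vertex of tenacity `> tenacity(v)` on the path `p` to `v`. -/
def IsBaseOn (M : G.Subgraph) {f v : V} (p : G.Walk f v) (b : V) : Prop :=
  tenacity M v < tenacity M b ∧
    ∃ (q : G.Walk f b) (r : G.Walk b v), p = q.append r ∧
      ∀ x ∈ r.support, tenacity M v < tenacity M x → x = b

/-- The set `B(v)` of all `F(p, v)`, over `evenlevel(v)` and `oddlevel(v)` paths `p`. -/
def baseSet (M : G.Subgraph) (v : V) : Set V :=
  {b | ∃ (f : V) (p : G.Walk f v), IsLevelPath M p ∧ IsBaseOn M p b}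

/-- `base(v) = b`, i.e. `B(v)` is a singleton and `b` is its element. -/
def HasBase (M : G.Subgraph) (v b : V) : Prop := baseSet M v = {b}

/-- The set `S_{b,t}`. -/
def blossomCore (M : G.Subgraph) (b : V) (t : ℕ) : Set V :=
  {v | tenacity M v = t ∧ HasBase M v b}

/-- The blossom of tenacity `t` and base `b`, meaningful for odd `t`. -/
def blossom (M : G.Subgraph) : ℕ → V → Set V
  | 0, _ => ∅
  | 1, _ => ∅
  | t + 2, b => blossomCore M b (t + 2) ∪
      ⋃ v ∈ {v | v ∈ blossomCore M b (t + 2) ∪ {b} ∧ IsOuter M v}, blossom M t v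

/-- The family of all blossoms of tenacity at most `t`. -/
def blossomFamily (M : G.Subgraph) (t : ℕ) : Set (Set V) :=
  {B | ∃ (b : V) (t' : ℕ), Odd t' ∧ t' ≤ t ∧ IsOuter M b ∧ (t' : ℕ∞) < tenacity M b ∧
    B = blossom M t' b}

/-- Any two members of the family are disjoint or one contains the other. -/
def IsLaminar (F : Set (Set V)) : Prop :=
  ∀ A ∈ F, ∀ B ∈ F, Disjoint A B ∨ A ⊆ B ∨ B ⊆ A

/-- `p` is an alternating path whose first edge (if any) is unmatched. -/
def IsAltPathUnmatchedStart (M : G.Subgraph) {b v : V} (p : G.Walk b v) : Prop :=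
  IsAltPath M p ∧ ∀ e ∈ p.edges.head?, e ∉ M.edgeSet

/-- `p` is an `evenlevel(b; v)` path: of minimum length among the even length alternating paths
from `b` to `v` that start with an unmatched edge. -/
def IsEvenlevelPathFrom (M : G.Subgraph) {b v : V} (p : G.Walk b v) : Prop :=
  IsAltPathUnmatchedStart M p ∧ Even p.length ∧
    ∀ q : G.Walk b v, IsAltPathUnmatchedStart M q → Even q.length → p.length ≤ q.length

/-- `p` is an `oddlevel(b; v)` path: of minimum length among the odd length alternating paths
from `b` to `v` that start with an unmatched edge. -/
def IsOddlevelPathFrom (M : G.Subgraph) {b v : V} (p : G.Walk b v) : Prop :=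
  IsAltPathUnmatchedStart M p ∧ Odd p.length ∧
    ∀ q : G.Walk b v, IsAltPathUnmatchedStart M q → Odd q.length → p.length ≤ q.length

end MV

namespace MV

open SimpleGraph

/-! ### Alternating walks with a prescribed first colour -/

section Alternation

variable {V : Type*} {G : SimpleGraph V} {M : G.Subgraph}

/-! The proof is a duality argument for shortest alternating paths. For every `j ≤ n` there is a
class function `B j`: it sends a vertex of the blossom of tenacity `2j - 1` with base `b` to `b` and
fixes all other vertices. Together with lower bounds `eBd`, `oBd` for the two levels these functions
form a feasible dual solution (`Dual`). Along an alternating path that starts with an unmatched edge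
at a vertex fixed by all `B j`, count for each `j` the unbased classes, those met by the path whose
base is not yet on it. Each edge raises "bound at the end vertex plus twice the number of unbased
classes" by at most one, which gives weak duality (`Dual.bound`).

Complementary slackness does the rest. If a path attains the bound, every single step is an
equality. Hence a tight path ending in a class whose base it contains stays in the class after the
base (`Dual.exists_split`), and a tight even path to a base meets the class nowhere else
(`Dual.eq_of_tight_even`). Level paths of vertices of small tenacity are tight and leave no class
unbased, so they split at the base (`Setting.split`). Bases, blossoms as classes without their bases
(`blossom_eq`), and laminarity as nesting of fibres all follow.

The dual solution is built by induction on `n`. After contracting the classes of stage `n`, the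
vertices with a level at most `n` form a layered graph under the predecessor relation, and the
bridges of tenacity `2n + 1` join its vertices. Disjoint descents from both ends of a bridge would
give an augmenting path of length `2n + 1`; when `2n + 2 ≤ l_m` this is impossible, so the ends have
a common dominator (`disjoint_or_dom`). The vertices above it on these descents are merged: the
detour through the bridge gives them tenacity `2n + 1`. Sending every vertex of the graph to its
highest unmerged dominator (`top`) defines `B (n + 1)`. Feasibility is checked edge by edge
(`preStage_succ`), and duality then shows that every vertex of tenacity `2n + 1` has been moved
(`PreStage.le_tenacity`).

For bridges, an identity carried along tight paths (`Setting.countP_bridges`) counts those of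
tenacity `2n + 1`. It needs only stage `n`, that is `2n ≤ l_m`, and so also covers tenacity `l_m`.
-/

/-- The edges of the walk alternate, the first one being matched iff `s` is true. -/
def Alt (M : G.Subgraph) : Bool → {u v : V} → G.Walk u v → Prop
  | _, _, _, .nil => True
  | s, u, _, .cons (v := w) _ p => (M.Adj u w ↔ s = true) ∧ Alt M (!s) p

@[simp] lemma alt_nil (s : Bool) (u : V) : Alt M s (Walk.nil : G.Walk u u) := trivial

@[simp] lemma alt_cons (s : Bool) {u v w : V} (h : G.Adj u v) (p : G.Walk v w) :
    Alt M s (.cons h p) ↔ (M.Adj u v ↔ s = true) ∧ Alt M (!s) p := Iff.rfl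

lemma alt_append (s : Bool) {u v w : V} (p : G.Walk u v) (q : G.Walk v w) :
    Alt M s (p.append q) ↔ Alt M s p ∧ Alt M (s ^^ p.length.bodd) q := by
  induction p generalizing s with
  | nil => simp
  | cons h p ih =>
    rw [Walk.cons_append, alt_cons, ih, alt_cons, Walk.length_cons, Nat.bodd_succ, and_assoc]
    have : ((!s) ^^ p.length.bodd) = (s ^^ !p.length.bodd) := by cases s <;> cases p.length.bodd <;> rfl
    rw [this]

lemma alt_concat (s : Bool) {u v w : V} (p : G.Walk u v) (h : G.Adj v w) :
    Alt M s (p.concat h) ↔ Alt M s p ∧ (M.Adj v w ↔ (s ^^ p.length.bodd) = true) := by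
  rw [Walk.concat_eq_append, alt_append]
  simp

lemma alt_reverse (s : Bool) {u v : V} (p : G.Walk u v) (hp : Alt M s p) :
    Alt M (s ^^ !p.length.bodd) p.reverse := by
  induction p generalizing s with
  | nil => simp
  | @cons a b c h p ih =>
    rw [alt_cons] at hp
    rw [Walk.reverse_cons, alt_append]
    have := ih _ hp.2
    simp only [Walk.length_cons, Nat.bodd_succ, Bool.not_not, Walk.length_reverse, alt_cons, alt_nil,
      and_true]
    constructor
    · convert this using 1
      cases s <;> cases p.length.bodd <;> rfl
    · rw [M.adj_comm, hp.1]
      cases s <;> cases p.length.bodd <;> simp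

lemma alt_of_isChain {u v : V} (p : G.Walk u v)
    (hp : p.edges.IsChain (fun e e' => e ∈ M.edgeSet ↔ e' ∉ M.edgeSet)) (s : Bool)
    (hs : ∀ e ∈ p.edges.head?, (e ∈ M.edgeSet ↔ s = true)) : Alt M s p := by
  induction p generalizing s with
  | nil => simp
  | @cons a b c h p ih =>
    have h1 : M.Adj a b ↔ s = true := by
      have := hs s(a, b) (by simp)
      rwa [Subgraph.mem_edgeSet] at this
    refine ⟨h1, ?_⟩
    rw [Walk.edges_cons, List.isChain_cons] at hp
    refine ih hp.2 _ fun e he => ?_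
    have := hp.1 e he
    rw [Subgraph.mem_edgeSet, h1] at this
    cases s <;> simp_all

lemma isChain_of_alt {u v : V} (p : G.Walk u v) (s : Bool) (hp : Alt M s p) :
    p.edges.IsChain (fun e e' => e ∈ M.edgeSet ↔ e' ∉ M.edgeSet) ∧
      ∀ e ∈ p.edges.head?, (e ∈ M.edgeSet ↔ s = true) := by
  induction p generalizing s with
  | nil => simp
  | @cons a b c h p ih =>
    rw [alt_cons] at hp
    obtain ⟨h1, h2⟩ := ih _ hp.2
    rw [Walk.edges_cons, List.isChain_cons]
    refine ⟨⟨fun e he => ?_, h1⟩, ?_⟩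
    · have := h2 e he
      rw [Subgraph.mem_edgeSet, hp.1, this]
      cases s <;> simp
    · simpa using hp.1

lemma isAltPathUnmatchedStart_iff {u v : V} (p : G.Walk u v) :
    IsAltPathUnmatchedStart M p ↔ p.IsPath ∧ Alt M false p := by
  constructor
  · rintro ⟨⟨h1, h2⟩, h3⟩
    exact ⟨h1, alt_of_isChain p h2 false (by simpa using h3)⟩
  · rintro ⟨h1, h2⟩
    obtain ⟨h3, h4⟩ := isChain_of_alt p false h2
    exact ⟨⟨h1, h3⟩, by simpa using h4⟩

/-- No matched edge leaves an unmatched vertex, so the colour of the first edge is forced. -/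
lemma isAltPathFromFree_iff {f v : V} (p : G.Walk f v) :
    IsAltPathFromFree M p ↔ IsUnmatched M f ∧ p.IsPath ∧ Alt M false p := by
  constructor
  · rintro ⟨h0, h1, h2⟩
    refine ⟨h0, h1, alt_of_isChain p h2 false ?_⟩
    cases p with
    | nil => simp
    | cons h p => simpa using h0 _
  · rintro ⟨h0, h1, h2⟩
    exact ⟨h0, h1, (isChain_of_alt p false h2).1⟩

/-- An alternating path with prescribed start, length and set of allowed vertices exists. -/
def HasAlt (M : G.Subgraph) (s : Bool) (n : ℕ) (X : Set V) (u v : V) : Prop :=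
  ∃ p : G.Walk u v, p.IsPath ∧ Alt M s p ∧ p.length = n ∧ ∀ x ∈ p.support, x ∈ X

lemma isPath_append {u v w : V} {p : G.Walk u v} {q : G.Walk v w} (hp : p.IsPath) (hq : q.IsPath)
    (h : ∀ x ∈ p.support, x ∈ q.support → x = v) : (p.append q).IsPath := by
  rw [Walk.isPath_def, Walk.support_append, List.nodup_append']
  have hq' := hq.support_nodup
  rw [← Walk.cons_tail_support, List.nodup_cons] at hq'
  refine ⟨hp.support_nodup, hq'.2, fun x hx hx' => ?_⟩
  have := h x hx (List.mem_of_mem_tail hx')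
  exact hq'.1 (this ▸ hx')

lemma HasAlt.nil (s : Bool) {X : Set V} {u : V} (hu : u ∈ X) : HasAlt M s 0 X u u :=
  ⟨.nil, by simp, by simp, rfl, by simpa using hu⟩

lemma HasAlt.single (s : Bool) {X : Set V} {u v : V} (h : G.Adj u v) (hs : M.Adj u v ↔ s = true)
    (hu : u ∈ X) (hv : v ∈ X) : HasAlt M s 1 X u v :=
  ⟨.cons h .nil, by simp [h.ne], by simpa using hs, rfl, by simp [hu, hv]⟩

lemma HasAlt.trans {s s' : Bool} {n k : ℕ} {X Y : Set V} {u v w : V} (h : HasAlt M s n X u v)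
    (h' : HasAlt M s' k Y v w) (hs : s' = (s ^^ n.bodd)) (hXY : ∀ x ∈ X, x ∈ Y → x = v) :
    HasAlt M s (n + k) (X ∪ Y) u w := by
  obtain ⟨p, hp, ha, rfl, hX⟩ := h
  obtain ⟨q, hq, ha', rfl, hY⟩ := h'
  subst hs
  refine ⟨p.append q, isPath_append hp hq fun x hx hx' => hXY x (hX x hx) (hY x hx'),
    (alt_append _ _ _).2 ⟨ha, ha'⟩, by simp, fun x hx => ?_⟩
  rcases (Walk.mem_support_append_iff _ _).1 hx with hx | hx
  exacts [Or.inl (hX x hx), Or.inr (hY x hx)]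

lemma HasAlt.reverse {s : Bool} {n : ℕ} {X : Set V} {u v : V} (h : HasAlt M s n X u v) :
    HasAlt M (s ^^ !n.bodd) n X v u := by
  obtain ⟨p, hp, ha, rfl, hX⟩ := h
  exact ⟨p.reverse, hp.reverse, alt_reverse s p ha, by simp, by simpa using hX⟩

lemma HasAlt.mono {s : Bool} {n : ℕ} {X Y : Set V} {u v : V} (h : HasAlt M s n X u v)
    (hXY : X ⊆ Y) : HasAlt M s n Y u v := by
  obtain ⟨p, hp, ha, hn, hX⟩ := h
  exact ⟨p, hp, ha, hn, fun x hx => hXY (hX x hx)⟩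

lemma mem_support_concat {u v w x : V} (p : G.Walk u v) (h : G.Adj v w) :
    x ∈ (p.concat h).support ↔ x ∈ p.support ∨ x = w := by
  simp [Walk.support_concat]

lemma bodd_false_iff (n : ℕ) : n.bodd = false ↔ n % 2 = 0 := by
  rw [Nat.mod_two_of_bodd]; cases n.bodd <;> simp

lemma bodd_true_iff (n : ℕ) : n.bodd = true ↔ n % 2 = 1 := by
  rw [Nat.mod_two_of_bodd]; cases n.bodd <;> simp

/-- A nontrivial walk is the extension of a shorter one by its last edge. -/
lemma exists_eq_concat {u v : V} (p : G.Walk u v) (hp : p.length ≠ 0) :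
    ∃ (w : V) (q : G.Walk u w) (h : G.Adj w v), p = q.concat h := by
  cases p with
  | nil => simp at hp
  | cons h p =>
    obtain ⟨w, q, h', e⟩ := Walk.exists_cons_eq_concat h p
    exact ⟨w, q, h', e⟩

/-- `p` is an alternating path starting at an unmatched vertex. -/
def FreePath (M : G.Subgraph) {f v : V} (p : G.Walk f v) : Prop :=
  IsUnmatched M f ∧ p.IsPath ∧ Alt M false p

lemma FreePath.prefix {f v w : V} {q : G.Walk f v} {r : G.Walk v w} (h : FreePath M (q.append r)) :
    FreePath M q :=
  ⟨h.1, h.2.1.of_append_left, ((alt_append _ _ _).1 h.2.2).1⟩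

lemma FreePath.of_concat {f v w : V} {q : G.Walk f v} {h : G.Adj v w}
    (hp : FreePath M (q.concat h)) : FreePath M q ∧ w ∉ q.support ∧ (M.Adj v w ↔ q.length % 2 = 1) := by
  have h1 := (Walk.concat_isPath_iff h).1 hp.2.1
  have h2 := (alt_concat _ _ _).1 hp.2.2
  refine ⟨⟨hp.1, h1.1, h2.1⟩, h1.2, ?_⟩
  rw [h2.2, ← bodd_true_iff]; simp

lemma FreePath.concat {f v w : V} {q : G.Walk f v} (hq : FreePath M q) (h : G.Adj v w)
    (hw : w ∉ q.support) (hs : M.Adj v w ↔ q.length % 2 = 1) : FreePath M (q.concat h) := by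
  refine ⟨hq.1, hq.2.1.concat hw h, (alt_concat _ _ _).2 ⟨hq.2.2, ?_⟩⟩
  rw [hs, ← bodd_true_iff]; simp

/-- Every second edge is matched, so apart from the unmatched start the vertices come in matched
pairs; only the last vertex of an odd path can be without its partner. -/
lemma FreePath.mate_mem (hM : M.IsMatching) {f v : V} (p : G.Walk f v) (hp : FreePath M p) :
    ∀ z ∈ p.support, ∀ y, M.Adj z y → y ∈ p.support ∨ (z = v ∧ p.length % 2 = 1) := by
  induction p using Walk.concatRec with
  | Hnil =>
    intro z hz y hy
    rw [Walk.support_nil, List.mem_singleton] at hz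
    exact absurd hy (hz ▸ hp.1 y)
  | @Hconcat u v w p h ih =>
    obtain ⟨h1, h2, h3⟩ := hp.of_concat
    intro z hz y hy
    rw [mem_support_concat] at hz ⊢
    rw [Walk.length_concat]
    rcases hz with hz | rfl
    · rcases ih h1 z hz y hy with h4 | ⟨rfl, h4⟩
      · exact Or.inl (Or.inl h4)
      · exact Or.inl (Or.inr (hM.eq_of_adj_left hy (h3.2 h4)))
    · by_cases h4 : p.length % 2 = 1
      · refine Or.inl (Or.inl ?_)
        rw [hM.eq_of_adj_left hy (h3.2 h4).symm]
        exact p.end_mem_support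
      · exact Or.inr ⟨rfl, by omega⟩

lemma FreePath.mate_notMem (hM : M.IsMatching) {f x y : V} (p : G.Walk f x) (hp : FreePath M p)
    (hl : p.length % 2 = 1) (hy : M.Adj x y) : y ∉ p.support := by
  obtain ⟨w, q, h, rfl⟩ := exists_eq_concat p (by omega)
  obtain ⟨h1, h2, h3⟩ := hp.of_concat
  rw [Walk.length_concat] at hl
  rw [mem_support_concat]
  rintro (h4 | h4)
  · rcases h1.mate_mem hM q y h4 x hy.symm with h5 | ⟨-, h5⟩
    · exact h2 h5
    · omega
  · exact hy.ne h4.symm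

end Alternation

/-! ### Level functions and their elementary inequalities -/

section Levels

variable {V : Type*} {G : SimpleGraph V} {M : G.Subgraph}

/-- `e` and `o` are the even and odd level functions, with infinite values replaced by `2K` and
`2K + 1`. -/
structure LevelData (M : G.Subgraph) (K : ℕ) (e o : V → ℕ) : Prop where
  e_mod : ∀ v, e v % 2 = 0
  o_mod : ∀ v, o v % 2 = 1
  e_le : ∀ {f v : V} (p : G.Walk f v), FreePath M p → p.length % 2 = 0 → e v ≤ p.length
  o_le : ∀ {f v : V} (p : G.Walk f v), FreePath M p → p.length % 2 = 1 → o v ≤ p.length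
  e_att : ∀ v, e v < 2 * K → ∃ (f : V) (p : G.Walk f v), FreePath M p ∧ p.length = e v
  o_att : ∀ v, o v < 2 * K → ∃ (f : V) (p : G.Walk f v), FreePath M p ∧ p.length = o v

variable {K : ℕ} {e o : V → ℕ}

namespace LevelData

lemma e_free (L : LevelData M K e o) {f : V} (hf : IsUnmatched M f) : e f = 0 := by
  have := L.e_le (Walk.nil : G.Walk f f) ⟨hf, by simp, by simp⟩ rfl
  simpa using this

lemma free_of_e (L : LevelData M K e o) {f : V} (h : e f = 0) (hK : 0 < K) : IsUnmatched M f := by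
  obtain ⟨g, p, hp, hl⟩ := L.e_att f (by omega)
  cases p with
  | nil => exact hp.1
  | cons _ _ => simp [h] at hl

lemma e_mate_pos (L : LevelData M K e o) (hK : 0 < K) {x y : V} (h : M.Adj x y) : e x ≠ 0 :=
  fun h0 => L.free_of_e h0 hK y h

/-- An even path to `y` must enter through the matched edge, and an odd path to `x` extends over it
because `y` is not on it. The second alternative is the case where both values are caps. -/
lemma mate (L : LevelData M K e o) (hM : M.IsMatching) (hK : 0 < K) {x y : V} (h : M.Adj x y) :
    e y = o x + 1 ∨ (2 * K ≤ e y ∧ 2 * K ≤ o x) := by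
  have hy := L.e_mate_pos hK h.symm
  have a1 : o x < 2 * K → e y ≤ o x + 1 := fun hx => by
    obtain ⟨f, p, hp, hl⟩ := L.o_att x hx
    have ho : p.length % 2 = 1 := hl ▸ L.o_mod x
    have := L.e_le _ (hp.concat h.adj_sub (hp.mate_notMem hM p ho h) (by simp [h, ho]))
      (by rw [Walk.length_concat]; omega)
    rw [Walk.length_concat] at this
    omega
  have a2 : e y < 2 * K → o x + 1 ≤ e y := fun hy' => by
    obtain ⟨f, p, hp, hl⟩ := L.e_att y hy'
    obtain ⟨w, q, h', rfl⟩ := exists_eq_concat p (by omega)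
    obtain ⟨h1, h2, h3⟩ := hp.of_concat
    have hm := L.e_mod y
    rw [Walk.length_concat] at hl
    have h4 := h3.2 (by omega)
    obtain rfl := hM.eq_of_adj_right h h4
    have := L.o_le q h1 (by omega)
    omega
  omega

/-- A vertex on a level path has a level at most its position. -/
lemma le_of_mem (L : LevelData M K e o) {f v x : V} (p : G.Walk f v) (hp : FreePath M p)
    (hx : x ∈ p.support) : e x ≤ p.length ∨ o x ≤ p.length := by
  obtain ⟨q, r, rfl⟩ := Walk.mem_support_iff_exists_append.1 hx
  have h1 := hp.prefix
  have h2 : (q.append r).length = q.length + r.length := Walk.length_append _ _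
  rcases Nat.mod_two_eq_zero_or_one q.length with h | h
  · have := L.e_le q h1 h; omega
  · have := L.o_le q h1 h; omega

/-- Append the edge to a shortest even path to `w`; if `a` is already on that path, its prefix
bounds one of the levels of `a`. -/
lemma extend (L : LevelData M K e o) {w a : V} (h : G.Adj w a) (hn : ¬ M.Adj w a)
    (hw : e w < 2 * K) : o a ≤ e w + 1 ∨ e a ≤ e w := by
  obtain ⟨f, p, hp, hl⟩ := L.e_att w hw
  have hm := L.e_mod w
  by_cases ha : a ∈ p.support
  · have := L.le_of_mem p hp ha
    omega
  · have := L.o_le _ (hp.concat h ha (by simp only [hn, false_iff]; omega))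
      (by rw [Walk.length_concat]; omega)
    rw [Walk.length_concat] at this
    omega

end LevelData

end Levels

/-! ### Counting classes met without their base -/

section Unbased

variable {V : Type*}

/-- The classes (fibres of `β`) met by `S` whose base is not in `S`. -/
def unbased (β : V → V) (S : Set V) : Set V := {c | c ∉ S ∧ ∃ x ∈ S, β x = c}

/-- The indicator of a proposition. -/
noncomputable def ind (P : Prop) : ℕ := open Classical in if P then 1 else 0

lemma ind_pos {P : Prop} (h : P) : ind P = 1 := by simp [ind, h]

lemma ind_neg {P : Prop} (h : ¬ P) : ind P = 0 := by simp [ind, h]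

lemma unbased_insert_subset {β : V → V} {S : Set V} {x y : V} (hx : x ∈ S)
    (h : β y ≠ y → β x = β y) : unbased β (insert y S) ⊆ unbased β S := by
  rintro c ⟨hc, z, hz, rfl⟩
  rw [Set.mem_insert_iff, not_or] at hc
  refine ⟨hc.2, ?_⟩
  rcases hz with rfl | hz
  · exact ⟨x, hx, h hc.1⟩
  · exact ⟨z, hz, rfl⟩

/-- A new vertex in the class of `x` opens no class, and closes that class if it is its base; in
another class it opens at most one, and none if it is a base. The two indicators encode these four
cases. -/
lemma ncard_unbased_insert_le [Finite V] {β : V → V} {S : Set V} {x y : V} (hx : x ∈ S)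
    (hy : y ∉ S) :
    (unbased β (insert y S)).ncard + ind (β x = β y) ≤ (unbased β S).ncard + ind (β y ≠ y) := by
  by_cases h1 : β x = β y
  · have hs : unbased β (insert y S) ⊆ unbased β S := unbased_insert_subset hx fun _ => h1
    rw [ind_pos h1]
    by_cases h2 : β y = y
    · have : unbased β (insert y S) ⊂ unbased β S := by
        refine ⟨hs, fun h => ?_⟩
        have : y ∈ unbased β S := ⟨hy, x, hx, h1.trans h2⟩
        exact (h this).1 (Set.mem_insert _ _)
      have := Set.ncard_lt_ncard this
      omega
    · rw [ind_pos h2]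
      have := Set.ncard_le_ncard hs
      omega
  · rw [ind_neg h1]
    by_cases h2 : β y = y
    · have hs : unbased β (insert y S) ⊆ unbased β S := unbased_insert_subset hx fun h => absurd h2 h
      have := Set.ncard_le_ncard hs
      omega
    · rw [ind_pos h2]
      have hs : unbased β (insert y S) ⊆ insert (β y) (unbased β S) := by
        rintro c ⟨hc, z, hz, rfl⟩
        rw [Set.mem_insert_iff, not_or] at hc
        rcases hz with rfl | hz
        · exact Set.mem_insert _ _
        · exact Set.mem_insert_of_mem _ ⟨hc.2, z, hz, rfl⟩
      have h3 := Set.ncard_le_ncard hs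
      have h4 := Set.ncard_insert_le (β y) (unbased β S)
      omega

end Unbased

/-! ### Weak duality and complementary slackness -/

section Potential

variable {V : Type*} {G : SimpleGraph V} {M : G.Subgraph}

/-- A feasible dual solution: nested class functions `B j`, `j ≤ n`, and lower bounds `E`, `O` for
the lengths of even and odd alternating paths. -/
structure Dual (M : G.Subgraph) (n : ℕ) (B : ℕ → V → V) (E O : V → ℕ) : Prop where
  idem : ∀ j ≤ n, ∀ x, B j (B j x) = B j x
  mate : ∀ j ≤ n, ∀ x y, M.Adj x y → B j x ≠ x → B j y = B j x ∧ B j y ≠ y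
  matched : ∀ x y, M.Adj x y → E y ≤ O x + 1
  unmatched : ∀ x y, G.Adj x y → ¬ M.Adj x y →
    O y + 2 * ∑ j ∈ Finset.range (n + 1), ind (B j y ≠ y) ≤
      E x + 1 + 2 * ∑ j ∈ Finset.range (n + 1), ind (B j x = B j y)

variable {n : ℕ} {B : ℕ → V → V} {E O : V → ℕ}

/-- The vertices of a walk. -/
def vset {u v : V} (p : G.Walk u v) : Set V := {x | x ∈ p.support}

lemma vset_concat {u v w : V} (p : G.Walk u v) (h : G.Adj v w) :
    vset (p.concat h) = insert w (vset p) := by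
  ext x
  simp only [vset, Set.mem_ofPred_eq, mem_support_concat, Set.mem_insert_iff]
  tauto

/-- The bound for paths whose length has the parity of `k`. -/
def lev (E O : V → ℕ) (k : ℕ) (x : V) : ℕ := if k % 2 = 0 then E x else O x

/-- The total number of unbased classes. -/
noncomputable def totalUnbased (n : ℕ) (B : ℕ → V → V) (S : Set V) : ℕ :=
  ∑ j ∈ Finset.range (n + 1), (unbased (B j) S).ncard

/-- The path attains its lower bound. -/
def Tight (n : ℕ) (B : ℕ → V → V) (E O : V → ℕ) {b x : V} (p : G.Walk b x) : Prop :=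
  E b + p.length = lev E O p.length x + 2 * totalUnbased n B (vset p)

lemma lev_even {k : ℕ} (h : k % 2 = 0) (x : V) : lev E O k x = E x := by simp [lev, h]

lemma lev_odd {k : ℕ} (h : k % 2 = 1) (x : V) : lev E O k x = O x := by simp [lev, h]

namespace Dual

lemma unbased_matched (D : Dual M n B E O) {j : ℕ} (hj : j ≤ n) {x y : V} {S : Set V}
    (h : M.Adj x y) (hx : x ∈ S) : unbased (B j) (insert y S) ⊆ unbased (B j) S :=
  unbased_insert_subset hx fun hy => (D.mate j hj y x h.symm hy).1

variable [Finite V]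

/-- Mates share a class unless the new vertex is fixed, so no class is opened and only the
constraint `matched` is used. -/
lemma step_matched (D : Dual M n B E O) {u x y : V} {p : G.Walk u x} {h : G.Adj x y}
    (hl : p.length % 2 = 1) (hm : M.Adj x y) :
    lev E O (p.concat h).length y + 2 * totalUnbased n B (vset (p.concat h)) ≤
      lev E O p.length x + 2 * totalUnbased n B (vset p) + 1 := by
  rw [lev_odd hl, lev_even (by rw [Walk.length_concat]; omega), vset_concat]
  have h1 := D.matched x y hm
  have h2 : totalUnbased n B (insert y (vset p)) ≤ totalUnbased n B (vset p) :=
    Finset.sum_le_sum fun j hj => Set.ncard_le_ncard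
      (D.unbased_matched (by simpa [Nat.lt_succ_iff] using hj) hm p.end_mem_support)
  omega

/-- The change in the number of unbased classes is paid for, index by index, by the indicator sums
in the constraint `unmatched`. -/
lemma step_unmatched (D : Dual M n B E O) {u x y : V} {p : G.Walk u x} {h : G.Adj x y}
    (hl : p.length % 2 = 0) (hm : ¬ M.Adj x y) (hy : y ∉ p.support) :
    lev E O (p.concat h).length y + 2 * totalUnbased n B (vset (p.concat h)) ≤
      lev E O p.length x + 2 * totalUnbased n B (vset p) + 1 := by
  rw [lev_even hl, lev_odd (by rw [Walk.length_concat]; omega), vset_concat]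
  have h1 := D.unmatched x y h hm
  have h2 : totalUnbased n B (insert y (vset p)) + ∑ j ∈ Finset.range (n + 1), ind (B j x = B j y)
      ≤ totalUnbased n B (vset p) + ∑ j ∈ Finset.range (n + 1), ind (B j y ≠ y) := by
    unfold totalUnbased
    rw [← Finset.sum_add_distrib, ← Finset.sum_add_distrib]
    exact Finset.sum_le_sum fun j _ => ncard_unbased_insert_le p.end_mem_support hy
  omega

omit [Finite V] in
lemma unbased_start {b : V} (hb : ∀ j ≤ n, B j b = b) :
    totalUnbased n B (vset (Walk.nil : G.Walk b b)) = 0 := by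
  refine Finset.sum_eq_zero fun j hj => ?_
  have : unbased (B j) (vset (Walk.nil : G.Walk b b)) = ∅ := by
    ext c
    simp only [unbased, vset, Walk.support_nil, List.mem_singleton, Set.mem_ofPred_eq,
      Set.mem_empty_iff_false, iff_false]
    rintro ⟨h1, x, rfl, h2⟩
    exact h1 (h2 ▸ hb j (by simpa [Nat.lt_succ_iff] using hj))
  simp [this]

/-- Weak duality: the one-step inequalities add up along the path, and the potential starts at `E b`
because `b` is its own base at every index. -/
lemma bound (D : Dual M n B E O) {b x : V} (p : G.Walk b x) (hb : ∀ j ≤ n, B j b = b)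
    (hp : p.IsPath) (ha : Alt M false p) :
    lev E O p.length x + 2 * totalUnbased n B (vset p) ≤ E b + p.length := by
  induction p using Walk.concatRec with
  | Hnil => simp [unbased_start hb, lev]
  | @Hconcat u v w p h ih =>
    rw [Walk.concat_isPath_iff] at hp
    rw [alt_concat, Bool.false_xor, bodd_true_iff] at ha
    have h1 := ih hb hp.1 ha.1
    have h2 : (p.concat h).length = p.length + 1 := Walk.length_concat _ _
    rcases Nat.mod_two_eq_zero_or_one p.length with hl | hl
    · have := D.step_unmatched (h := h) hl (by rw [ha.2]; omega) hp.2
      omega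
    · have := D.step_matched (h := h) hl (ha.2.2 hl)
      omega

/-- The slack never decreases along a path, so zero slack at the end means zero slack before. -/
lemma tight_of_concat (D : Dual M n B E O) {b x y : V} {p : G.Walk b x} {h : G.Adj x y}
    (hb : ∀ j ≤ n, B j b = b) (hp : (p.concat h).IsPath) (ha : Alt M false (p.concat h))
    (ht : Tight n B E O (p.concat h)) : Tight n B E O p := by
  rw [Walk.concat_isPath_iff] at hp
  rw [alt_concat, Bool.false_xor, bodd_true_iff] at ha
  have h1 := D.bound p hb hp.1 ha.1
  have h2 : (p.concat h).length = p.length + 1 := Walk.length_concat _ _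
  unfold Tight at ht ⊢
  rcases Nat.mod_two_eq_zero_or_one p.length with hl | hl
  · have := D.step_unmatched (h := h) hl (by rw [ha.2]; omega) hp.2
    omega
  · have := D.step_matched (h := h) hl (ha.2.2 hl)
    omega

lemma tight_matched (D : Dual M n B E O) {b x y : V} {p : G.Walk b x} {h : G.Adj x y}
    (hb : ∀ j ≤ n, B j b = b) (hp : (p.concat h).IsPath) (ha : Alt M false (p.concat h))
    (ht : Tight n B E O (p.concat h)) (hl : p.length % 2 = 1) :
    M.Adj x y ∧ E y = O x + 1 ∧
      ∀ j ≤ n, unbased (B j) (vset (p.concat h)) = unbased (B j) (vset p) := by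
  have ht' := D.tight_of_concat hb hp ha ht
  rw [Walk.concat_isPath_iff] at hp
  rw [alt_concat, Bool.false_xor, bodd_true_iff] at ha
  have hm := ha.2.2 hl
  have h2 : (p.concat h).length = p.length + 1 := Walk.length_concat _ _
  unfold Tight at ht ht'
  rw [lev_even (by omega), vset_concat] at ht
  rw [lev_odd hl] at ht'
  have h3 := D.matched x y hm
  have hsub : ∀ j ∈ Finset.range (n + 1),
      unbased (B j) (insert y (vset p)) ⊆ unbased (B j) (vset p) := fun j hj =>
    D.unbased_matched (by simpa [Nat.lt_succ_iff] using hj) hm p.end_mem_support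
  have h4 : ∀ j ∈ Finset.range (n + 1),
      (unbased (B j) (insert y (vset p))).ncard ≤ (unbased (B j) (vset p)).ncard := fun j hj =>
    Set.ncard_le_ncard (hsub j hj)
  have h5 := Finset.sum_le_sum h4
  have h6 : totalUnbased n B (insert y (vset p)) = totalUnbased n B (vset p) := by
    unfold totalUnbased at *
    omega
  refine ⟨hm, by omega, fun j hj => ?_⟩
  have h7 := (Finset.sum_eq_sum_iff_of_le h4).1 h6 j (by simpa [Nat.lt_succ_iff] using hj)
  rw [vset_concat]
  exact Set.eq_of_subset_of_ncard_le (hsub j (by simpa [Nat.lt_succ_iff] using hj)) h7.ge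

/-- Complementary slackness: the step inequality is a sum of the dual constraint and one counting
inequality for each `j`, so tightness makes all of them equalities. -/
lemma tight_unmatched (D : Dual M n B E O) {b x y : V} {p : G.Walk b x} {h : G.Adj x y}
    (hb : ∀ j ≤ n, B j b = b) (hp : (p.concat h).IsPath) (ha : Alt M false (p.concat h))
    (ht : Tight n B E O (p.concat h)) (hl : p.length % 2 = 0) :
    ¬ M.Adj x y ∧
      O y + 2 * ∑ j ∈ Finset.range (n + 1), ind (B j y ≠ y) =
        E x + 1 + 2 * ∑ j ∈ Finset.range (n + 1), ind (B j x = B j y) ∧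
      ∀ j ≤ n, (unbased (B j) (vset (p.concat h))).ncard + ind (B j x = B j y) =
        (unbased (B j) (vset p)).ncard + ind (B j y ≠ y) := by
  have ht' := D.tight_of_concat hb hp ha ht
  rw [Walk.concat_isPath_iff] at hp
  rw [alt_concat, Bool.false_xor, bodd_true_iff] at ha
  have hm : ¬ M.Adj x y := by rw [ha.2]; omega
  have h2 : (p.concat h).length = p.length + 1 := Walk.length_concat _ _
  unfold Tight at ht ht'
  rw [lev_odd (by omega), vset_concat] at ht
  rw [lev_even hl] at ht'
  have h3 := D.unmatched x y h hm
  have h4 : ∀ j ∈ Finset.range (n + 1),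
      (unbased (B j) (insert y (vset p))).ncard + ind (B j x = B j y) ≤
        (unbased (B j) (vset p)).ncard + ind (B j y ≠ y) := fun j _ =>
    ncard_unbased_insert_le p.end_mem_support hp.2
  have h5 := Finset.sum_le_sum h4
  have h5' := h5
  rw [Finset.sum_add_distrib, Finset.sum_add_distrib] at h5'
  have h6 : ∑ j ∈ Finset.range (n + 1),
      ((unbased (B j) (insert y (vset p))).ncard + ind (B j x = B j y)) =
      ∑ j ∈ Finset.range (n + 1), ((unbased (B j) (vset p)).ncard + ind (B j y ≠ y)) := by
    rw [Finset.sum_add_distrib, Finset.sum_add_distrib]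
    unfold totalUnbased at *
    omega
  refine ⟨hm, ?_, fun j hj => ?_⟩
  · unfold totalUnbased at *
    omega
  · rw [vset_concat]
    exact (Finset.sum_eq_sum_iff_of_le h4).1 h6 j (by simpa [Nat.lt_succ_iff] using hj)

/-- A tight path ending in a class whose base it contains stays in the class after the base. -/
lemma exists_split (D : Dual M n B E O) {b x : V} (p : G.Walk b x) (hb : ∀ j ≤ n, B j b = b)
    (hp : p.IsPath) (ha : Alt M false p) (ht : Tight n B E O p) {j : ℕ} (hj : j ≤ n)
    (hc : B j x ∈ p.support) :
    ∃ (q : G.Walk b (B j x)) (r : G.Walk (B j x) x), p = q.append r ∧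
      ∀ z ∈ r.support, B j z = B j x := by
  induction p using Walk.concatRec with
  | @Hnil u =>
    have h0 : B j u = u := hb j hj
    rw [h0]
    exact ⟨.nil, .nil, rfl, by simp [h0]⟩
  | @Hconcat u v w p h ih =>
    by_cases h0 : B j w = w
    · rw [h0]
      exact ⟨p.concat h, .nil, by simp, by simp [h0]⟩
    · rw [mem_support_concat] at hc
      have hc' := hc.resolve_right h0
      have hvw : B j v = B j w := by
        rcases Nat.mod_two_eq_zero_or_one p.length with hl | hl
        · obtain ⟨-, -, h3⟩ := D.tight_unmatched hb hp ha ht hl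
          have h4 := h3 j hj
          -- The base of the class of `w` is already on the path, so coming from another class would
          -- not open it; the equality of slackness, however, demands one more unbased class.
          by_contra h5
          rw [ind_neg h5, ind_pos h0, vset_concat] at h4
          have : unbased (B j) (insert w (vset p)) ⊆ unbased (B j) (vset p) := by
            rintro c ⟨hc1, z, hz, rfl⟩
            rw [Set.mem_insert_iff, not_or] at hc1
            rcases hz with rfl | hz
            · exact absurd hc' hc1.2
            · exact ⟨hc1.2, z, hz, rfl⟩
          have := Set.ncard_le_ncard this
          omega
        · obtain ⟨h1, -, -⟩ := D.tight_matched hb hp ha ht hl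
          exact (D.mate j hj w v h1.symm h0).1
      obtain ⟨q, r, h1, h2⟩ := ih hb ((Walk.concat_isPath_iff h).1 hp).1
        ((alt_concat _ _ _).1 ha).1 (D.tight_of_concat hb hp ha ht) (by rwa [hvw])
      rw [← hvw]
      refine ⟨q, r.concat h, by rw [h1, Walk.append_concat], fun z hz => ?_⟩
      rcases (mem_support_concat _ _).1 hz with hz | rfl
      exacts [h2 z hz, hvw.symm]

/-- A tight even path to a base avoids the rest of the class of that base. -/
lemma eq_of_tight_even (D : Dual M n B E O) {b c : V} (p : G.Walk b c) (hb : ∀ j ≤ n, B j b = b)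
    (hp : p.IsPath) (ha : Alt M false p) (ht : Tight n B E O p) (hl : p.length % 2 = 0)
    {j : ℕ} (hj : j ≤ n) {z : V} (hz : z ∈ p.support) (hc : B j z = c) : z = c := by
  by_cases h0 : p.length = 0
  · cases p with
    | nil => simpa using hz
    | cons _ _ => simp at h0
  · obtain ⟨w, q, h, rfl⟩ := exists_eq_concat p h0
    rw [Walk.length_concat] at hl
    obtain ⟨h1, -, h3⟩ := D.tight_matched hb hp ha ht (by omega)
    rcases (mem_support_concat _ _).1 hz with hz | hz
    · exfalso
      -- Before its last, matched edge the path would have met the class of `c` without `c`; that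
      -- edge must not change the unbased classes, yet it adds `c`.
      have : c ∈ unbased (B j) (vset q) := ⟨((Walk.concat_isPath_iff h).1 hp).2, z, hz, hc⟩
      rw [← h3 j hj] at this
      exact this.1 (Walk.end_mem_support _)
    · exact hz

end Dual

end Potential

/-! ### Dominators in layered graphs with bridges -/

section Layered

variable {V : Type*} {R : V → V → Prop} {S : V → Prop} {m : V → ℕ}

/-- `DChain R S a l`: the list `l` starts with `a`, descends along `R` (where `R c a` says that `c`
is a predecessor of `a`) and ends in a source. -/
inductive DChain (R : V → V → Prop) (S : V → Prop) : V → List V → Prop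
  | base {a : V} : S a → DChain R S a [a]
  | step {c a : V} {l : List V} : R c a → DChain R S c l → DChain R S a (a :: l)

/-- `d` lies on every chain from `a`. -/
def Dom (R : V → V → Prop) (S : V → Prop) (d a : V) : Prop := ∀ l, DChain R S a l → d ∈ l

/-- Some chain starts at `a`. -/
def Reach (R : V → V → Prop) (S : V → Prop) (a : V) : Prop := ∃ l, DChain R S a l

namespace DChain

lemma head_mem {a : V} {l : List V} (h : DChain R S a l) : a ∈ l := by
  cases h <;> simp

lemma level (hm : ∀ c a, R c a → m c < m a) {a : V} {l : List V} (h : DChain R S a l) :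
    ∀ x ∈ l, x = a ∨ m x < m a := by
  induction h with
  | base _ => simp
  | @step c a l hc _ ih =>
    intro x hx
    rcases List.mem_cons.1 hx with hx | hx
    · exact Or.inl hx
    · right
      have := hm _ _ hc
      rcases ih x hx with rfl | h
      exacts [this, h.trans this]

lemma level_le (hm : ∀ c a, R c a → m c < m a) {a : V} {l : List V} (h : DChain R S a l) {x : V}
    (hx : x ∈ l) : m x ≤ m a := by
  rcases h.level hm x hx with rfl | h
  exacts [le_rfl, h.le]

lemma split (hm : ∀ c a, R c a → m c < m a) {a : V} {l : List V} (h : DChain R S a l) {x : V}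
    (hx : x ∈ l) : ∃ l₁ l₂, l = l₁ ++ l₂ ∧ DChain R S x l₂ ∧
      (∀ l', DChain R S x l' → DChain R S a (l₁ ++ l')) ∧ ∀ y ∈ l₁, m x < m y := by
  induction h with
  | @base a ha =>
    obtain rfl := List.mem_singleton.1 hx
    exact ⟨[], [x], rfl, .base ha, fun _ h => h, by simp⟩
  | @step c a l hc hl ih =>
    by_cases hxa : x = a
    · subst hxa
      exact ⟨[], x :: l, rfl, .step hc hl, fun _ h => h, by simp⟩
    · have hx' : x ∈ l := (List.mem_cons.1 hx).resolve_left hxa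
      obtain ⟨l₁, l₂, h1, h2, h3, h4⟩ := ih hx'
      refine ⟨a :: l₁, l₂, by rw [h1]; rfl, h2, fun l' h' => .step hc (h3 l' h'), ?_⟩
      intro y hy
      rcases List.mem_cons.1 hy with rfl | hy
      · exact (hl.level_le hm hx').trans_lt (hm _ _ hc)
      · exact h4 y hy

lemma exists_succ {a : V} {l : List V} (h : DChain R S a l) {x : V} (hx : x ∈ l) (hxa : x ≠ a) :
    ∃ y ∈ l, R x y := by
  induction h with
  | base _ => exact absurd (List.mem_singleton.1 hx) hxa
  | @step c a l hc hl ih =>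
    have hx' : x ∈ l := (List.mem_cons.1 hx).resolve_left hxa
    by_cases hxc : x = c
    · exact ⟨a, by simp, hxc ▸ hc⟩
    · obtain ⟨y, hy, h⟩ := ih hx' hxc
      exact ⟨y, List.mem_cons_of_mem _ hy, h⟩

lemma reach {a : V} {l : List V} (h : DChain R S a l) {x : V} (hx : x ∈ l) : Reach R S x := by
  induction h with
  | base h => exact ⟨_, .base (List.mem_singleton.1 hx ▸ h)⟩
  | @step c a l hc hl ih =>
    rcases List.mem_cons.1 hx with rfl | hx
    exacts [⟨_, .step hc hl⟩, ih hx]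

end DChain

lemma Dom.refl (a : V) : Dom R S a a := fun _ h => h.head_mem

lemma Dom.reach {d a : V} (h : Dom R S d a) (ha : Reach R S a) : Reach R S d := by
  obtain ⟨l, hl⟩ := ha
  exact hl.reach (h l hl)

lemma Dom.trans (hm : ∀ c a, R c a → m c < m a) {d b a : V} (h : Dom R S d b)
    (h' : Dom R S b a) : Dom R S d a := by
  intro l hl
  obtain ⟨l₁, l₂, rfl, h2, -, -⟩ := hl.split hm (h' l hl)
  exact List.mem_append_right _ (h l₂ h2)

/-- Dominators below a vertex of a chain dominate that vertex. -/
lemma Dom.of_mem (hm : ∀ c a, R c a → m c < m a) {d b a : V} {l : List V} (hl : DChain R S a l)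
    (hb : b ∈ l) (h : Dom R S d a) (hdb : m d ≤ m b) : Dom R S d b := by
  intro l' hl'
  obtain ⟨l₁, l₂, rfl, -, h3, h4⟩ := hl.split hm hb
  rcases List.mem_append.1 (h _ (h3 l' hl')) with h5 | h5
  · exact absurd (h4 d h5) (by omega)
  · exact h5

/-- Two vertices have chains to sources that are disjoint, or that meet only up to the level of a
common dominator. -/
lemma disjoint_or_dom (hm : ∀ c a, R c a → m c < m a) (N : ℕ) : ∀ a c : V, m a + m c < N →
    Reach R S a → Reach R S c →
    (∃ L K, DChain R S a L ∧ DChain R S c K ∧ ∀ x ∈ L, x ∉ K) ∨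
    ∃ b L K, Dom R S b a ∧ Dom R S b c ∧ DChain R S a L ∧ DChain R S c K ∧
      ∀ x ∈ L, x ∈ K → m x ≤ m b := by
  induction N with
  | zero => intro a c h; omega
  | succ N ih =>
    -- By symmetry it suffices to descend from the end of larger level.
    have key : ∀ a c : V, m a + m c < N + 1 → m c ≤ m a → Reach R S a → Reach R S c →
        (∃ L K, DChain R S a L ∧ DChain R S c K ∧ ∀ x ∈ L, x ∉ K) ∨
        ∃ b L K, Dom R S b a ∧ Dom R S b c ∧ DChain R S a L ∧ DChain R S c K ∧
          ∀ x ∈ L, x ∈ K → m x ≤ m b := by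
      intro a c hN hca ha hc
      by_cases hac : a = c
      · subst hac
        obtain ⟨l, hl⟩ := ha
        exact Or.inr ⟨a, l, l, Dom.refl a, Dom.refl a, hl, hl, fun x hx _ => hl.level_le hm hx⟩
      have hnot : ∀ K, DChain R S c K → a ∉ K := fun K hK haK => by
        rcases hK.level hm a haK with h | h
        exacts [hac h, absurd h (by omega)]
      obtain ⟨K₀, hK₀⟩ := hc
      by_cases hS : S a
      · exact Or.inl ⟨[a], K₀, .base hS, hK₀, by simpa using hnot K₀ hK₀⟩
      by_cases hdis : ∃ a' L K, R a' a ∧ DChain R S a' L ∧ DChain R S c K ∧ ∀ x ∈ L, x ∉ K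
      · obtain ⟨a', L, K, h1, h2, h3, h4⟩ := hdis
        refine Or.inl ⟨a :: L, K, .step h1 h2, h3, fun x hx => ?_⟩
        rcases List.mem_cons.1 hx with rfl | hx
        exacts [hnot K h3, h4 x hx]
      right
      have hpred : ∀ a', R a' a → Reach R S a' → ∃ b L K, Dom R S b a' ∧ Dom R S b c ∧
          DChain R S a' L ∧ DChain R S c K ∧ ∀ x ∈ L, x ∈ K → m x ≤ m b := by
        intro a' h1 h2
        have := hm _ _ h1
        rcases ih a' c (by omega) h2 ⟨K₀, hK₀⟩ with ⟨L, K, h3⟩ | h3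
        · exact absurd ⟨a', L, K, h1, h3⟩ hdis
        · exact h3
      -- Each predecessor of `a` has its own common dominator with `c`; one of lowest level
      -- dominates them all.
      let Q : ℕ → Prop := fun k => ∃ a' b L K, R a' a ∧ m b = k ∧ Dom R S b a' ∧ Dom R S b c ∧
          DChain R S a' L ∧ DChain R S c K ∧ ∀ x ∈ L, x ∈ K → m x ≤ m b
      have hQ : ∃ k, Q k := by
        obtain ⟨l, hl⟩ := ha
        cases hl with
        | base h => exact absurd h hS
        | @step a' _ l h1 h2 =>
          obtain ⟨b, L, K, h⟩ := hpred a' h1 ⟨l, h2⟩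
          exact ⟨m b, a', b, L, K, h1, rfl, h⟩
      classical
      obtain ⟨a', b, L, K, h1, h2, h3, h4, h5, h6, h7⟩ := Nat.find_spec hQ
      refine ⟨b, a :: L, K, ?_, h4, .step h1 h5, h6, ?_⟩
      · intro l hl
        cases hl with
        | base h => exact absurd h hS
        | @step a'' _ l h8 h9 =>
          obtain ⟨b', L', K', h10⟩ := hpred a'' h8 ⟨l, h9⟩
          have hle : m b ≤ m b' := by
            rw [h2]
            exact Nat.find_min' hQ ⟨a'', b', L', K', h8, rfl, h10⟩
          -- Both vertices dominate `c`, so they lie on one chain from `c`, and the lower one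
          -- dominates the higher one.
          have hbb : Dom R S b b' := Dom.of_mem hm hK₀ (h10.2.1 _ hK₀) h4 hle
          exact List.mem_cons_of_mem _ (hbb.trans hm h10.1 l h9)
      · intro x hx hxK
        rcases List.mem_cons.1 hx with rfl | hx
        exacts [absurd hxK (hnot K h6), h7 x hx hxK]
    intro a c hN ha hc
    rcases le_total (m c) (m a) with h | h
    · exact key a c hN h ha hc
    · rcases key c a (by omega) h hc ha with ⟨L, K, h1, h2, h3⟩ | ⟨b, L, K, h1, h2, h3, h4, h5⟩
      · exact Or.inl ⟨K, L, h2, h1, fun x hx hx' => h3 x hx' hx⟩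
      · exact Or.inr ⟨b, K, L, h2, h1, h4, h3, fun x hx hx' => h5 x hx' hx⟩

variable {Br : V → V → Prop}

/-- `z` lies on a chain from one end of a bridge whose part above `z` avoids a chain from the other
end. -/
def Merged (R : V → V → Prop) (S : V → Prop) (m : V → ℕ) (Br : V → V → Prop) (z : V) : Prop :=
  ∃ a c L K, Br a c ∧ DChain R S a L ∧ DChain R S c K ∧ z ∈ L ∧ ∀ x ∈ L, m z ≤ m x → x ∉ K

/-- Rerouting: climb from `z` along `L'` to the first vertex of `L` or `K`, then follow that chain
up to its end of the bridge. Above `b` the chains `L` and `K` are disjoint, so the new chain avoids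
the other one from the level of `z` upwards. -/
lemma merged_of_level_lt (hm : ∀ c a, R c a → m c < m a) (hsymm : ∀ a c, Br a c → Br c a)
    {a c b : V} (hbr : Br a c) {L K : List V} (hL : DChain R S a L) (hK : DChain R S c K)
    (hLK : ∀ x ∈ L, x ∈ K → m x ≤ m b) {L' : List V} (hL' : DChain R S a L') {z : V}
    (hz : z ∈ L') (hbz : m b < m z) : Merged R S m Br z := by
  classical
  let Q : ℕ → Prop := fun k => ∃ y ∈ L', (y ∈ L ∨ y ∈ K) ∧ m z ≤ m y ∧ m y = k
  have hQ : ∃ k, Q k :=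
    ⟨m a, a, hL'.head_mem, Or.inl hL.head_mem, hL'.level_le hm hz, rfl⟩
  obtain ⟨y, hy1, hy2, hy3, hy4⟩ := Nat.find_spec hQ
  obtain ⟨T₁, T₂, h1, h2, -, h4⟩ := hL'.split hm hy1
  have hzT : z ∈ T₂ := by
    rw [h1] at hz
    rcases List.mem_append.1 hz with h | h
    exacts [absurd (h4 z h) (by omega), h]
  have hT : ∀ x ∈ T₂, m z ≤ m x → x ∈ L ∨ x ∈ K → x = y := by
    intro x hx hzx hxLK
    have : m y ≤ m x := by
      rw [hy4]
      exact Nat.find_min' hQ ⟨x, by rw [h1]; exact List.mem_append_right _ hx, hxLK, hzx, rfl⟩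
    rcases h2.level hm x hx with h | h
    exacts [h, absurd h (by omega)]
  rcases hy2 with hy2 | hy2
  · obtain ⟨L₁, L₂, rfl, -, h5, h6⟩ := hL.split hm hy2
    refine ⟨a, c, L₁ ++ T₂, K, hbr, h5 _ h2, hK, List.mem_append_right _ hzT, ?_⟩
    intro x hx hzx hxK
    rcases List.mem_append.1 hx with hx | hx
    · exact absurd (hLK x (List.mem_append_left _ hx) hxK) (by omega)
    · obtain rfl := hT x hx hzx (Or.inr hxK)
      exact absurd (hLK x hy2 hxK) (by omega)
  · obtain ⟨K₁, K₂, rfl, -, h5, h6⟩ := hK.split hm hy2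
    refine ⟨c, a, K₁ ++ T₂, L, hsymm _ _ hbr, h5 _ h2, hL, List.mem_append_right _ hzT, ?_⟩
    intro x hx hzx hxL
    rcases List.mem_append.1 hx with hx | hx
    · exact absurd (hLK x hxL (List.mem_append_left _ hx)) (by omega)
    · obtain rfl := hT x hx hzx (Or.inl hxL)
      exact absurd (hLK x hxL hy2) (by omega)

/-- The dominators of `x` that are not merged. -/
def domSet (R : V → V → Prop) (S : V → Prop) (m : V → ℕ) (Br : V → V → Prop) (x : V) : Set V :=
  {d | Dom R S d x ∧ ¬ Merged R S m Br d}

/-- The highest dominator of `x` that is not merged. -/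
noncomputable def top (R : V → V → Prop) (S : V → Prop) (m : V → ℕ) (Br : V → V → Prop) (x : V) :
    V :=
  @Classical.epsilon V ⟨x⟩ fun d =>
    d ∈ domSet R S m Br x ∧ ∀ d' ∈ domSet R S m Br x, m d' ≤ m d

/-- A layered graph with bridges whose ends do not have disjoint chains to sources. -/
structure Layered (R : V → V → Prop) (S : V → Prop) (m : V → ℕ) (Br : V → V → Prop) : Prop where
  lt : ∀ c a, R c a → m c < m a
  symm : ∀ a c, Br a c → Br c a
  reach : ∀ a c, Br a c → Reach R S a
  meet : ∀ a c, Br a c → ∀ L K, DChain R S a L → DChain R S c K → ∃ x ∈ L, x ∈ K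

namespace Layered

lemma exists_dom (D : Layered R S m Br) {a c : V} (h : Br a c) :
    ∃ b L K, Dom R S b a ∧ Dom R S b c ∧ DChain R S a L ∧ DChain R S c K ∧
      ∀ x ∈ L, x ∈ K → m x ≤ m b := by
  rcases disjoint_or_dom D.lt _ a c (Nat.lt_succ_self _) (D.reach a c h)
    (D.reach c a (D.symm a c h)) with ⟨L, K, h1, h2, h3⟩ | h1
  · obtain ⟨x, hx, hx'⟩ := D.meet a c h L K h1 h2
    exact absurd hx' (h3 x hx)
  · exact h1

/-- An unmerged dominator of one end cannot lie above the common dominator `b`, since everything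
there is merged. So it dominates `b`, and hence the other end. -/
lemma domSet_bridge (D : Layered R S m Br) {a c : V} (h : Br a c) :
    domSet R S m Br a = domSet R S m Br c := by
  have key : ∀ a c, Br a c → domSet R S m Br a ⊆ domSet R S m Br c := by
    intro a c h d hd
    obtain ⟨b, L, K, h1, h2, h3, h4, h5⟩ := D.exists_dom h
    have hdb : m d ≤ m b := by
      by_contra hlt
      exact hd.2 (merged_of_level_lt D.lt D.symm h h3 h4 h5 h3 (hd.1 _ h3) (by omega))
    exact ⟨(Dom.of_mem D.lt h3 (h1 _ h3) hd.1 hdb).trans D.lt h2, hd.2⟩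
  exact Set.Subset.antisymm (key a c h) (key c a (D.symm a c h))

/-- If `x` is merged through a bridge, the common dominator of the ends lies strictly below `x` and
dominates it; iterate. -/
lemma domSet_nonempty (D : Layered R S m Br) (N : ℕ) :
    ∀ x, m x < N → Reach R S x → (domSet R S m Br x).Nonempty := by
  induction N with
  | zero => intro x h; omega
  | succ N ih =>
    intro x hN hx
    by_cases hmx : Merged R S m Br x
    · obtain ⟨a, c, L, K, h1, h2, h3, h4, h5⟩ := hmx
      obtain ⟨b, L', K', h6, h7, -, -, -⟩ := D.exists_dom h1
      have hlt : m b < m x := by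
        by_contra hle
        exact h5 b (h6 L h2) (by omega) (h7 K h3)
      have hbx : Dom R S b x := Dom.of_mem D.lt h2 h4 h6 hlt.le
      obtain ⟨d, hd⟩ := ih b (by omega) (h6.reach ⟨L, h2⟩)
      exact ⟨d, hd.1.trans D.lt hbx, hd.2⟩
    · exact ⟨x, Dom.refl x, hmx⟩

variable [Finite V]

lemma top_spec (D : Layered R S m Br) {x : V} (hx : Reach R S x) :
    top R S m Br x ∈ domSet R S m Br x ∧ ∀ d ∈ domSet R S m Br x, m d ≤ m (top R S m Br x) := by
  obtain ⟨d, hd, h⟩ := Set.exists_max_image (domSet R S m Br x) m (Set.toFinite _)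
    (D.domSet_nonempty _ x (Nat.lt_succ_self _) hx)
  exact @Classical.epsilon_spec V (fun d =>
    d ∈ domSet R S m Br x ∧ ∀ d' ∈ domSet R S m Br x, m d' ≤ m d) ⟨d, hd, h⟩

lemma reach_top (D : Layered R S m Br) {x : V} (hx : Reach R S x) : Reach R S (top R S m Br x) :=
  (D.top_spec hx).1.1.reach hx

lemma top_eq_self (D : Layered R S m Br) {x : V} (hx : Reach R S x) (h : ¬ Merged R S m Br x) :
    top R S m Br x = x := by
  obtain ⟨h1, h2⟩ := D.top_spec hx
  obtain ⟨l, hl⟩ := hx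
  rcases hl.level D.lt _ (h1.1 l hl) with h3 | h3
  · exact h3
  · exact absurd (h2 x ⟨Dom.refl x, h⟩) (by omega)

lemma merged_of_top_ne (D : Layered R S m Br) {x : V} (hx : Reach R S x)
    (h : top R S m Br x ≠ x) : Merged R S m Br x := by
  by_contra h'
  exact h (D.top_eq_self hx h')

lemma top_ne_of_merged (D : Layered R S m Br) {x : V} (hx : Reach R S x)
    (h : Merged R S m Br x) : top R S m Br x ≠ x := fun h' =>
  (D.top_spec hx).1.2 (h'.symm ▸ h)

lemma top_top (D : Layered R S m Br) {x : V} (hx : Reach R S x) :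
    top R S m Br (top R S m Br x) = top R S m Br x :=
  D.top_eq_self (D.reach_top hx) (D.top_spec hx).1.2

-- The choice in `top` depends on the vertex only through its set of unmerged dominators, so equal
-- sets give the same vertex and not merely one of the same level.
omit [Finite V] in
lemma top_congr {x y : V} (h : domSet R S m Br x = domSet R S m Br y) :
    top R S m Br x = top R S m Br y := by
  unfold top
  rw [h]

omit [Finite V] in
lemma top_bridge (D : Layered R S m Br) {a c : V} (h : Br a c) :
    top R S m Br a = top R S m Br c := top_congr (D.domSet_bridge h)

-- A chain from an end of the bridge through `x` and `c` exists. An unmerged dominator of `c` lies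
-- on it, hence not above the common dominator `b` of the ends; as `b` dominates `x`, so does that
-- vertex. Conversely, an unmerged dominator of `x` is not `x` itself, so it survives on the chains
-- from `c`.
omit [Finite V] in
lemma domSet_pred (D : Layered R S m Br) {x c : V} (hR : R c x) (hc : Reach R S c) (hmx : Merged R S m Br x) :
    domSet R S m Br c = domSet R S m Br x := by
  obtain ⟨a, a', L, K, h1, h2, h3, h4, h5⟩ := id hmx
  obtain ⟨b, L', K', h6, h7, h8, h9, h10⟩ := D.exists_dom h1
  have hlt : m b < m x := by
    by_contra hle
    exact h5 b (h6 L h2) (by omega) (h7 K h3)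
  have hbx : Dom R S b x := Dom.of_mem D.lt h2 h4 h6 hlt.le
  obtain ⟨L₁, L₂, -, -, h11, -⟩ := h2.split D.lt h4
  ext d
  constructor
  · rintro ⟨hd, hd'⟩
    refine ⟨fun l hl => ?_, hd'⟩
    · obtain ⟨lc, hlc⟩ := hc
      have hch := h11 _ (.step hR hlc)
      have hdb : m d ≤ m b := by
        by_contra h
        exact hd' (merged_of_level_lt D.lt D.symm h1 h8 h9 h10 hch
          (List.mem_append_right _ (List.mem_cons_of_mem _ (hd _ hlc))) (by omega))
      have hbc : b ∈ lc := by
        rcases List.mem_cons.1 (hbx _ (.step hR hlc)) with rfl | h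
        exacts [absurd hlt (lt_irrefl _), h]
      exact (Dom.of_mem D.lt hlc hbc hd hdb).trans D.lt hbx l hl
  · rintro ⟨hd, hd'⟩
    refine ⟨fun l hl => ?_, hd'⟩
    rcases List.mem_cons.1 (hd _ (.step hR hl)) with rfl | h
    exacts [absurd hmx hd', h]

-- The vertices `x` and `x'` always occur together: a chain through `x` continues to `x'`, and a
-- chain from the other end can reach `x'` only through `x`. This is the situation of an outer
-- vertex and its inner mate.
omit [Finite V] in
lemma merged_pred (D : Layered R S m Br) {x x' : V} (hS : ¬ S x) (hR : R x' x)
    (hpred : ∀ c, R c x → c = x') (hsucc : ∀ a, R x' a → a = x) (hbr : ∀ a, ¬ Br a x')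
    (h : Merged R S m Br x) : Merged R S m Br x' := by
  obtain ⟨a, c, L, K, h1, h2, h3, h4, h5⟩ := h
  obtain ⟨L₁, L₂, rfl, h6, -, h8⟩ := h2.split D.lt h4
  cases h6 with
  | base h => exact absurd h hS
  | @step c' _ l h9 h10 =>
    obtain rfl := hpred _ h9
    refine ⟨a, c, _, K, h1, h2, h3,
      List.mem_append_right _ (List.mem_cons_of_mem _ h10.head_mem), fun y hy hle hyK => ?_⟩
    rcases List.mem_append.1 hy with hy' | hy'
    · exact h5 y hy (h8 y hy').le hyK
    rcases List.mem_cons.1 hy' with rfl | hy'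
    · exact h5 y hy le_rfl hyK
    rcases h10.level D.lt y hy' with rfl | h
    · have hyc : y ≠ c := fun h => hbr a (h ▸ h1)
      obtain ⟨z, hz, hyz⟩ := h3.exists_succ hyK hyc
      obtain rfl := hsucc z hyz
      exact h5 z h4 le_rfl hz
    · omega

omit [Finite V] in
lemma merged_succ (D : Layered R S m Br) {x x' : V} (hsucc : ∀ a, R x' a → a = x)
    (hbr : ∀ a, ¬ Br a x') (h : Merged R S m Br x') : Merged R S m Br x := by
  obtain ⟨a, c, L, K, h1, h2, h3, h4, h5⟩ := h
  obtain ⟨z, hz, hxz⟩ := h2.exists_succ h4 (fun h => hbr c (h ▸ D.symm _ _ h1))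
  obtain rfl := hsucc z hxz
  have := D.lt _ _ hxz
  exact ⟨a, c, L, K, h1, h2, h3, hz, fun x hx hle => h5 x hx (by omega)⟩

end Layered

end Layered

/-! ### The dual solution at stage `n` and its consequences -/

section Bounds

variable {V : Type*} {G : SimpleGraph V} {M : G.Subgraph}

/-- The lower bound for even path lengths at stage `n`. -/
noncomputable def eBd (n : ℕ) (B : ℕ → V → V) (e o : V → ℕ) (x : V) : ℕ :=
  open Classical in
  -- Moved vertices keep their true levels. For a fixed vertex the two bounds add up to `2n + 1`: an
  -- outer one has its even level truncated at `n + 1`, and for an inner one `oBd` becomes its odd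
  -- level truncated at `n`.
  if B n x ≠ x then e x else if e x < o x then min (e x) (n + 1) else max (2 * n + 1 - o x) (n + 1)

/-- The lower bound for odd path lengths at stage `n`. -/
noncomputable def oBd (n : ℕ) (B : ℕ → V → V) (e o : V → ℕ) (x : V) : ℕ :=
  open Classical in if B n x ≠ x then o x else 2 * n + 1 - eBd n B e o x

variable {n : ℕ} {B : ℕ → V → V} {K : ℕ} {e o : V → ℕ} {x : V}

lemma eBd_ne (h : B n x ≠ x) : eBd n B e o x = e x := by simp [eBd, h]

lemma eBd_outer (h : B n x = x) (h' : e x < o x) : eBd n B e o x = min (e x) (n + 1) := by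
  simp [eBd, h, h']

lemma eBd_inner (h : B n x = x) (h' : ¬ e x < o x) :
    eBd n B e o x = max (2 * n + 1 - o x) (n + 1) := by
  rw [eBd, if_neg (not_not.2 h), if_neg h']

lemma oBd_ne (h : B n x ≠ x) : oBd n B e o x = o x := by simp [oBd, h]

lemma oBd_eq (h : B n x = x) : oBd n B e o x = 2 * n + 1 - eBd n B e o x := by simp [oBd, h]

lemma eBd_le_of_eq (h : B n x = x) : eBd n B e o x ≤ 2 * n + 1 := by
  by_cases h' : e x < o x
  · rw [eBd_outer h h']; omega
  · rw [eBd_inner h h']; omega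

lemma sum_ind_le {Q : ℕ → Prop} {a : ℕ} (n : ℕ) (ha : a ≤ n + 1)
    (h : ∀ j ≤ n, Q j → a ≤ j) :
    ∑ j ∈ Finset.range (n + 1), ind (Q j) ≤ n + 1 - a := by
  induction n with
  | zero =>
    rw [Finset.sum_range_one]
    by_cases h0 : Q 0
    · have := h 0 le_rfl h0; rw [ind_pos h0]; omega
    · rw [ind_neg h0]; omega
  | succ n ih =>
    rw [Finset.sum_range_succ]
    by_cases h0 : Q (n + 1)
    · rw [ind_pos h0]
      have := h _ le_rfl h0
      have := ih (by omega) fun j hj => h j (by omega)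
      omega
    · rw [ind_neg h0]
      rcases Nat.lt_or_ge (n + 1) a with h1 | h1
      · rw [Finset.sum_eq_zero fun j hj => ?_]
        · omega
        · rw [ind_neg fun hq => ?_]
          rw [Finset.mem_range] at hj
          have := h j (by omega) hq
          omega
      · have := ih h1 fun j hj => h j (by omega)
        omega

lemma sum_ind_eq_zero {Q : ℕ → Prop} (n : ℕ) (h : ∀ j ≤ n, ¬ Q j) :
    ∑ j ∈ Finset.range (n + 1), ind (Q j) = 0 :=
  Finset.sum_eq_zero fun j hj => ind_neg (h j (by simpa [Nat.lt_succ_iff] using hj))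

/-- The class functions `B j` for tenacities less than `2j`, `j ≤ n`, together with the dual
feasibility they guarantee. -/
structure PreStage (M : G.Subgraph) (e o : V → ℕ) (n : ℕ) (B : ℕ → V → V) : Prop where
  zero : ∀ x, B 0 x = x
  idem : ∀ j ≤ n, ∀ x, B j (B j x) = B j x
  nested : ∀ j k, j ≤ k → k ≤ n → ∀ x, B k (B j x) = B k x
  mono : ∀ j k, j ≤ k → k ≤ n → ∀ x, B j x ≠ x → B k x ≠ x
  ten : ∀ j ≤ n, ∀ x, B j x ≠ x → e x + o x + 1 ≤ 2 * j
  mate : ∀ j ≤ n, ∀ x y, M.Adj x y → B j x ≠ x → B j y = B j x ∧ B j y ≠ y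
  matched : ∀ x y, M.Adj x y → B n x = x →
    eBd n B e o x + eBd n B e o y ≤ 2 * n + 2
  unmatched : ∀ x y, G.Adj x y → ¬ M.Adj x y →
    2 * n + 1 ≤ eBd n B e o x + eBd n B e o y + 1 +
      2 * ∑ j ∈ Finset.range (n + 1), ind (B j x = B j y)

/-- A `PreStage` whose class functions move all vertices of small tenacity. -/
structure Stage (M : G.Subgraph) (e o : V → ℕ) (n : ℕ) (B : ℕ → V → V) : Prop
    extends PreStage M e o n B where
  ten_iff : ∀ j ≤ n, ∀ x, e x + o x + 1 ≤ 2 * j → B j x ≠ x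

lemma stage_zero : Stage M e o 0 (fun _ x => x) where
  zero _ := rfl
  idem _ _ _ := rfl
  nested _ _ _ _ _ := rfl
  mono _ _ _ _ _ h := absurd rfl h
  ten _ _ _ h := absurd rfl h
  mate _ _ _ _ _ h := absurd rfl h
  matched x y _ _ := by
    have := eBd_le_of_eq (n := 0) (B := fun _ x => x) (e := e) (o := o) (x := x) rfl
    have := eBd_le_of_eq (n := 0) (B := fun _ x => x) (e := e) (o := o) (x := y) rfl
    omega
  unmatched x y _ _ := by omega
  ten_iff j hj x h := by omega

namespace PreStage

lemma base_of_le (S : PreStage M e o n B) {j : ℕ} (hj : j ≤ n) (h : B n x = x) : B j x = x := by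
  by_contra h'
  exact S.mono j n hj le_rfl x h' h

/-- A moved vertex of tenacity `τ` is moved only for `j ≥ (τ + 1) / 2`, at most `n + 1 - (τ + 1) /
2` times. This turns the symmetric edge condition of `PreStage` into the directed constraint of
`Dual`. -/
lemma oBd_add_le (S : PreStage M e o n B) (L : LevelData M K e o) (y : V) :
    oBd n B e o y + eBd n B e o y + 2 * ∑ j ∈ Finset.range (n + 1), ind (B j y ≠ y) ≤
      2 * n + 1 := by
  by_cases hy : B n y = y
  · have := eBd_le_of_eq (e := e) (o := o) hy
    rw [sum_ind_eq_zero n fun j hj => not_not.2 (S.base_of_le hj hy), oBd_eq hy]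
    omega
  · rw [oBd_ne hy, eBd_ne hy]
    have h3 := S.ten n le_rfl y hy
    have h4 := L.e_mod y
    have h5 := L.o_mod y
    have := sum_ind_le (Q := fun j => B j y ≠ y) (a := (e y + o y + 1) / 2) n (by omega)
      fun j hj hq => by
        have := S.ten j hj y hq
        omega
    omega

lemma dual (S : PreStage M e o n B) (L : LevelData M K e o) (hM : M.IsMatching) (hK : n + 2 ≤ K) :
    Dual M n B (eBd n B e o) (oBd n B e o) where
  idem := S.idem
  mate := S.mate
  matched x y h := by
    by_cases hx : B n x = x
    · have := S.matched x y h hx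
      have := eBd_le_of_eq (e := e) (o := o) hx
      rw [oBd_eq hx]
      omega
    · have hy := (S.mate n le_rfl x y h hx).2
      rw [oBd_ne hx, eBd_ne hy]
      have := L.mate hM (by omega) h
      have := S.ten n le_rfl x hx
      omega
  unmatched x y h hn := by
    have h1 := S.unmatched x y h hn
    have h2 := S.oBd_add_le L y
    omega

lemma base_free (S : PreStage M e o n B) (hf : ∀ f, IsUnmatched M f → 2 * n ≤ o f) {f : V}
    (h : IsUnmatched M f) : ∀ j ≤ n, B j f = f := by
  intro j hj
  by_contra h'
  have := S.ten j hj f h'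
  have := hf f h
  omega

lemma eBd_free (S : PreStage M e o n B) (L : LevelData M K e o)
    (hf : ∀ f, IsUnmatched M f → 2 * n ≤ o f) {f : V} (h : IsUnmatched M f) :
    eBd n B e o f = 0 := by
  have h1 := S.base_free hf h n le_rfl
  have h2 := L.e_free h
  have h3 := L.o_mod f
  rw [eBd_outer h1 (by omega)]
  omega

variable [Finite V]

lemma bound (S : PreStage M e o n B) (L : LevelData M K e o) (hM : M.IsMatching) (hK : n + 2 ≤ K)
    (hf : ∀ f, IsUnmatched M f → 2 * n ≤ o f) {f x : V} (p : G.Walk f x) (hp : FreePath M p) :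
    lev (eBd n B e o) (oBd n B e o) p.length x + 2 * totalUnbased n B (vset p) ≤ p.length := by
  have := (S.dual L hM hK).bound p (S.base_free hf hp.1) hp.2.1 hp.2.2
  rw [S.eBd_free L hf hp.1] at this
  omega

lemma eBd_le (S : PreStage M e o n B) (L : LevelData M K e o) (hM : M.IsMatching) (hK : n + 2 ≤ K)
    (hf : ∀ f, IsUnmatched M f → 2 * n ≤ o f) (hx : e x < 2 * K) : eBd n B e o x ≤ e x := by
  obtain ⟨f, p, hp, hl⟩ := L.e_att x hx
  have := S.bound L hM hK hf p hp
  rw [lev_even (by rw [hl]; exact L.e_mod x)] at this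
  omega

lemma oBd_le (S : PreStage M e o n B) (L : LevelData M K e o) (hM : M.IsMatching) (hK : n + 2 ≤ K)
    (hf : ∀ f, IsUnmatched M f → 2 * n ≤ o f) (hx : o x < 2 * K) : oBd n B e o x ≤ o x := by
  obtain ⟨f, p, hp, hl⟩ := L.o_att x hx
  have := S.bound L hM hK hf p hp
  rw [lev_odd (by rw [hl]; exact L.o_mod x)] at this
  omega

/-- The bounds of a fixed vertex add up to `2n + 1` and by weak duality lie below its finite levels.
This is how a new stage is seen to move every vertex it should. -/
lemma le_tenacity (S : PreStage M e o n B) (L : LevelData M K e o) (hM : M.IsMatching)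
    (hK : n + 2 ≤ K) (hf : ∀ f, IsUnmatched M f → 2 * n ≤ o f) (hx : B n x = x) :
    2 * n + 1 ≤ e x + o x := by
  by_contra h
  have h1 := S.eBd_le L hM hK hf (x := x) (by omega)
  have h2 := S.oBd_le L hM hK hf (x := x) (by omega)
  have := eBd_le_of_eq (e := e) (o := o) hx
  rw [oBd_eq hx] at h2
  omega

/-- A path no longer than the bound at its end leaves no room for unbased classes, so the base of
every class it meets lies on it. -/
lemma tight_of_le (S : PreStage M e o n B) (L : LevelData M K e o) (hM : M.IsMatching)
    (hK : n + 2 ≤ K) (hf : ∀ f, IsUnmatched M f → 2 * n ≤ o f) {f x : V} (p : G.Walk f x)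
    (hp : FreePath M p) (hl : p.length ≤ lev (eBd n B e o) (oBd n B e o) p.length x) :
    Tight n B (eBd n B e o) (oBd n B e o) p ∧ ∀ j ≤ n, unbased (B j) (vset p) = ∅ := by
  have h := S.bound L hM hK hf p hp
  have h0 : totalUnbased n B (vset p) = 0 := by omega
  refine ⟨?_, fun j hj => ?_⟩
  · unfold Tight
    rw [S.eBd_free L hf hp.1]
    omega
  · unfold totalUnbased at h0
    rw [Finset.sum_eq_zero_iff] at h0
    exact (Set.ncard_eq_zero (Set.toFinite _)).1 (h0 j (by simpa [Nat.lt_succ_iff] using hj))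

end PreStage

lemma mem_of_unbased_eq_empty {β : V → V} {S : Set V} (h : unbased β S = ∅) {x : V} (hx : x ∈ S) :
    β x ∈ S := by
  by_contra h'
  have : β x ∈ unbased β S := ⟨h', x, hx, rfl⟩
  simp [h] at this

/-- The standing assumptions at stage `n`. -/
structure Setting (M : G.Subgraph) (K : ℕ) (e o : V → ℕ) (n : ℕ) (B : ℕ → V → V) : Prop where
  stage : Stage M e o n B
  level : LevelData M K e o
  matching : M.IsMatching
  large : n + 2 ≤ K
  free : ∀ f, IsUnmatched M f → 2 * n ≤ o f

namespace Setting

lemma tau (W : Setting M K e o n B) {j : ℕ} (hj : j ≤ n) (h : B j x = x) :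
    2 * j + 1 ≤ e x + o x := by
  by_contra h'
  have := W.level.e_mod x
  have := W.level.o_mod x
  exact W.stage.ten_iff j hj x (by omega) h

lemma tau_le (W : Setting M K e o n B) {j : ℕ} (hj : j ≤ n) (h : B j x ≠ x) :
    e x + o x + 1 ≤ 2 * j := W.stage.ten j hj x h

lemma dual (W : Setting M K e o n B) : Dual M n B (eBd n B e o) (oBd n B e o) :=
  W.stage.toPreStage.dual W.level W.matching W.large

lemma lev_eq_of_ne (h : B n x ≠ x) {k : ℕ} (hk : k % 2 = 0 → k = e x) (hk' : k % 2 = 1 → k = o x) :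
    lev (eBd n B e o) (oBd n B e o) k x = k := by
  rcases Nat.mod_two_eq_zero_or_one k with h1 | h1
  · rw [lev_even h1, eBd_ne h, hk h1]
  · rw [lev_odd h1, oBd_ne h, hk' h1]

variable [Finite V]

lemma tight_of_ne (W : Setting M K e o n B) (h : B n x ≠ x) {f : V} (p : G.Walk f x)
    (hp : FreePath M p) (hk : p.length % 2 = 0 → p.length = e x)
    (hk' : p.length % 2 = 1 → p.length = o x) :
    Tight n B (eBd n B e o) (oBd n B e o) p ∧ ∀ j ≤ n, unbased (B j) (vset p) = ∅ :=
  W.stage.toPreStage.tight_of_le W.level W.matching W.large W.free p hp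
    (lev_eq_of_ne h hk hk').ge

lemma tight_outer (W : Setting M K e o n B) (h : B n x = x → e x ≤ n) {f : V} (p : G.Walk f x)
    (hp : FreePath M p) (hk : p.length = e x) :
    Tight n B (eBd n B e o) (oBd n B e o) p ∧ ∀ j ≤ n, unbased (B j) (vset p) = ∅ := by
  refine W.stage.toPreStage.tight_of_le W.level W.matching W.large W.free p hp ?_
  have h2 := W.level.e_mod x
  rw [lev_even (by omega)]
  by_cases h1 : B n x = x
  · have := W.tau le_rfl h1
    have := h h1
    rw [eBd_outer h1 (by omega)]
    omega
  · rw [eBd_ne h1, hk]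

lemma exists_split (W : Setting M K e o n B) {j : ℕ} (hj : j ≤ n) (hx : B j x ≠ x) {f : V}
    (p : G.Walk f x) (hp : FreePath M p) (hk : p.length % 2 = 0 → p.length = e x)
    (hk' : p.length % 2 = 1 → p.length = o x) :
    ∃ (q : G.Walk f (B j x)) (r : G.Walk (B j x) x), p = q.append r ∧ q.length % 2 = 0 ∧
      ∀ z ∈ r.support, B j z = B j x := by
  have hn := W.stage.mono j n hj le_rfl x hx
  obtain ⟨h1, h2⟩ := W.tight_of_ne hn p hp hk hk'
  obtain ⟨q, r, h3, h4⟩ := W.dual.exists_split p (W.stage.base_free W.free hp.1) hp.2.1 hp.2.2 h1 hj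
    (mem_of_unbased_eq_empty (h2 j hj) p.end_mem_support)
  refine ⟨q, r, h3, ?_, h4⟩
  subst h3
  have hr : r.IsPath := hp.2.1.of_append_right
  have ha := ((alt_append _ _ _).1 hp.2.2).2
  by_contra hodd
  have hb : q.length.bodd = true := (bodd_true_iff _).2 (by omega)
  -- If the base were reached at an odd position, the path would leave it along its matched edge to
  -- a moved vertex of the class; mates are moved together, but the base is fixed.
  have : ∀ (c : V) (r : G.Walk c x), c ≠ x → r.IsPath → Alt M true r → B j c = c →
      (∀ z ∈ r.support, B j z = c) → False := by
    intro c r hc hr ha hcc hz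
    cases r with
    | nil => exact hc rfl
    | @cons _ y _ h r =>
      rw [alt_cons] at ha
      have hy : B j y = c := hz y (by simp)
      have := W.stage.mate j hj y c (ha.1.2 rfl).symm (by rw [hy]; exact h.ne)
      exact this.2 hcc
  exact this _ r hx hr (by simpa [hb] using ha) (W.stage.idem j hj x) h4

/-- The base lies at an even position on level paths of both parities, so its even level is at most
the smaller level of `x`, which is at most `j - 1`; its tenacity is at least `2j + 1`. -/
lemma base_outer (W : Setting M K e o n B) {j : ℕ} (hj : j ≤ n) (hx : B j x ≠ x) :
    e (B j x) + 1 ≤ j ∧ j + 2 ≤ o (B j x) ∧ e (B j x) ≤ e x ∧ e (B j x) ≤ o x := by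
  have h1 := W.tau_le hj hx
  have h2 := W.tau hj (W.stage.idem j hj x)
  have hK := W.large
  have key : ∀ (f : V) (p : G.Walk f x), FreePath M p → (p.length % 2 = 0 → p.length = e x) →
      (p.length % 2 = 1 → p.length = o x) → e (B j x) ≤ p.length := by
    intro f p hp hk hk'
    obtain ⟨q, r, rfl, h3, -⟩ := W.exists_split hj hx p hp hk hk'
    have := W.level.e_le q hp.prefix h3
    have := Walk.length_append q r
    omega
  have hem := W.level.e_mod x
  have hom := W.level.o_mod x
  obtain ⟨f, p, hp, hl⟩ := W.level.e_att x (by omega)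
  obtain ⟨f', p', hp', hl'⟩ := W.level.o_att x (by omega)
  have := key f p hp (by omega) (by omega)
  have := key f' p' hp' (by omega) (by omega)
  omega

/-- An even level path of a base meets the class only in the base. -/
lemma eq_base_of_mem (W : Setting M K e o n B) {j : ℕ} (hj : j ≤ n) (hx : B j x ≠ x) {f : V}
    (q : G.Walk f (B j x)) (hq : FreePath M q) (hl : q.length = e (B j x)) {z : V}
    (hz : z ∈ q.support) (hzx : B j z = B j x) : z = B j x := by
  have h1 := W.base_outer hj hx
  have h2 := W.level.e_mod (B j x)
  obtain ⟨ht, -⟩ := W.tight_outer (x := B j x) (fun _ => by omega) q hq hl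
  exact W.dual.eq_of_tight_even q (W.stage.base_free W.free hq.1) hq.2.1 hq.2.2 ht (by omega) hj
    hz hzx

/-- Level paths split at the base into an even level path of the base and a path in the class. -/
lemma split (W : Setting M K e o n B) {j : ℕ} (hj : j ≤ n) (hx : B j x ≠ x) {f : V}
    (p : G.Walk f x) (hp : FreePath M p) (hk : p.length % 2 = 0 → p.length = e x)
    (hk' : p.length % 2 = 1 → p.length = o x) :
    ∃ (q : G.Walk f (B j x)) (r : G.Walk (B j x) x), p = q.append r ∧ q.length = e (B j x) ∧
      ∀ z ∈ r.support, B j z = B j x := by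
  obtain ⟨q, r, rfl, h3, h4⟩ := W.exists_split hj hx p hp hk hk'
  refine ⟨q, r, rfl, ?_, h4⟩
  have h5 := W.base_outer hj hx
  have hK := W.large
  have h6 := W.level.e_le q hp.prefix h3
  obtain ⟨g, q', hq', hl'⟩ := W.level.e_att (B j x) (by omega)
  have hm := W.level.e_mod (B j x)
  have ha := ((alt_append _ _ _).1 hp.2.2).2
  rw [(bodd_false_iff _).2 h3] at ha
  -- Exchange: a shortest even path to the base meets the class only there, so it can replace `q`,
  -- and minimality of the whole path forces `q` to be shortest.
  have hnew : FreePath M (q'.append r) := by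
    refine ⟨hq'.1, isPath_append hq'.2.1 hp.2.1.of_append_right fun z hz hz' =>
      W.eq_base_of_mem hj hx q' hq' hl' hz (h4 z hz'), (alt_append _ _ _).2 ⟨hq'.2.2, ?_⟩⟩
    rw [(bodd_false_iff _).2 (by omega)]
    exact ha
  have hl1 := Walk.length_append q r
  have hl2 := Walk.length_append q' r
  rcases Nat.mod_two_eq_zero_or_one r.length with h | h
  · have := W.level.e_le _ hnew (by omega)
    have := hk (by omega)
    omega
  · have := W.level.o_le _ hnew (by omega)
    have := hk' (by omega)
    omega

lemma hasAlt_class (W : Setting M K e o n B) {j : ℕ} (hj : j ≤ n) (x : V) (hK : e x < 2 * K) :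
    HasAlt M false (e x - e (B j x)) {z | B j z = B j x} (B j x) x := by
  by_cases hx : B j x = x
  · rw [hx]
    simpa using HasAlt.nil (M := M) false (X := {z | B j z = x}) (u := x) (by simpa using hx)
  · obtain ⟨f, p, hp, hl⟩ := W.level.e_att x hK
    have hm := W.level.e_mod x
    obtain ⟨q, r, rfl, h1, h2⟩ := W.split hj hx p hp (by omega) (by omega)
    have ha := ((alt_append _ _ _).1 hp.2.2).2
    have hm' := W.level.e_mod (B j x)
    rw [(bodd_false_iff _).2 (by omega)] at ha
    have hl1 := Walk.length_append q r
    exact ⟨r, hp.2.1.of_append_right, by simpa using ha, by omega, h2⟩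

end Setting

end Bounds

/-! ### The layered graph of contracted classes -/

section Extension

variable {V : Type*} {G : SimpleGraph V} {M : G.Subgraph} {n : ℕ} {B : ℕ → V → V} {K : ℕ}
  {e o : V → ℕ} {x : V}

/-- The vertices of tenacity at least `2n + 1` with a level at most `n`. -/
def Node (e o : V → ℕ) (n : ℕ) (B : ℕ → V → V) (x : V) : Prop := B n x = x ∧ (e x ≤ n ∨ o x ≤ n)

/-- The smaller of the two levels. -/
def mlev (e o : V → ℕ) (x : V) : ℕ := min (e x) (o x)

/-- `c` is the class preceding `a` on some shortest path. -/
def PredOf (M : G.Subgraph) (e o : V → ℕ) (n : ℕ) (B : ℕ → V → V) (c a : V) : Prop :=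
  Node e o n B c ∧ Node e o n B a ∧ ((e a < o a ∧ M.Adj c a) ∨
    (o a < e a ∧ ∃ w, B n w = c ∧ G.Adj w a ∧ ¬ M.Adj w a ∧ e w + 1 = o a))

/-- `a` and `c` are the classes of the ends of a bridge of tenacity `2n + 1`. -/
def BridgeOf (M : G.Subgraph) (e o : V → ℕ) (n : ℕ) (B : ℕ → V → V) (a c : V) : Prop :=
  Node e o n B a ∧ Node e o n B c ∧ a ≠ c ∧
    ((e a < o a ∧ e c < o c ∧
        ∃ u v, B n u = a ∧ B n v = c ∧ G.Adj u v ∧ ¬ M.Adj u v ∧ e u + e v = 2 * n) ∨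
      (M.Adj a c ∧ o a = n ∧ o c = n ∧ o a < e a ∧ o c < e c))

namespace Setting

variable [Finite V]

omit [Finite V] in
lemma node_outer (W : Setting M K e o n B) (h : Node e o n B x) (h' : e x < o x) :
    e x ≤ n ∧ n + 1 ≤ o x := by
  have := W.tau le_rfl h.1
  have := h.2
  omega

omit [Finite V] in
lemma node_inner (W : Setting M K e o n B) (h : Node e o n B x) (h' : ¬ e x < o x) :
    o x ≤ n ∧ n + 1 ≤ e x := by
  have := W.tau le_rfl h.1
  have := h.2
  have := W.level.e_mod x
  have := W.level.o_mod x
  omega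

omit [Finite V] in
lemma ne_level (W : Setting M K e o n B) (x : V) : e x ≠ o x := by
  have := W.level.e_mod x
  have := W.level.o_mod x
  omega

omit [Finite V] in
lemma node_free (W : Setting M K e o n B) (h : IsUnmatched M x) : Node e o n B x :=
  ⟨W.stage.base_free W.free h n le_rfl, Or.inl (by rw [W.level.e_free h]; omega)⟩

lemma e_base_le (W : Setting M K e o n B) (x : V) : e (B n x) ≤ e x := by
  by_cases h : B n x = x
  · rw [h]
  · exact (W.base_outer le_rfl h).2.2.1

/-- The class of a vertex of small even level is a node with even level less than odd level. -/
lemma node_base (W : Setting M K e o n B) (h : B n x = x → e x ≤ n) :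
    Node e o n B (B n x) ∧ e (B n x) < o (B n x) := by
  by_cases hx : B n x = x
  · have := W.tau le_rfl hx
    have := W.ne_level x
    have := h hx
    rw [hx]
    exact ⟨⟨hx, Or.inl (h hx)⟩, by omega⟩
  · have := W.base_outer le_rfl hx
    exact ⟨⟨W.stage.idem n le_rfl x, Or.inl (by omega)⟩, by omega⟩

lemma predOf_inner (W : Setting M K e o n B) {a : V} {w : V} (hw : e w + 1 = o a)
    (ha : Node e o n B a) (hai : o a < e a) :
    Node e o n B (B n w) ∧ e (B n w) < o (B n w) := by
  have := W.node_inner ha (by omega)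
  exact W.node_base fun _ => by omega

lemma predOf_lt (W : Setting M K e o n B) (c a : V) (h : PredOf M e o n B c a) :
    mlev e o c < mlev e o a := by
  obtain ⟨hc, ha, ⟨h1, h2⟩ | ⟨h1, w, rfl, h2, h3, h4⟩⟩ := h
  · have := W.level.mate W.matching (by have := W.large; omega) h2
    have := W.node_outer ha h1
    have := W.large
    unfold mlev
    omega
  · have := W.e_base_le w
    unfold mlev
    omega

/-- Every matched node has a predecessor. -/
lemma exists_predOf (W : Setting M K e o n B) {a : V} (ha : Node e o n B a)
    (hf : ¬ IsUnmatched M a) : ∃ c, PredOf M e o n B c a := by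
  have hK := W.large
  by_cases hout : e a < o a
  · unfold IsUnmatched at hf
    push Not at hf
    obtain ⟨c, hc⟩ := hf
    have h1 := W.level.mate W.matching (by omega) hc.symm
    have h2 := W.node_outer ha hout
    refine ⟨c, ⟨?_, Or.inr (by omega)⟩, ha, Or.inl ⟨hout, hc.symm⟩⟩
    by_contra h3
    exact (W.stage.mate n le_rfl c a hc.symm h3).2 ha.1
  · have h1 := W.node_inner ha hout
    obtain ⟨f, p, hp, hl⟩ := W.level.o_att a (by omega)
    have hm := W.level.o_mod a
    obtain ⟨w, q, h, rfl⟩ := exists_eq_concat p (by omega)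
    obtain ⟨h2, h3, h4⟩ := hp.of_concat
    rw [Walk.length_concat] at hl
    have h5 := W.level.e_le q h2 (by omega)
    have hn : ¬ M.Adj w a := by rw [h4]; omega
    have h6 := W.stage.unmatched w a h hn
    have h7 := W.stage.toPreStage.eBd_le W.level W.matching W.large W.free (x := w) (by omega)
    -- The class of `a` cannot contain `w`: a base of another vertex is outer. The dual constraint
    -- of this cross edge then gives `o a ≤ e w + 1`.
    have hwa : B n w ≠ B n a := by
      rw [ha.1]
      intro hwa
      have h8 := W.base_outer le_rfl (x := w) (by rw [hwa]; exact h.ne.symm)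
      rw [hwa] at h8
      omega
    rw [sum_ind_eq_zero n fun j hj hja => hwa (by
      rw [← W.stage.nested j n hj le_rfl w, ← W.stage.nested j n hj le_rfl a, hja]),
      eBd_inner ha.1 hout] at h6
    have h9 : e w + 1 = o a := by omega
    exact ⟨B n w, (W.predOf_inner h9 ha (by omega)).1, ha,
      Or.inr ⟨by omega, w, rfl, h, hn, h9⟩⟩

lemma reach_node (W : Setting M K e o n B) (N : ℕ) : ∀ a, mlev e o a < N → Node e o n B a →
    Reach (PredOf M e o n B) (IsUnmatched M) a := by
  induction N with
  | zero => intro a h; omega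
  | succ N ih =>
    intro a h ha
    by_cases hf : IsUnmatched M a
    · exact ⟨_, .base hf⟩
    · obtain ⟨c, hc⟩ := W.exists_predOf ha hf
      have := W.predOf_lt c a hc
      obtain ⟨l, hl⟩ := ih c (by omega) hc.1
      exact ⟨_, .step hc hl⟩

omit [Finite V] in
lemma node_of_reach (W : Setting M K e o n B) {a : V}
    (h : Reach (PredOf M e o n B) (IsUnmatched M) a) : Node e o n B a := by
  obtain ⟨l, hl⟩ := h
  cases hl with
  | base h => exact W.node_free h
  | step h _ => exact h.2.1

/-- One step of a chain unfolds to a matched edge, or to a path inside the class of `c` followed by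
an unmatched edge to `a`. -/
lemma hasAlt_pred (W : Setting M K e o n B) {c a : V} (h : PredOf M e o n B c a) :
    HasAlt M (mlev e o c).bodd (mlev e o a - mlev e o c) {x | x = a ∨ B n x = c} c a := by
  have hK := W.large
  have hlt := W.predOf_lt c a h
  obtain ⟨hc, ha, ⟨h1, h2⟩ | ⟨h1, w, rfl, h2, h3, h4⟩⟩ := h
  · have h5 := W.level.mate W.matching (by omega) h2
    have h6 := W.level.mate W.matching (by omega) h2.symm
    have h7 := W.node_outer ha h1
    have h8 := W.tau le_rfl ha.1
    have h9 : mlev e o c = o c := by unfold mlev at *; omega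
    have h10 : mlev e o a - mlev e o c = 1 := by unfold mlev at *; omega
    rw [h10, h9, (bodd_true_iff _).2 (W.level.o_mod c)]
    exact HasAlt.single true h2.adj_sub (by simp [h2]) (Or.inr hc.1) (Or.inl rfl)
  · have h5 := W.predOf_inner h4 ha h1
    have h6 := W.node_inner ha (by omega)
    have h7 := W.e_base_le w
    have h8 : mlev e o (B n w) = e (B n w) := by unfold mlev; omega
    have h9 : mlev e o a - mlev e o (B n w) = e w - e (B n w) + 1 := by
      rw [h8]; unfold mlev; omega
    have hm := W.level.e_mod w
    have hm' := W.level.e_mod (B n w)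
    rw [h9, h8, (bodd_false_iff _).2 hm']
    refine ((W.hasAlt_class le_rfl w (by omega)).trans
      (HasAlt.single (X := {w, a}) false h2 (by simp [h3]) (by simp) (by simp)) ?_ ?_).mono ?_
    · rw [(bodd_false_iff _).2 (by omega)]; rfl
    · rintro y hy (rfl | hy')
      · rfl
      · obtain rfl : y = a := hy'
        have : B n w = y := by rw [← show B n y = B n w from hy, ha.1]
        rw [this] at h5
        omega
    · rintro y (hy | rfl | hy)
      · exact Or.inr hy
      · exact Or.inr rfl
      · exact Or.inl hy

/-- The unfolded steps lie in classes whose bases have strictly increasing levels, so they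
concatenate to a simple path. The recorded vertex set makes disjoint chains yield disjoint paths. -/
lemma hasAlt_chain (W : Setting M K e o n B) {a z : V} {L : List V}
    (hL : DChain (PredOf M e o n B) (IsUnmatched M) a L) (hz : z ∈ L) :
    HasAlt M (mlev e o z).bodd (mlev e o a - mlev e o z)
      {x | x = a ∨ (B n x ∈ L ∧ mlev e o z ≤ mlev e o (B n x) ∧ mlev e o (B n x) < mlev e o a)}
      z a := by
  induction hL with
  | @base a h =>
    obtain rfl := List.mem_singleton.1 hz
    rw [Nat.sub_self]
    exact HasAlt.nil _ (Or.inl rfl)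
  | @step c a l h hl ih =>
    by_cases hza : z = a
    · subst hza
      rw [Nat.sub_self]
      exact HasAlt.nil _ (Or.inl rfl)
    have hz' : z ∈ l := (List.mem_cons.1 hz).resolve_left hza
    have hlt := W.predOf_lt c a h
    have hle := hl.level_le W.predOf_lt hz'
    have h1 : mlev e o a - mlev e o z =
        (mlev e o c - mlev e o z) + (mlev e o a - mlev e o c) := by omega
    rw [h1]
    refine ((ih hz').trans (W.hasAlt_pred h) ?_ ?_).mono ?_
    · have : mlev e o c = mlev e o z + (mlev e o c - mlev e o z) := by omega
      conv_lhs => rw [this, Nat.bodd_add]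
    · rintro x (hx | ⟨-, -, hx⟩) (rfl | hx')
      · exact hx
      · exact hx
      · rw [h.2.1.1] at hx; omega
      · rw [show B n x = c from hx'] at hx; omega
    · rintro x ((rfl | ⟨hx1, hx2, hx3⟩) | (rfl | hx))
      · right
        rw [h.1.1]
        exact ⟨List.mem_cons_of_mem _ hl.head_mem, hle, hlt⟩
      · exact Or.inr ⟨List.mem_cons_of_mem _ hx1, hx2, by omega⟩
      · exact Or.inl rfl
      · right
        rw [show B n x = c from hx]
        exact ⟨List.mem_cons_of_mem _ hl.head_mem, hle, hlt⟩

omit [Finite V] in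
lemma exists_source {R : V → V → Prop} {S : V → Prop} {a : V} {L : List V} (hL : DChain R S a L) :
    ∃ f ∈ L, S f := by
  induction hL with
  | @base a h => exact ⟨a, by simp, h⟩
  | step _ _ ih =>
    obtain ⟨f, hf, h⟩ := ih
    exact ⟨f, List.mem_cons_of_mem _ hf, h⟩

omit [Finite V] in
lemma bridgeOf_symm (a c : V) (h : BridgeOf M e o n B a c) : BridgeOf M e o n B c a := by
  obtain ⟨h1, h2, h3, ⟨h4, h5, u, v, h6, h7, h8, h9, h10⟩ | ⟨h4, h5, h6, h7, h8⟩⟩ := h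
  · exact ⟨h2, h1, h3.symm, Or.inl ⟨h5, h4, v, u, h7, h6, h8.symm, fun h => h9 h.symm, by omega⟩⟩
  · exact ⟨h2, h1, h3.symm, Or.inr ⟨h4.symm, h6, h5, h8, h7⟩⟩

omit [Finite V] in
lemma bridgeOf_level {a c : V} (h : BridgeOf M e o n B a c) :
    mlev e o a + mlev e o c ≤ 2 * n := by
  obtain ⟨h1, h2, h3, -⟩ := h
  have := h1.2
  have := h2.2
  unfold mlev
  omega

lemma hasAlt_bridge (W : Setting M K e o n B) {a c : V} (h : BridgeOf M e o n B a c) :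
    HasAlt M (mlev e o a).bodd (2 * n + 1 - mlev e o a - mlev e o c)
      {x | B n x = a ∨ B n x = c} a c := by
  have hK := W.large
  obtain ⟨h1, h2, h3, ⟨h4, h5, u, v, rfl, rfl, h8, h9, h10⟩ | ⟨h4, h5, h6, h7, h8⟩⟩ := h
  · have hu := W.e_base_le u
    have hv := W.e_base_le v
    have hmu := W.level.e_mod u
    have hmv := W.level.e_mod v
    have hma := W.level.e_mod (B n u)
    have hmc := W.level.e_mod (B n v)
    have e1 : mlev e o (B n u) = e (B n u) := by unfold mlev; omega
    have e2 : mlev e o (B n v) = e (B n v) := by unfold mlev; omega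
    have e3 : 2 * n + 1 - e (B n u) - e (B n v) =
      (e u - e (B n u)) + (1 + (e v - e (B n v))) := by omega
    rw [e1, e2, e3, (bodd_false_iff _).2 hma]
    have k2 := (HasAlt.single (M := M) (X := {u, v}) false h8 (by simp [h9]) (by simp)
      (by simp)).trans (W.hasAlt_class le_rfl v (by omega)).reverse (by
        rw [(bodd_false_iff _).2 (by omega)]; rfl) (by
        rintro y (rfl | hy) hy'
        · exact absurd hy' h3
        · exact hy)
    refine ((W.hasAlt_class le_rfl u (by omega)).trans k2 ?_ ?_).mono ?_
    · rw [(bodd_false_iff _).2 (by omega)]; rfl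
    · rintro y hy ((rfl | hy') | hy')
      · rfl
      · obtain rfl : y = v := hy'
        exact absurd (show B n y = B n u from hy).symm h3
      · exact absurd ((show B n y = B n u from hy).symm.trans hy') h3
    · rintro y (hy | (rfl | hy) | hy)
      · exact Or.inl hy
      · exact Or.inl rfl
      · obtain rfl : y = v := hy
        exact Or.inr rfl
      · exact Or.inr hy
  · have e1 : mlev e o a = n := by unfold mlev; omega
    have e2 : mlev e o c = n := by unfold mlev; omega
    rw [e2, e1, show 2 * n + 1 - n - n = 1 by omega,
      (bodd_true_iff _).2 (by rw [← h5]; exact W.level.o_mod a)]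
    exact HasAlt.single true h4.adj_sub (by simp [h4]) (Or.inl h1.1) (Or.inr h2.1)

/-- The path through a bridge to a vertex below one of its ends. -/
lemma exists_path (W : Setting M K e o n B) {a c z : V} (hbr : BridgeOf M e o n B a c)
    {L K' : List V} (hL : DChain (PredOf M e o n B) (IsUnmatched M) a L)
    (hK : DChain (PredOf M e o n B) (IsUnmatched M) c K') (hz : z ∈ L)
    (hLK : ∀ x ∈ L, mlev e o z ≤ mlev e o x → x ∉ K') :
    ∃ (f : V) (p : G.Walk f z), FreePath M p ∧ p.length = 2 * n + 1 - mlev e o z := by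
  obtain ⟨f, hfK, hf⟩ := exists_source hK
  have hf0 : mlev e o f = 0 := by unfold mlev; rw [W.level.e_free hf]; omega
  have h1 := W.hasAlt_chain hK hfK
  rw [hf0, Nat.sub_zero] at h1
  have h2 := W.hasAlt_bridge (bridgeOf_symm a c hbr)
  have h3 := (W.hasAlt_chain hL hz).reverse
  have hle := hL.level_le W.predOf_lt hz
  have hlev := bridgeOf_level hbr
  have haK : a ∉ K' := hLK a hL.head_mem hle
  have h12 := h1.trans h2 (by simp) (by
    rintro x (hx | ⟨hx1, -, hx⟩) (hx' | hx')
    · exact hx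
    · exact hx
    · rw [show B n x = c from hx'] at hx; omega
    · rw [show B n x = a from hx'] at hx1; exact absurd hx1 haK)
  -- The path climbs from an unmatched vertex to `c`, crosses the bridge to `a` and descends to `z`;
  -- the level terms of `a` and `c` cancel in its length.
  have h123 := h12.trans h3 (by
    have e1 : mlev e o c + (2 * n + 1 - mlev e o c - mlev e o a) = 2 * n + 1 - mlev e o a := by
      omega
    have e2 : (2 * n + 1 - mlev e o a).bodd = !(mlev e o a).bodd := by
      have : ((2 * n + 1 - mlev e o a) + mlev e o a).bodd = true := by
        rw [bodd_true_iff]; omega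
      rw [Nat.bodd_add] at this
      revert this
      cases (2 * n + 1 - mlev e o a).bodd <;> cases (mlev e o a).bodd <;> simp
    have e3 : (mlev e o a).bodd = ((mlev e o z).bodd ^^ (mlev e o a - mlev e o z).bodd) := by
      rw [← Nat.bodd_add]
      congr 1
      omega
    rw [e1, e2, e3]
    cases (mlev e o z).bodd <;> cases (mlev e o a - mlev e o z).bodd <;> rfl) (by
    have hcK := hK.head_mem
    have key : ∀ x, (x = a ∨ (B n x ∈ L ∧ mlev e o z ≤ mlev e o (B n x) ∧
        mlev e o (B n x) < mlev e o a)) → B n x ∉ K' := by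
      rintro x (rfl | ⟨hx1, hx2, -⟩)
      · rw [hbr.1.1]; exact haK
      · exact hLK _ hx1 hx2
    rintro x ((hx | ⟨hx, -⟩) | (hx | hx)) hx'
    · refine absurd ?_ (key x hx')
      rw [show x = c from hx, hbr.2.1.1]
      exact hcK
    · exact absurd hx (key x hx')
    · refine absurd ?_ (key x hx')
      rw [show B n x = c from hx]
      exact hcK
    · rcases hx' with hx' | ⟨-, -, hx'⟩
      · exact hx'
      · rw [show B n x = a from hx] at hx'; omega)
  obtain ⟨p, hp, ha, hl, -⟩ := h123
  exact ⟨f, p, ⟨hf, hp, ha⟩, by omega⟩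

/-- The tenacity of merged vertices is small. -/
lemma merged_tau (W : Setting M K e o n B) {z : V}
    (h : Merged (PredOf M e o n B) (IsUnmatched M) (mlev e o) (BridgeOf M e o n B) z) :
    e z + o z ≤ 2 * n + 1 := by
  obtain ⟨a, c, L, K', h1, h2, h3, h4, h5⟩ := h
  obtain ⟨f, p, hp, hl⟩ := W.exists_path h1 h2 h3 h4 h5
  have := bridgeOf_level h1
  have := h2.level_le W.predOf_lt h4
  have hme := W.level.e_mod z
  have hmo := W.level.o_mod z
  -- The length `2n + 1 - mlev e o z` has the parity opposite to `mlev e o z`, so it bounds the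
  -- larger level.
  rcases Nat.mod_two_eq_zero_or_one p.length with h | h
  · have := W.level.e_le p hp h
    unfold mlev at *
    omega
  · have := W.level.o_le p hp h
    unfold mlev at *
    omega

/-- Disjoint chains from the ends of a bridge would give an odd alternating path of length `2n + 1`
between unmatched vertices, shorter than `hfree` permits. -/
lemma layered (W : Setting M K e o n B) (hfree : ∀ f, IsUnmatched M f → 2 * (n + 1) ≤ o f) :
    Layered (PredOf M e o n B) (IsUnmatched M) (mlev e o) (BridgeOf M e o n B) where
  lt := W.predOf_lt
  symm := bridgeOf_symm
  reach a c h := W.reach_node _ a (Nat.lt_succ_self _) h.1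
  meet a c h L K' hL hK := by
    by_contra hdis
    push Not at hdis
    obtain ⟨z, hzL, hz⟩ := exists_source hL
    obtain ⟨f, p, hp, hl⟩ := W.exists_path h hL hK hzL fun x hx _ => hdis x hx
    have h0 : mlev e o z = 0 := by unfold mlev; rw [W.level.e_free hz]; omega
    have := W.level.o_le p hp (by omega)
    have := hfree z hz
    omega

end Setting

end Extension

/-! ### Feasibility of the next stage -/

section NextStage

variable {V : Type*} {G : SimpleGraph V} {M : G.Subgraph} {n : ℕ} {B : ℕ → V → V} {K : ℕ}
  {e o : V → ℕ} {x y : V}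

/-- The class function for tenacities up to `2n + 1`. -/
noncomputable def nextBase (M : G.Subgraph) (e o : V → ℕ) (n : ℕ) (B : ℕ → V → V) (x : V) : V :=
  open Classical in
  if Node e o n B (B n x) then
    top (PredOf M e o n B) (IsUnmatched M) (mlev e o) (BridgeOf M e o n B) (B n x)
  else B n x

/-- The class functions extended by one stage. -/
noncomputable def extendB (M : G.Subgraph) (e o : V → ℕ) (n : ℕ) (B : ℕ → V → V) : ℕ → V → V :=
  Function.update B (n + 1) (nextBase M e o n B)

lemma extendB_le {j : ℕ} (hj : j ≤ n) : extendB M e o n B j = B j := by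
  unfold extendB
  rw [Function.update_of_ne (by omega)]

lemma extendB_succ : extendB M e o n B (n + 1) = nextBase M e o n B := by
  simp [extendB]

lemma nextBase_congr (h : B n x = B n y) : nextBase M e o n B x = nextBase M e o n B y := by
  unfold nextBase
  rw [h]

lemma nextBase_node (h : Node e o n B (B n x)) : nextBase M e o n B x =
    top (PredOf M e o n B) (IsUnmatched M) (mlev e o) (BridgeOf M e o n B) (B n x) := by
  simp [nextBase, h]

lemma nextBase_not_node (h : ¬ Node e o n B (B n x)) : nextBase M e o n B x = B n x := by
  simp [nextBase, h]

namespace Setting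

variable [Finite V]

lemma reach (W : Setting M K e o n B) (h : Node e o n B x) :
    Reach (PredOf M e o n B) (IsUnmatched M) x := W.reach_node _ x (Nat.lt_succ_self _) h

variable (W : Setting M K e o n B) (hfree : ∀ f, IsUnmatched M f → 2 * (n + 1) ≤ o f)
include W hfree

lemma base_nextBase (x : V) : B n (nextBase M e o n B x) = nextBase M e o n B x := by
  by_cases h : Node e o n B (B n x)
  · rw [nextBase_node h]
    exact (W.node_of_reach ((W.layered hfree).reach_top (W.reach h))).1
  · rw [nextBase_not_node h]
    exact W.stage.idem n le_rfl x

lemma nextBase_idem (x : V) :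
    nextBase M e o n B (nextBase M e o n B x) = nextBase M e o n B x := by
  by_cases h : Node e o n B (B n x)
  · have h1 := (W.layered hfree).reach_top (W.reach h)
    have h2 := W.node_of_reach h1
    rw [nextBase_node h, nextBase_node (by rwa [h2.1]), h2.1]
    exact (W.layered hfree).top_top (W.reach h)
  · rw [nextBase_not_node h, nextBase_congr (W.stage.idem n le_rfl x), nextBase_not_node h]

lemma nextBase_ne (h : B n x ≠ x) : nextBase M e o n B x ≠ x := fun h' => by
  have := W.base_nextBase hfree x
  rw [h'] at this
  exact h this

lemma merged_of_ne (h : B n x = x) (h' : nextBase M e o n B x ≠ x) :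
    Node e o n B x ∧
      Merged (PredOf M e o n B) (IsUnmatched M) (mlev e o) (BridgeOf M e o n B) x := by
  by_cases hx : Node e o n B x
  · refine ⟨hx, (W.layered hfree).merged_of_top_ne (W.reach hx) ?_⟩
    rwa [nextBase_node (by rwa [h]), h] at h'
  · rw [nextBase_not_node (by rwa [h])] at h'
    exact absurd h h'

lemma tau_of_ne (h : B n x = x) (h' : nextBase M e o n B x ≠ x) : e x + o x = 2 * n + 1 := by
  have h1 := W.merged_tau (W.merged_of_ne hfree h h').2
  have h2 := W.tau le_rfl h
  omega

lemma nextBase_ten (h' : nextBase M e o n B x ≠ x) : e x + o x ≤ 2 * n + 1 := by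
  by_cases h : B n x = x
  · exact (W.tau_of_ne hfree h h').le
  · have := W.tau_le le_rfl h
    omega

lemma nextBase_bridge (h : BridgeOf M e o n B (B n x) (B n y)) :
    nextBase M e o n B x = nextBase M e o n B y := by
  rw [nextBase_node h.1, nextBase_node h.2.1]
  exact (W.layered hfree).top_bridge h

lemma nextBase_pred (h : PredOf M e o n B (B n x) y) (hy : nextBase M e o n B y ≠ y) :
    nextBase M e o n B x = nextBase M e o n B y := by
  rw [nextBase_node h.1, nextBase_node (by rw [h.2.1.1]; exact h.2.1), h.2.1.1]
  exact Layered.top_congr ((W.layered hfree).domSet_pred h (W.reach h.1)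
    (W.merged_of_ne hfree h.2.1.1 hy).2)

/-- The inner mate `y` is the only predecessor of `x`, has `x` as its only successor and is the end
of no bridge, so the two are merged together and get the same base. -/
lemma nextBase_mate_outer {x y : V} (h : M.Adj x y) (hx : B n x = x) (hy : B n y = y)
    (hxo : e x < o x) (hyi : o y < e y) (hne : nextBase M e o n B x ≠ x ∨ nextBase M e o n B y ≠ y) :
    nextBase M e o n B x = nextBase M e o n B y ∧ nextBase M e o n B x ≠ x ∧
      nextBase M e o n B y ≠ y := by
  have hK := W.large
  have D := W.layered hfree
  have h1 := W.level.mate W.matching (by omega) h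
  have h2 := W.level.mate W.matching (by omega) h.symm
  have ht : e x + o x = 2 * n + 1 ∨ e y + o y = 2 * n + 1 :=
    hne.imp (W.tau_of_ne hfree hx) (W.tau_of_ne hfree hy)
  have hnx : Node e o n B x := ⟨hx, Or.inl (by omega)⟩
  have hny : Node e o n B y := ⟨hy, Or.inr (by omega)⟩
  have hR : PredOf M e o n B y x := ⟨hny, hnx, Or.inl ⟨hxo, h.symm⟩⟩
  have hpred : ∀ c, PredOf M e o n B c x → c = y := by
    rintro c ⟨-, -, ⟨-, h3⟩ | ⟨h3, -⟩⟩
    · exact W.matching.eq_of_adj_right h3 h.symm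
    · omega
  have hsucc : ∀ a, PredOf M e o n B y a → a = x := by
    rintro a ⟨-, h4, ⟨-, h3⟩ | ⟨h3, w, hw, -, -, h5⟩⟩
    · exact W.matching.eq_of_adj_left h3 h.symm
    · have := (W.predOf_inner h5 h4 h3).2
      rw [hw] at this
      omega
  have hbr : ∀ a, ¬ BridgeOf M e o n B a y := by
    rintro a ⟨-, -, -, ⟨-, h3, -⟩ | ⟨h3, -, -, h4, -⟩⟩
    · omega
    · obtain rfl := W.matching.eq_of_adj_right h3 h
      omega
  have hf : ¬ IsUnmatched M x := fun hf => hf y h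
  have key : nextBase M e o n B x ≠ x ∧ nextBase M e o n B y ≠ y := by
    rw [nextBase_node (by rwa [hx]), nextBase_node (by rwa [hy]), hx, hy] at *
    rcases hne with h3 | h3
    · exact ⟨h3, D.top_ne_of_merged (W.reach hny)
        (D.merged_pred hf hR hpred hsucc hbr (D.merged_of_top_ne (W.reach hnx) h3))⟩
    · exact ⟨D.top_ne_of_merged (W.reach hnx)
        (D.merged_succ hsucc hbr (D.merged_of_top_ne (W.reach hny) h3)), h3⟩
  exact ⟨(W.nextBase_pred hfree (x := y) (y := x) (by rwa [hy]) key.1).symm, key⟩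

lemma nextBase_mate {x y : V} (h : M.Adj x y) (hne : nextBase M e o n B x ≠ x) :
    nextBase M e o n B y = nextBase M e o n B x ∧ nextBase M e o n B y ≠ y := by
  have hK := W.large
  by_cases hx : B n x = x
  · have hy : B n y = y := by
      by_contra hy
      exact (W.stage.mate n le_rfl y x h.symm hy).2 hx
    have h1 := W.level.mate W.matching (by omega) h
    have h2 := W.level.mate W.matching (by omega) h.symm
    have ht := W.tau_of_ne hfree hx hne
    have hx' := W.ne_level x
    have hy' := W.ne_level y
    by_cases hxo : e x < o x
    · obtain ⟨h3, h4, h5⟩ := W.nextBase_mate_outer hfree h hx hy hxo (by omega) (Or.inl hne)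
      exact ⟨h3.symm, h5⟩
    by_cases hyo : e y < o y
    · obtain ⟨h3, h4, h5⟩ := W.nextBase_mate_outer hfree h.symm hy hx hyo (by omega) (Or.inr hne)
      exact ⟨h3, h4⟩
    have hnx : Node e o n B x := ⟨hx, Or.inr (by omega)⟩
    have hny : Node e o n B y := ⟨hy, Or.inr (by omega)⟩
    -- Two inner mates of tenacity `2n + 1` both have odd level `n`, so their edge is a bridge.
    -- Neither can dominate the other, as they are on the same level.
    have hbr : BridgeOf M e o n B x y :=
      ⟨hnx, hny, h.ne, Or.inr ⟨h, by omega, by omega, by omega, by omega⟩⟩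
    have heq := W.nextBase_bridge hfree (x := x) (y := y) (by rwa [hx, hy])
    refine ⟨heq.symm, fun h3 => ?_⟩
    have h4 : nextBase M e o n B x = y := heq.trans h3
    rw [nextBase_node (by rwa [hx]), hx] at h4
    have h5 := ((W.layered hfree).top_spec (W.reach hnx)).1.1
    rw [h4] at h5
    obtain ⟨l, hl⟩ := W.reach hnx
    rcases hl.level W.predOf_lt y (h5 l hl) with h6 | h6
    · exact h.ne h6.symm
    · unfold mlev at h6
      omega
  · obtain ⟨h1, h2⟩ := W.stage.mate n le_rfl x y h hx
    exact ⟨nextBase_congr h1, W.nextBase_ne hfree h2⟩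

lemma nextBase_matched {x y : V} (h : M.Adj x y) (hx : nextBase M e o n B x = x) :
    eBd (n + 1) (extendB M e o n B) e o x + eBd (n + 1) (extendB M e o n B) e o y ≤
      2 * (n + 1) + 2 := by
  have hK := W.large
  have hy : nextBase M e o n B y = y := by
    by_contra hy
    exact (W.nextBase_mate hfree h.symm hy).2 hx
  have hxb : B n x = x := by
    by_contra h'; exact W.nextBase_ne hfree h' hx
  have hyb : B n y = y := by
    by_contra h'; exact W.nextBase_ne hfree h' hy
  have h1 := W.level.mate W.matching (by omega) h
  have h2 := W.level.mate W.matching (by omega) h.symm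
  have h3 := W.tau le_rfl hxb
  have h4 := W.tau le_rfl hyb
  have hx' := W.ne_level x
  have hy' := W.ne_level y
  have ex : extendB M e o n B (n + 1) x = x := by rw [extendB_succ, hx]
  have ey : extendB M e o n B (n + 1) y = y := by rw [extendB_succ, hy]
  by_cases hxo : e x < o x
  · rw [eBd_outer ex hxo]
    by_cases hyo : e y < o y
    · rw [eBd_outer ey hyo]; omega
    · rw [eBd_inner ey hyo]; omega
  · rw [eBd_inner ex hxo]
    by_cases hyo : e y < o y
    · rw [eBd_outer ey hyo]; omega
    · rw [eBd_inner ey hyo]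
      -- Inner mates have equal odd levels, at least `n` here; only the value `n` breaks the bound,
      -- and then the edge is a bridge whose ends would have been identified.
      by_contra hcon
      have hbr : BridgeOf M e o n B x y :=
        ⟨⟨hxb, Or.inr (by omega)⟩, ⟨hyb, Or.inr (by omega)⟩, h.ne,
          Or.inr ⟨h, by omega, by omega, by omega, by omega⟩⟩
      have heq := W.nextBase_bridge hfree (x := x) (y := y) (by rwa [hxb, hyb])
      rw [hx, hy] at heq
      exact h.ne heq

/-- How the even bound changes from one stage to the next. -/
lemma eBd_cases (x : V) :
    (eBd (n + 1) (extendB M e o n B) e o x = e x ∧ eBd n B e o x = e x ∧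
      (B n x = x → e x < o x ∧ e x ≤ n + 1)) ∨
    (eBd (n + 1) (extendB M e o n B) e o x = e x ∧ eBd n B e o x = e x ∧
      nextBase M e o n B x ≠ x ∧ Node e o n B x ∧ o x < e x ∧ e x + o x = 2 * n + 1) ∨
    (eBd (n + 1) (extendB M e o n B) e o x = eBd n B e o x + 2) ∨
    (eBd (n + 1) (extendB M e o n B) e o x = n + 2 ∧ eBd n B e o x = n + 1 ∧
      n < o x ∧ (o x < e x ∨ (e x < o x ∧ n + 1 < e x))) := by
  have hlev := W.ne_level x
  by_cases hx : nextBase M e o n B x = x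
  · have hxb : B n x = x := by
      by_contra h'; exact W.nextBase_ne hfree h' hx
    have ex : extendB M e o n B (n + 1) x = x := by rw [extendB_succ, hx]
    by_cases hxo : e x < o x
    · rw [eBd_outer ex hxo, eBd_outer hxb hxo]
      by_cases h : e x ≤ n + 1
      · exact Or.inl ⟨by omega, by omega, fun _ => ⟨hxo, h⟩⟩
      · exact Or.inr (Or.inr (Or.inr ⟨by omega, by omega, by omega, Or.inr ⟨hxo, by omega⟩⟩))
    · rw [eBd_inner ex hxo, eBd_inner hxb hxo]
      by_cases h : o x ≤ n
      · exact Or.inr (Or.inr (Or.inl (by omega)))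
      · exact Or.inr (Or.inr (Or.inr ⟨by omega, by omega, by omega, Or.inl (by omega)⟩))
  · have ex : extendB M e o n B (n + 1) x ≠ x := by rwa [extendB_succ]
    rw [eBd_ne ex]
    by_cases hxb : B n x = x
    · have h1 := W.tau_of_ne hfree hxb hx
      have h2 := (W.merged_of_ne hfree hxb hx).1
      by_cases hxo : e x < o x
      · rw [eBd_outer hxb hxo]
        exact Or.inl ⟨rfl, by omega, fun _ => ⟨hxo, by omega⟩⟩
      · rw [eBd_inner hxb hxo]
        exact Or.inr (Or.inl ⟨rfl, by omega, hx, h2, by omega, h1⟩)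
    · rw [eBd_ne hxb]
      exact Or.inl ⟨rfl, rfl, fun h => absurd h hxb⟩

/-- An unmatched edge between different classes does not violate the new bounds. -/
lemma nextBase_unmatched_aux {x y : V} (h : G.Adj x y) (hn : ¬ M.Adj x y)
    (hne : nextBase M e o n B x ≠ nextBase M e o n B y)
    (hlt : eBd (n + 1) (extendB M e o n B) e o x + eBd (n + 1) (extendB M e o n B) e o y ≤
      2 * n + 1) (hge : 2 * n ≤ eBd n B e o x + eBd n B e o y) : False := by
  have hK := W.large
  have mx := W.level.e_mod x
  have my := W.level.e_mod y
  have mox := W.level.o_mod x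
  have moy := W.level.o_mod y
  have ext1 := W.level.extend h hn
  have ext2 := W.level.extend h.symm (fun h => hn h.symm)
  have hxy : B n x ≠ B n y := fun h => hne (nextBase_congr h)
  -- Parity and `extend` exclude all but three combinations: a bridge, or a predecessor edge into a
  -- merged inner vertex from either side. In each the new classes of the ends agree.
  rcases W.eBd_cases hfree x with ⟨x1, x2, x3⟩ | ⟨x1, x2, x3, x4, x5, x6⟩ | x1 | ⟨x1, x2, x3, x4⟩ <;>
  rcases W.eBd_cases hfree y with ⟨y1, y2, y3⟩ | ⟨y1, y2, y3, y4, y5, y6⟩ | y1 | ⟨y1, y2, y3, y4⟩ <;>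
  try omega
  · have hs : e x + e y = 2 * n := by omega
    have hx := W.node_base (x := x) fun hb => by have := x3 hb; omega
    have hy := W.node_base (x := y) fun hb => by have := y3 hb; omega
    exact hne (W.nextBase_bridge hfree
      ⟨hx.1, hy.1, hxy, Or.inl ⟨hx.2, hy.2, x, y, rfl, rfl, h, hn, hs⟩⟩)
  · have hs : e x + 1 = o y := by omega
    exact hne (W.nextBase_pred hfree
      ⟨(W.predOf_inner hs y4 y5).1, y4, Or.inr ⟨y5, x, rfl, h, hn, hs⟩⟩ y3)
  · have hs : e y + 1 = o x := by omega
    exact hne (W.nextBase_pred hfree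
      ⟨(W.predOf_inner hs x4 x5).1, x4,
        Or.inr ⟨x5, y, rfl, h.symm, fun h => hn h.symm, hs⟩⟩ x3).symm

/-- The required sum grows by two. Ends in a common new class supply this by the new indicator,
since the bounds do not decrease; otherwise the ends were in different classes all along and the
bounds themselves must have grown enough. -/
lemma nextBase_unmatched {x y : V} (h : G.Adj x y) (hn : ¬ M.Adj x y) :
    2 * (n + 1) + 1 ≤ eBd (n + 1) (extendB M e o n B) e o x +
      eBd (n + 1) (extendB M e o n B) e o y + 1 +
      2 * ∑ j ∈ Finset.range (n + 1 + 1), ind (extendB M e o n B j x = extendB M e o n B j y) := by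
  have h1 := W.stage.unmatched x y h hn
  rw [Finset.sum_range_succ, extendB_succ, Finset.sum_congr rfl (g := fun j => ind (B j x = B j y))
    fun j hj => by rw [extendB_le (by simpa [Nat.lt_succ_iff] using hj)]]
  by_cases hne : nextBase M e o n B x = nextBase M e o n B y
  · rw [ind_pos hne]
    have hx := W.eBd_cases hfree x
    have hy := W.eBd_cases hfree y
    omega
  · have h0 : ∑ j ∈ Finset.range (n + 1), ind (B j x = B j y) = 0 :=
      sum_ind_eq_zero n fun j hj hja => hne (nextBase_congr (by
        rw [← W.stage.nested j n hj le_rfl x, ← W.stage.nested j n hj le_rfl y, hja]))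
    rw [h0] at h1 ⊢
    rw [ind_neg hne]
    by_contra hcon
    exact W.nextBase_unmatched_aux hfree h hn hne (by omega) (by omega)

lemma preStage_succ : PreStage M e o (n + 1) (extendB M e o n B) where
  zero x := by rw [extendB_le (Nat.zero_le _)]; exact W.stage.zero x
  idem j hj x := by
    rcases Nat.lt_or_ge n j with h | h
    · obtain rfl : j = n + 1 := by omega
      rw [extendB_succ]
      exact W.nextBase_idem hfree x
    · rw [extendB_le h]
      exact W.stage.idem j h x
  nested j k hjk hk x := by
    rcases Nat.lt_or_ge n k with h | h
    · obtain rfl : k = n + 1 := by omega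
      rw [extendB_succ]
      rcases Nat.lt_or_ge n j with h' | h'
      · obtain rfl : j = n + 1 := by omega
        rw [extendB_succ]
        exact W.nextBase_idem hfree x
      · rw [extendB_le h']
        exact nextBase_congr (W.stage.nested j n h' le_rfl x)
    · rw [extendB_le h, extendB_le (hjk.trans h)]
      exact W.stage.nested j k hjk h x
  mono j k hjk hk x hx := by
    rcases Nat.lt_or_ge n k with h | h
    · obtain rfl : k = n + 1 := by omega
      rcases Nat.lt_or_ge n j with h' | h'
      · obtain rfl : j = n + 1 := by omega
        exact hx
      · rw [extendB_le h'] at hx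
        rw [extendB_succ]
        exact W.nextBase_ne hfree (W.stage.mono j n h' le_rfl x hx)
    · rw [extendB_le h]
      rw [extendB_le (hjk.trans h)] at hx
      exact W.stage.mono j k hjk h x hx
  ten j hj x hx := by
    rcases Nat.lt_or_ge n j with h | h
    · obtain rfl : j = n + 1 := by omega
      rw [extendB_succ] at hx
      have := W.nextBase_ten hfree hx
      omega
    · rw [extendB_le h] at hx
      exact W.stage.ten j h x hx
  mate j hj x y hxy hx := by
    rcases Nat.lt_or_ge n j with h | h
    · obtain rfl : j = n + 1 := by omega
      rw [extendB_succ] at hx ⊢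
      exact W.nextBase_mate hfree hxy hx
    · rw [extendB_le h] at hx ⊢
      exact W.stage.mate j h x y hxy hx
  matched x y hxy hx := by
    rw [extendB_succ] at hx
    exact W.nextBase_matched hfree hxy hx
  unmatched x y hxy hn := W.nextBase_unmatched hfree hxy hn

/-- Merging bounds the tenacity of moved vertices; the converse is not seen from the construction
but comes from duality. -/
lemma succ (hK : n + 1 + 2 ≤ K) : Setting M K e o (n + 1) (extendB M e o n B) := by
  have hP := W.preStage_succ hfree
  refine ⟨⟨hP, fun j hj x hx => ?_⟩, W.level, W.matching, hK, hfree⟩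
  rcases Nat.lt_or_ge n j with h | h
  · obtain rfl : j = n + 1 := by omega
    intro h'
    have := hP.le_tenacity W.level W.matching hK hfree h'
    omega
  · rw [extendB_le h]
    exact W.stage.ten_iff j h x hx

end Setting

lemma exists_setting [Finite V] (L : LevelData M K e o) (hM : M.IsMatching) (n : ℕ)
    (hK : n + 2 ≤ K) (hfree : ∀ f, IsUnmatched M f → 2 * n ≤ o f) :
    ∃ B, Setting M K e o n B := by
  induction n with
  | zero => exact ⟨_, stage_zero, L, hM, hK, hfree⟩
  | succ n ih =>
    obtain ⟨B, W⟩ := ih (by omega) fun f hf => by have := hfree f hf; omega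
    exact ⟨_, W.succ hfree hK⟩

end NextStage

/-! ### Translation between extended and capped levels -/

section Values

variable {V : Type*} {G : SimpleGraph V} {M : G.Subgraph} {K : ℕ} {x y : V}

/-- The even level, with `⊤` replaced by `2K`. -/
noncomputable def eLv (M : G.Subgraph) (K : ℕ) (v : V) : ℕ :=
  open Classical in if evenlevel M v = ⊤ then 2 * K else (evenlevel M v).toNat

/-- The odd level, with `⊤` replaced by `2K + 1`. -/
noncomputable def oLv (M : G.Subgraph) (K : ℕ) (v : V) : ℕ :=
  open Classical in if oddlevel M v = ⊤ then 2 * K + 1 else (oddlevel M v).toNat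

lemma eLv_eq {k : ℕ} (h : evenlevel M x = k) : eLv M K x = k := by simp [eLv, h]

lemma oLv_eq {k : ℕ} (h : oddlevel M x = k) : oLv M K x = k := by simp [oLv, h]

lemma eLv_top (h : evenlevel M x = ⊤) : eLv M K x = 2 * K := by simp [eLv, h]

lemma oLv_top (h : oddlevel M x = ⊤) : oLv M K x = 2 * K + 1 := by simp [oLv, h]

lemma evenlevel_le {f : V} (p : G.Walk f x) (hp : FreePath M p) (hl : p.length % 2 = 0) :
    evenlevel M x ≤ p.length :=
  sInf_le ⟨f, p, (isAltPathFromFree_iff p).2 hp, Nat.even_iff.2 hl, rfl⟩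

lemma oddlevel_le {f : V} (p : G.Walk f x) (hp : FreePath M p) (hl : p.length % 2 = 1) :
    oddlevel M x ≤ p.length :=
  sInf_le ⟨f, p, (isAltPathFromFree_iff p).2 hp, Nat.odd_iff.2 hl, rfl⟩

lemma evenlevel_att (h : evenlevel M x ≠ ⊤) : ∃ (f : V) (p : G.Walk f x), FreePath M p ∧
    p.length % 2 = 0 ∧ evenlevel M x = p.length := by
  have hne : {l : ℕ∞ | ∃ (f : V) (p : G.Walk f x), IsAltPathFromFree M p ∧ Even p.length ∧
      l = p.length}.Nonempty := by
    by_contra hne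
    rw [Set.not_nonempty_iff_eq_empty] at hne
    exact h (by rw [evenlevel, hne, sInf_empty])
  obtain ⟨f, p, h1, h2, h3⟩ := csInf_mem hne
  exact ⟨f, p, (isAltPathFromFree_iff p).1 h1, Nat.even_iff.1 h2, h3⟩

lemma oddlevel_att (h : oddlevel M x ≠ ⊤) : ∃ (f : V) (p : G.Walk f x), FreePath M p ∧
    p.length % 2 = 1 ∧ oddlevel M x = p.length := by
  have hne : {l : ℕ∞ | ∃ (f : V) (p : G.Walk f x), IsAltPathFromFree M p ∧ Odd p.length ∧
      l = p.length}.Nonempty := by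
    by_contra hne
    rw [Set.not_nonempty_iff_eq_empty] at hne
    exact h (by rw [oddlevel, hne, sInf_empty])
  obtain ⟨f, p, h1, h2, h3⟩ := csInf_mem hne
  exact ⟨f, p, (isAltPathFromFree_iff p).1 h1, Nat.odd_iff.1 h2, h3⟩

lemma levelData (M : G.Subgraph) (K : ℕ) : LevelData M K (eLv M K) (oLv M K) where
  e_mod v := by
    by_cases h : evenlevel M v = ⊤
    · rw [eLv_top h]; omega
    · obtain ⟨f, p, -, h2, h3⟩ := evenlevel_att h
      rw [eLv_eq h3, h2]
  o_mod v := by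
    by_cases h : oddlevel M v = ⊤
    · rw [oLv_top h]; omega
    · obtain ⟨f, p, -, h2, h3⟩ := oddlevel_att h
      rw [oLv_eq h3, h2]
  e_le {f v} p hp hl := by
    have h1 := evenlevel_le p hp hl
    have h : evenlevel M v ≠ ⊤ := fun h => by simp [h] at h1
    obtain ⟨f, q, -, h2, h3⟩ := evenlevel_att h
    rw [eLv_eq h3]
    rw [h3] at h1
    exact_mod_cast h1
  o_le {f v} p hp hl := by
    have h1 := oddlevel_le p hp hl
    have h : oddlevel M v ≠ ⊤ := fun h => by simp [h] at h1
    obtain ⟨f, q, -, h2, h3⟩ := oddlevel_att h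
    rw [oLv_eq h3]
    rw [h3] at h1
    exact_mod_cast h1
  e_att v hv := by
    have h : evenlevel M v ≠ ⊤ := fun h => by rw [eLv_top h] at hv; omega
    obtain ⟨f, p, h1, h2, h3⟩ := evenlevel_att h
    exact ⟨f, p, h1, (eLv_eq h3).symm⟩
  o_att v hv := by
    have h : oddlevel M v ≠ ⊤ := fun h => by rw [oLv_top h] at hv; omega
    obtain ⟨f, p, h1, h2, h3⟩ := oddlevel_att h
    exact ⟨f, p, h1, (oLv_eq h3).symm⟩

/-- A level is either finite and unchanged, or infinite and replaced by the cap. -/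
lemma evenlevel_cases (M : G.Subgraph) (K : ℕ) (x : V) :
    evenlevel M x = eLv M K x ∨ (evenlevel M x = ⊤ ∧ eLv M K x = 2 * K) := by
  by_cases h : evenlevel M x = ⊤
  · exact Or.inr ⟨h, eLv_top h⟩
  · obtain ⟨f, p, -, -, h3⟩ := evenlevel_att h
    exact Or.inl (by rw [eLv_eq h3, h3])

lemma oddlevel_cases (M : G.Subgraph) (K : ℕ) (x : V) :
    oddlevel M x = oLv M K x ∨ (oddlevel M x = ⊤ ∧ oLv M K x = 2 * K + 1) := by
  by_cases h : oddlevel M x = ⊤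
  · exact Or.inr ⟨h, oLv_top h⟩
  · obtain ⟨f, p, -, -, h3⟩ := oddlevel_att h
    exact Or.inl (by rw [oLv_eq h3, h3])

lemma evenlevel_of_lt (h : eLv M K x < 2 * K) : evenlevel M x = eLv M K x :=
  (evenlevel_cases M K x).resolve_right fun h' => by omega

lemma oddlevel_of_lt (h : oLv M K x < 2 * K) : oddlevel M x = oLv M K x :=
  (oddlevel_cases M K x).resolve_right fun h' => by omega

lemma tenacity_of_lt (h : eLv M K x + oLv M K x < 2 * K) :
    tenacity M x = (eLv M K x + oLv M K x : ℕ) := by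
  rw [tenacity, evenlevel_of_lt (K := K) (by omega), oddlevel_of_lt (K := K) (by omega)]
  push_cast; rfl

lemma le_tenacity_of_le {k : ℕ} (h : k ≤ eLv M K x + oLv M K x) : (k : ℕ∞) ≤ tenacity M x := by
  unfold tenacity
  rcases evenlevel_cases M K x with h1 | ⟨h1, -⟩
  · rcases oddlevel_cases M K x with h2 | ⟨h2, -⟩
    · rw [h1, h2]
      exact_mod_cast h
    · simp [h2]
  · simp [h1]

lemma sum_of_tenacity {k : ℕ} (h : tenacity M x = k) : eLv M K x + oLv M K x = k := by
  unfold tenacity at h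
  rcases evenlevel_cases M K x with h1 | ⟨h1, -⟩
  · rcases oddlevel_cases M K x with h2 | ⟨h2, -⟩
    · rw [h1, h2] at h
      exact_mod_cast h
    · simp [h2] at h
  · simp [h1] at h

lemma edgeTenacity_matched (h : M.Adj x y) :
    edgeTenacity M s(x, y) = oddlevel M x + oddlevel M y + 1 := by
  rw [edgeTenacity, if_pos (by rwa [Subgraph.mem_edgeSet]), Sym2.lift_mk]

lemma edgeTenacity_unmatched (h : ¬ M.Adj x y) :
    edgeTenacity M s(x, y) = evenlevel M x + evenlevel M y + 1 := by
  rw [edgeTenacity, if_neg (by rwa [Subgraph.mem_edgeSet]), Sym2.lift_mk]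

lemma edgeTenacity_matched_eq {t : ℕ} (h : M.Adj x y) (ht : t < 2 * K) :
    edgeTenacity M s(x, y) = t ↔ oLv M K x + oLv M K y + 1 = t := by
  rw [edgeTenacity_matched h]
  rcases oddlevel_cases M K x with h1 | ⟨h1, h1'⟩
  · rcases oddlevel_cases M K y with h2 | ⟨h2, h2'⟩
    · rw [h1, h2]; norm_cast
    · rw [h2]; simp; omega
  · rw [h1]; simp; omega

lemma edgeTenacity_unmatched_eq {t : ℕ} (h : ¬ M.Adj x y) (ht : t < 2 * K) :
    edgeTenacity M s(x, y) = t ↔ eLv M K x + eLv M K y + 1 = t := by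
  rw [edgeTenacity_unmatched h]
  rcases evenlevel_cases M K x with h1 | ⟨h1, h1'⟩
  · rcases evenlevel_cases M K y with h2 | ⟨h2, h2'⟩
    · rw [h1, h2]; norm_cast
    · rw [h2]; simp; omega
  · rw [h1]; simp; omega

lemma freePath_of_isLevelPath {f v : V} {p : G.Walk f v} (h : IsLevelPath M p) :
    FreePath M p ∧ (p.length % 2 = 0 → p.length = eLv M K v) ∧
      (p.length % 2 = 1 → p.length = oLv M K v) := by
  rcases h with ⟨h1, h2, h3⟩ | ⟨h1, h2, h3⟩
  · rw [Nat.even_iff] at h2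
    exact ⟨(isAltPathFromFree_iff p).1 h1, fun _ => (eLv_eq h3.symm).symm, fun h => by omega⟩
  · rw [Nat.odd_iff] at h2
    exact ⟨(isAltPathFromFree_iff p).1 h1, fun h => by omega, fun _ => (oLv_eq h3.symm).symm⟩

lemma isEvenlevelPath_of {f v : V} {p : G.Walk f v} (hp : FreePath M p)
    (h : p.length = eLv M K v) (hK : eLv M K v < 2 * K) : IsEvenlevelPath M p :=
  ⟨(isAltPathFromFree_iff p).2 hp, Nat.even_iff.2 (by rw [h]; exact (levelData M K).e_mod v), by
    rw [h, evenlevel_of_lt hK]⟩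

lemma isOddlevelPath_of {f v : V} {p : G.Walk f v} (hp : FreePath M p)
    (h : p.length = oLv M K v) (hK : oLv M K v < 2 * K) : IsOddlevelPath M p :=
  ⟨(isAltPathFromFree_iff p).2 hp, Nat.odd_iff.2 (by rw [h]; exact (levelData M K).o_mod v), by
    rw [h, oddlevel_of_lt hK]⟩

lemma length_lt [Finite V] (hK : Nat.card V ≤ K) {f v : V} {p : G.Walk f v} (hp : p.IsPath) :
    p.length < 2 * K := by
  have := Fintype.ofFinite V
  have h1 := hp.length_lt
  rw [← Nat.card_eq_fintype_card] at h1
  omega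

/-- Simple paths are shorter than `2K` once `K` is at least the number of vertices, so a cap never
undercuts a true level. -/
lemma minlevelPath_cases [Finite V] (hK : Nat.card V ≤ K) {f v : V} {p : G.Walk f v}
    (h : IsMinlevelPath M p) : (p.length = eLv M K v ∧ eLv M K v < oLv M K v) ∨
      (p.length = oLv M K v ∧ oLv M K v < eLv M K v) := by
  obtain ⟨h1, h2⟩ := h
  obtain ⟨h3, h4, h5⟩ := freePath_of_isLevelPath (K := K) h1
  have hlt := length_lt hK h3.2.1
  have hle : p.length ≤ eLv M K v := by
    have : (p.length : ℕ∞) ≤ evenlevel M v := h2.trans_le (min_le_left _ _)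
    rcases evenlevel_cases M K v with h | ⟨-, h⟩
    · rw [h] at this; exact_mod_cast this
    · omega
  have hlo : p.length ≤ oLv M K v := by
    have : (p.length : ℕ∞) ≤ oddlevel M v := h2.trans_le (min_le_right _ _)
    rcases oddlevel_cases M K v with h | ⟨-, h⟩
    · rw [h] at this; exact_mod_cast this
    · omega
  have := (levelData M K).e_mod v
  have := (levelData M K).o_mod v
  rcases Nat.mod_two_eq_zero_or_one p.length with h | h
  · have := h4 h; omega
  · have := h5 h; omega

lemma maxlevelPath_length {f v : V} {p : G.Walk f v} (h : IsMaxlevelPath M p) :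
    eLv M K v ≤ p.length ∧ oLv M K v ≤ p.length := by
  have h1 := h.2
  have he : evenlevel M v ≤ p.length := h1.symm ▸ le_max_left _ _
  have ho : oddlevel M v ≤ p.length := h1.symm ▸ le_max_right _ _
  constructor
  · rcases evenlevel_cases M K v with h | ⟨h, -⟩
    · rw [h] at he; exact_mod_cast he
    · simp [h] at he
  · rcases oddlevel_cases M K v with h | ⟨h, -⟩
    · rw [h] at ho; exact_mod_cast ho
    · simp [h] at ho

/-- An odd alternating path between unmatched vertices is simple and nontrivial, so its ends differ
and it is augmenting. -/
lemma le_oLv_of_le_lm {k : ℕ} (hk : (k : ℕ∞) ≤ lm M) (hK : k ≤ 2 * K) {f : V}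
    (hf : IsUnmatched M f) : k ≤ oLv M K f := by
  by_cases h : oddlevel M f = ⊤
  · rw [oLv_top h]; omega
  · obtain ⟨g, p, h1, h2, h3⟩ := oddlevel_att h
    rw [oLv_eq h3]
    have hne : g ≠ f := by
      rintro rfl
      have := Walk.length_eq_zero_iff.2 (Walk.isPath_iff_nil.1 h1.2.1)
      omega
    have : lm M ≤ p.length :=
      sInf_le ⟨g, f, p, ⟨((isAltPathFromFree_iff p).2 h1).2, h1.1, hf, hne⟩, rfl⟩
    exact_mod_cast hk.trans this

end Values

/-! ### Recognising props and bridges -/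

section Edges

variable {V : Type*} {G : SimpleGraph V} {M : G.Subgraph} {K : ℕ} {x y : V}

lemma isPropEdge_of_odd (h : G.Adj x y) (hn : ¬ M.Adj x y)
    (h1 : eLv M K x + 1 = oLv M K y) (h2 : oLv M K y < eLv M K y) (hK : oLv M K y < 2 * K) :
    IsPropEdge M s(x, y) := by
  obtain ⟨f, p, hp, hl⟩ := (levelData M K).e_att x (by omega)
  have hm := (levelData M K).e_mod x
  -- Both levels of `y` exceed the length of `p`.
  have hy : y ∉ p.support := fun hy => by
    have := (levelData M K).le_of_mem p hp hy
    omega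
  have hq : FreePath M (p.concat h) := hp.concat h hy (by simp only [hn, false_iff]; omega)
  have hlq : (p.concat h).length = oLv M K y := by rw [Walk.length_concat]; omega
  refine ⟨x, y, ⟨f, p.concat h, ⟨Or.inr (isOddlevelPath_of hq hlq hK), ?_⟩, ?_, by simp⟩, rfl⟩
  · rw [minlevel, hlq, oddlevel_of_lt hK]
    refine (min_eq_right ?_).symm
    rcases evenlevel_cases M K y with h | ⟨h, -⟩
    · rw [h]; exact_mod_cast h2.le
    · simp [h]
  · intro hnil
    have := Walk.length_eq_zero_iff.2 hnil
    rw [Walk.length_concat] at this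
    omega

lemma isPropEdge_of_even (hM : M.IsMatching) (h : M.Adj x y) (hpos : 0 < K)
    (h2 : eLv M K y < oLv M K y) (hK : eLv M K y < 2 * K) : IsPropEdge M s(x, y) := by
  obtain ⟨f, p, hp, hl⟩ := (levelData M K).e_att y hK
  have hm := (levelData M K).e_mod y
  have h0 := (levelData M K).e_mate_pos hpos h.symm
  obtain ⟨w, q, h', rfl⟩ := exists_eq_concat p (by omega)
  obtain ⟨h3, h4, h5⟩ := hp.of_concat
  have h6 : (q.concat h').length = q.length + 1 := Walk.length_concat _ _
  have h7 := h5.2 (by omega)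
  obtain rfl := hM.eq_of_adj_right h h7
  refine ⟨x, y, ⟨f, q.concat h', ⟨Or.inl (isEvenlevelPath_of hp hl hK), ?_⟩, ?_, by simp⟩, rfl⟩
  · rw [minlevel, hl, evenlevel_of_lt hK]
    refine (min_eq_left ?_).symm
    rcases oddlevel_cases M K y with h | ⟨h, -⟩
    · rw [h]; exact_mod_cast h2.le
    · simp [h]
  · intro hnil
    have := Walk.length_eq_zero_iff.2 hnil
    omega

lemma isBridgeEdge_of (h : G.Adj x y) (h1 : ¬ IsPredecessor M x y) (h2 : ¬ IsPredecessor M y x) :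
    IsBridgeEdge M s(x, y) := by
  refine ⟨h, ?_⟩
  rintro ⟨u, v, huv, heq⟩
  rcases Sym2.eq_iff.1 heq with ⟨rfl, rfl⟩ | ⟨rfl, rfl⟩
  exacts [h1 huv, h2 huv]

variable [Finite V]

/-- The data carried by a predecessor relation. -/
lemma exists_of_isPredecessor (hK : Nat.card V ≤ K) (h : IsPredecessor M x y) :
    ∃ (f : V) (q : G.Walk f x) (hxy : G.Adj x y), FreePath M (q.concat hxy) ∧
      (((q.concat hxy).length = eLv M K y ∧ M.Adj x y ∧ eLv M K y < oLv M K y) ∨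
        ((q.concat hxy).length = oLv M K y ∧ ¬ M.Adj x y ∧ oLv M K y < eLv M K y)) := by
  obtain ⟨f, p, h1, h2, h3⟩ := h
  have h4 : p.length ≠ 0 := fun h => h2 (Walk.length_eq_zero_iff.1 h)
  obtain ⟨w, q, h', rfl⟩ := exists_eq_concat p h4
  rw [Walk.penultimate_concat] at h3
  subst h3
  obtain ⟨h5, -⟩ := freePath_of_isLevelPath (K := K) h1.1
  refine ⟨f, q, h', h5, ?_⟩
  have h6 := h5.of_concat.2.2
  have h7 : (q.concat h').length = q.length + 1 := Walk.length_concat _ _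
  have := (levelData M K).e_mod y
  have := (levelData M K).o_mod y
  rcases minlevelPath_cases hK h1 with ⟨h8, h9⟩ | ⟨h8, h9⟩
  · exact Or.inl ⟨h8, h6.2 (by omega), h9⟩
  · exact Or.inr ⟨h8, by rw [h6]; omega, h9⟩

lemma isBridgeEdge_matched (hK : Nat.card V ≤ K) (h : M.Adj x y) (hx : oLv M K x < eLv M K x)
    (hy : oLv M K y < eLv M K y) : IsBridgeEdge M s(x, y) := by
  refine isBridgeEdge_of h.adj_sub (fun h' => ?_) (fun h' => ?_)
  · obtain ⟨f, q, hxy, -, ⟨-, -, h1⟩ | ⟨-, h1, -⟩⟩ := exists_of_isPredecessor hK h'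
    exacts [by omega, h1 h]
  · obtain ⟨f, q, hxy, -, ⟨-, -, h1⟩ | ⟨-, h1, -⟩⟩ := exists_of_isPredecessor hK h'
    exacts [by omega, h1 h.symm]

variable {n : ℕ} {B : ℕ → V → V}

/-- A minlevel path ending in an unmatched edge is odd, so `y` is inner and by hypothesis moved. Its
path then splits at the base, which puts the last edge inside one class. -/
lemma Setting.not_isPredecessor (W : Setting M K (eLv M K) (oLv M K) n B) (hK : Nat.card V ≤ K)
    (hn : ¬ M.Adj x y) (hxy : B n x ≠ B n y) (hy : B n y = y → eLv M K y < oLv M K y) :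
    ¬ IsPredecessor M x y := by
  intro h
  obtain ⟨f, q, hadj, hp, ⟨-, h1, -⟩ | ⟨h1, -, h2⟩⟩ := exists_of_isPredecessor hK h
  · exact hn h1
  have hyb : B n y ≠ y := fun h => by have := hy h; omega
  have hm := W.level.o_mod y
  obtain ⟨q', r, h3, h4, h5⟩ := W.split le_rfl hyb (q.concat hadj) hp (by omega) (by omega)
  have hr : r.length ≠ 0 := by
    intro h0
    exact hyb (Walk.eq_of_length_eq_zero h0)
  obtain ⟨w, r', h', rfl⟩ := exists_eq_concat r hr
  rw [Walk.append_concat] at h3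
  have hw := congrArg Walk.penultimate h3
  rw [Walk.penultimate_concat, Walk.penultimate_concat] at hw
  subst hw
  exact hxy (h5 x ((mem_support_concat _ _).2 (Or.inl r'.end_mem_support)))

end Edges

/-! ### Unmatched edges of tight paths -/

section TightEdges

variable {V : Type*} [Finite V] {G : SimpleGraph V} {M : G.Subgraph} {n : ℕ} {B : ℕ → V → V} {K : ℕ}
  {e o : V → ℕ} {x y : V}

namespace Setting

/-- Slackness, `oBd_add_le` and the symmetric constraint bound the same quantity from both sides. -/
lemma tight_edge (W : Setting M K e o n B) {b : V} {p : G.Walk b x} {h : G.Adj x y}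
    (hb : ∀ j ≤ n, B j b = b) (hp : (p.concat h).IsPath) (ha : Alt M false (p.concat h))
    (ht : Tight n B (eBd n B e o) (oBd n B e o) (p.concat h)) (hl : p.length % 2 = 0) :
    ¬ M.Adj x y ∧ eBd n B e o x + eBd n B e o y + 1 +
      2 * ∑ j ∈ Finset.range (n + 1), ind (B j x = B j y) = 2 * n + 1 := by
  obtain ⟨h1, h2, -⟩ := W.dual.tight_unmatched hb hp ha ht hl
  have h3 := W.stage.unmatched x y h h1
  have h4 := W.stage.toPreStage.oBd_add_le W.level y
  exact ⟨h1, by omega⟩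

/-- Even if `x` is the base, its even level is below `n`, so the truncation is not active. -/
lemma eBd_of_class (W : Setting M K e o n B) (h : B n x = B n y) (hne : x ≠ y) :
    eBd n B e o x = e x := by
  by_cases hx : B n x = x
  · have hy : B n y ≠ y := by rw [← h, hx]; exact hne
    have := W.base_outer le_rfl hy
    rw [← h, hx] at this
    rw [eBd_outer hx (by omega)]
    omega
  · exact eBd_ne hx

/-- Tight unmatched edges inside a class have small tenacity. -/
lemma class_edge (W : Setting M K e o n B) (h : B n x = B n y) (hne : x ≠ y)
    (ht : eBd n B e o x + eBd n B e o y + 1 +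
      2 * ∑ j ∈ Finset.range (n + 1), ind (B j x = B j y) = 2 * n + 1) :
    e x + e y + 3 ≤ 2 * n + 1 := by
  rw [Finset.sum_range_succ, ind_pos h, W.eBd_of_class h hne, W.eBd_of_class h.symm hne.symm] at ht
  omega

omit [Finite V] in
lemma sum_eq_zero (W : Setting M K e o n B) (h : B n x ≠ B n y) :
    ∑ j ∈ Finset.range (n + 1), ind (B j x = B j y) = 0 :=
  sum_ind_eq_zero n fun j hj hja => h (by
    rw [← W.stage.nested j n hj le_rfl x, ← W.stage.nested j n hj le_rfl y, hja])

omit [Finite V] in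
/-- The shape of a tight unmatched edge between different classes. -/
lemma cross_cases (W : Setting M K e o n B) (h : G.Adj x y) (hn : ¬ M.Adj x y)
    (ht : eBd n B e o x + eBd n B e o y = 2 * n) :
    ((B n x = x → e x < o x) ∧ (B n y = y → e y < o y) ∧ e x + e y = 2 * n) ∨
    ((B n x = x → e x < o x) ∧ B n y = y ∧ o y < e y ∧ e x + 1 = o y ∧ o y ≤ n) ∨
    (B n x = x ∧ o x < e x ∧ (B n y = y → e y < o y) ∧ e y + 1 = o x ∧ o x ≤ n) := by
  have hK := W.large
  have ext1 := W.level.extend h hn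
  have ext2 := W.level.extend h.symm (fun h => hn h.symm)
  have hx' := W.ne_level x
  have hy' := W.ne_level y
  have key : ∀ x, (eBd n B e o x = e x ∧ (B n x = x → e x < o x)) ∨
      (eBd n B e o x = n + 1 ∧ B n x = x ∧ e x < o x ∧ n + 1 ≤ e x) ∨
      (eBd n B e o x = max (2 * n + 1 - o x) (n + 1) ∧ B n x = x ∧ o x < e x) := by
    intro x
    have := W.ne_level x
    by_cases hx : B n x = x
    · by_cases hxo : e x < o x
      · rw [eBd_outer hx hxo]
        by_cases h' : e x ≤ n + 1
        · exact Or.inl ⟨by omega, fun _ => hxo⟩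
        · exact Or.inr (Or.inl ⟨by omega, hx, hxo, by omega⟩)
      · rw [eBd_inner hx hxo]
        exact Or.inr (Or.inr ⟨rfl, hx, by omega⟩)
    · exact Or.inl ⟨eBd_ne hx, fun h => absurd h hx⟩
  rcases key x with ⟨x1, x2⟩ | ⟨x1, x2, x3, x4⟩ | ⟨x1, x2, x3⟩ <;>
  rcases key y with ⟨y1, y2⟩ | ⟨y1, y2, y3, y4⟩ | ⟨y1, y2, y3⟩ <;>
  try omega
  · exact Or.inl ⟨x2, y2, by omega⟩
  · exact Or.inr (Or.inl ⟨x2, y2, y3, by omega, by omega⟩)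
  · exact Or.inr (Or.inr ⟨x2, x3, y2, by omega, by omega⟩)

end Setting

end TightEdges

/-! ### Counting bridges on tight paths -/

section Bridges

variable {V : Type*} [Finite V] {G : SimpleGraph V} {M : G.Subgraph} {n : ℕ} {B : ℕ → V → V} {K : ℕ}
  {x y : V}

/-- The bridges of tenacity `t`. -/
def IsBridgeOfTenacity (M : G.Subgraph) (t : ℕ) (e : Sym2 V) : Prop :=
  IsBridgeEdge M e ∧ edgeTenacity M e = t

/-- A path of length of the parity of `k` reaching `x` has passed a bridge. -/
def Down (e o : V → ℕ) (n : ℕ) (B : ℕ → V → V) (k : ℕ) (x : V) : Prop :=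
  (k % 2 = 1 ↔ (B n x = x → e x < o x))

open Classical in
/-- The number of bridges of tenacity `2n + 1` on a tight path. -/
lemma Setting.countP_bridges (W : Setting M K (eLv M K) (oLv M K) n B) (hK : Nat.card V ≤ K)
    {f : V} (p : G.Walk f x) (hp : FreePath M p)
    (ht : Tight n B (eBd n B (eLv M K) (oLv M K)) (oBd n B (eLv M K) (oLv M K)) p) :
    p.edges.countP (IsBridgeOfTenacity M (2 * n + 1)) + ind (p.length % 2 = 1 ∧ B n x ≠ x) =
        ind (Down (eLv M K) (oLv M K) n B p.length x) + (unbased (B n) (vset p)).ncard ∧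
      (p.length % 2 = 1 → B n x = x → oLv M K x < eLv M K x → oLv M K x ≤ n) := by
  have hlarge := W.large
  -- The identity is checked at each new edge. Unmatched edges inside a class have too small a
  -- tenacity; those between classes are bridges or props by `cross_cases`. A matched edge counts
  -- only if both ends are fixed and inner, and the second conjunct, `oLv M K x ≤ n`, then gives it
  -- tenacity `2n + 1`.
  induction p using Walk.concatRec with
  | @Hnil u =>
    have hb := W.stage.base_free W.free hp.1 n le_rfl
    have he := W.level.e_free hp.1
    have ho := W.level.o_mod u
    have h1 : ¬ Down (eLv M K) (oLv M K) n B (Walk.nil : G.Walk u u).length u := by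
      unfold Down
      simp [hb, he]
      omega
    have h2 : unbased (B n) (vset (Walk.nil : G.Walk u u)) = ∅ := by
      ext c
      simp only [unbased, vset, Walk.support_nil, List.mem_singleton, Set.mem_ofPred_eq,
        Set.mem_empty_iff_false, iff_false]
      rintro ⟨h1, x, rfl, h2⟩
      exact h1 (h2 ▸ hb)
    rw [ind_neg h1, h2, ind_neg (by simp)]
    simp
  | @Hconcat u v w p h ih =>
    have hb := W.stage.base_free W.free hp.1
    have ht' := W.dual.tight_of_concat hb hp.2.1 hp.2.2 ht
    obtain ⟨h1, -, h3⟩ := hp.of_concat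
    obtain ⟨ih1, ih2⟩ := ih h1 ht'
    have hcount : (p.concat h).edges.countP (IsBridgeOfTenacity M (2 * n + 1)) =
        p.edges.countP (IsBridgeOfTenacity M (2 * n + 1)) +
          ind (IsBridgeOfTenacity M (2 * n + 1) s(v, w)) := by
      rw [Walk.edges_concat, List.concat_eq_append, List.countP_append, List.countP_singleton]
      simp [ind]
    rw [hcount, Walk.length_concat]
    have hv' := W.ne_level v
    have hw' := W.ne_level w
    rcases Nat.mod_two_eq_zero_or_one p.length with hl | hl
    · obtain ⟨hn, hE⟩ := W.tight_edge hb hp.2.1 hp.2.2 ht hl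
      have hU := (W.dual.tight_unmatched hb hp.2.1 hp.2.2 ht hl).2.2 n le_rfl
      have hodd : (p.length + 1) % 2 = 1 := by omega
      have hd : Down (eLv M K) (oLv M K) n B p.length v ↔
          ¬ (B n v = v → eLv M K v < oLv M K v) := by unfold Down; simp [hl]
      have hd' : Down (eLv M K) (oLv M K) n B (p.length + 1) w ↔
          (B n w = w → eLv M K w < oLv M K w) := by unfold Down; simp [hodd]
      have hi : ind (p.length % 2 = 1 ∧ B n v ≠ v) = 0 := ind_neg (by omega)
      have hi' : ind ((p.length + 1) % 2 = 1 ∧ B n w ≠ w) = ind (B n w ≠ w) := by simp [hodd]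
      rw [hi] at ih1
      rw [hi']
      by_cases hc : B n v = B n w
      · have hsm := W.class_edge hc h.ne hE
        have hbr : ¬ IsBridgeOfTenacity M (2 * n + 1) s(v, w) := fun hbr => by
          have := (edgeTenacity_unmatched_eq (K := K) hn (by omega)).1 hbr.2
          omega
        have hv : B n v = v → eLv M K v < oLv M K v := fun hvb => by
          have := W.base_outer (x := w) le_rfl (by rw [← hc, hvb]; exact h.ne)
          rw [← hc, hvb] at this
          omega
        have hw : B n w = w → eLv M K w < oLv M K w := fun hwb => by
          have := W.base_outer (x := v) le_rfl (by rw [hc, hwb]; exact h.ne.symm)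
          rw [hc, hwb] at this
          omega
        rw [ind_neg (by rw [hd]; simpa using hv)] at ih1
        rw [ind_neg hbr, ind_pos (hd'.2 hw)]
        rw [ind_pos hc] at hU
        refine ⟨by omega, fun _ h4 h5 => ?_⟩
        have := hw h4
        omega
      · rw [W.sum_eq_zero hc] at hE
        rw [ind_neg hc] at hU
        rcases W.cross_cases h hn (by omega) with ⟨hv, hw, hs⟩ | ⟨hv, hw1, hw2, hs, hs'⟩ |
            ⟨hv1, hv2, hw, hs, hs'⟩
        · have hbr : IsBridgeOfTenacity M (2 * n + 1) s(v, w) :=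
            ⟨isBridgeEdge_of h (W.not_isPredecessor hK hn hc hw)
              (W.not_isPredecessor hK (fun h => hn h.symm) (Ne.symm hc) hv),
              (edgeTenacity_unmatched_eq (K := K) hn (by omega)).2 (by omega)⟩
          rw [ind_neg (by rw [hd]; simpa using hv)] at ih1
          rw [ind_pos hbr, ind_pos (hd'.2 hw)]
          refine ⟨by omega, fun _ h4 h5 => ?_⟩
          have := hw h4
          omega
        · have hbr : ¬ IsBridgeOfTenacity M (2 * n + 1) s(v, w) := fun hbr =>
            hbr.1.2 (isPropEdge_of_odd h hn hs hw2 (by omega))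
          rw [ind_neg (by rw [hd]; simpa using hv)] at ih1
          rw [ind_neg hbr, ind_neg (P := Down _ _ _ _ _ _)
            (by rw [hd']; intro h4; have := h4 hw1; omega)]
          exact ⟨by omega, fun _ _ _ => hs'⟩
        · have hbr : ¬ IsBridgeOfTenacity M (2 * n + 1) s(v, w) := fun hbr =>
            hbr.1.2 (Sym2.eq_swap ▸
              isPropEdge_of_odd h.symm (fun h => hn h.symm) hs hv2 (by omega))
          rw [ind_pos (by rw [hd]; intro h4; have := h4 hv1; omega)] at ih1
          rw [ind_neg hbr, ind_pos (hd'.2 hw)]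
          refine ⟨by omega, fun _ h4 h5 => ?_⟩
          have := hw h4
          omega
    · obtain ⟨hm, -, hU⟩ := W.dual.tight_matched hb hp.2.1 hp.2.2 ht hl
      rw [hU n le_rfl]
      have heven : (p.length + 1) % 2 = 0 := by omega
      have hd : Down (eLv M K) (oLv M K) n B p.length v ↔
          (B n v = v → eLv M K v < oLv M K v) := by unfold Down; simp [hl]
      have hd' : Down (eLv M K) (oLv M K) n B (p.length + 1) w ↔
          ¬ (B n w = w → eLv M K w < oLv M K w) := by unfold Down; simp [heven]
      have hi : ind (p.length % 2 = 1 ∧ B n v ≠ v) = ind (B n v ≠ v) := by simp [hl]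
      have hi' : ind ((p.length + 1) % 2 = 1 ∧ B n w ≠ w) = 0 := ind_neg (by omega)
      rw [hi] at ih1
      rw [hi']
      have hm1 := W.level.mate W.matching (by omega) hm
      have hm2 := W.level.mate W.matching (by omega) hm.symm
      refine ⟨?_, fun h4 => by omega⟩
      by_cases hvb : B n v = v
      · have hwb : B n w = w := by
          by_contra hwb
          exact (W.stage.mate n le_rfl w v hm.symm hwb).2 hvb
        rw [ind_neg (not_not.2 hvb)] at ih1
        have htv := W.tau le_rfl hvb
        have hten := edgeTenacity_matched_eq (K := K) (t := 2 * n + 1) hm (by omega)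
        by_cases hv : eLv M K v < oLv M K v
        · rw [ind_pos (hd.2 fun _ => hv)] at ih1
          by_cases hw : eLv M K w < oLv M K w
          -- Two outer mates would need capped levels, but `p` shows that the odd level of `v` is
          -- finite.
          · have := W.level.o_le p h1 hl
            have := length_lt hK h1.2.1
            omega
          · have hbr : ¬ IsBridgeOfTenacity M (2 * n + 1) s(v, w) := fun hbr => by
              have := hten.1 hbr.2
              exact hbr.1.2 (Sym2.eq_swap ▸
                isPropEdge_of_even W.matching hm.symm (by omega) hv (by omega))
            rw [ind_neg hbr, ind_pos (by rw [hd']; intro h4; exact hw (h4 hwb))]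
            omega
        · rw [ind_neg (by rw [hd]; intro h4; exact hv (h4 hvb))] at ih1
          have hov := ih2 hl hvb (by omega)
          by_cases hw : eLv M K w < oLv M K w
          · have hbr : ¬ IsBridgeOfTenacity M (2 * n + 1) s(v, w) := fun hbr => by
              have := hten.1 hbr.2
              exact hbr.1.2 (isPropEdge_of_even W.matching hm (by omega) hw (by omega))
            rw [ind_neg hbr, ind_neg (by rw [hd']; simpa using fun _ => hw)]
            omega
          · have hbr : IsBridgeOfTenacity M (2 * n + 1) s(v, w) :=
              ⟨isBridgeEdge_matched hK hm (by omega) (by omega), hten.2 (by omega)⟩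
            rw [ind_pos hbr, ind_pos (by rw [hd']; intro h4; exact hw (h4 hwb))]
            omega
      · have hwb := (W.stage.mate n le_rfl v w hm hvb).2
        have htv := W.tau_le le_rfl hvb
        have hbr : ¬ IsBridgeOfTenacity M (2 * n + 1) s(v, w) := fun hbr => by
          have := (edgeTenacity_matched_eq (K := K) hm (by omega)).1 hbr.2
          omega
        rw [ind_pos hvb, ind_pos (hd.2 fun h => absurd h hvb)] at ih1
        rw [ind_neg hbr, ind_neg (by rw [hd']; simpa using fun h => absurd h hwb)]
        omega

/-- Level paths to a vertex of tenacity `2n + 1` are tight. -/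
lemma Setting.tight_of_tau {e o : V → ℕ} (W : Setting M K e o n B) (hx : e x + o x = 2 * n + 1)
    {f : V} (p : G.Walk f x) (hp : FreePath M p) (hk : p.length % 2 = 0 → p.length = e x)
    (hk' : p.length % 2 = 1 → p.length = o x) :
    B n x = x ∧ Tight n B (eBd n B e o) (oBd n B e o) p ∧
      ∀ j ≤ n, unbased (B j) (vset p) = ∅ := by
  have hb : B n x = x := by
    by_contra h
    have := W.tau_le le_rfl h
    omega
  refine ⟨hb, W.stage.toPreStage.tight_of_le W.level W.matching W.large W.free p hp ?_⟩
  have hne := W.ne_level x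
  rcases Nat.mod_two_eq_zero_or_one p.length with h | h
  · rw [lev_even h, hk h]
    by_cases hxo : e x < o x
    · rw [eBd_outer hb hxo]; omega
    · rw [eBd_inner hb hxo]; omega
  · rw [lev_odd h, hk' h, oBd_eq hb]
    by_cases hxo : e x < o x
    · rw [eBd_outer hb hxo]; omega
    · rw [eBd_inner hb hxo]; omega

lemma existsUnique_of_countP_eq_one {α : Type*} {l : List α} {Q : α → Bool}
    (h : l.countP Q = 1) : ∃! a, a ∈ l ∧ Q a = true := by
  rw [List.countP_eq_length_filter, List.length_eq_one_iff] at h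
  obtain ⟨a, ha⟩ := h
  have key : ∀ b, b ∈ l ∧ Q b = true ↔ b = a := fun b => by
    rw [← List.mem_filter, ha, List.mem_singleton]
  exact ⟨a, (key a).2 rfl, fun b hb => (key b).1 hb⟩

/-- Tenacity `2n + 1` makes the bounds at `v` exact, so the path is tight with no unbased class, and
the counting identity says that the number of bridges is the indicator of `Down`. Arriving with the
parity of the larger level is what `Down` means at a fixed vertex. -/
lemma Setting.existsUnique_bridge (W : Setting M K (eLv M K) (oLv M K) n B) (hK : Nat.card V ≤ K)
    {f v : V} (hv : tenacity M v = (2 * n + 1 : ℕ)) (p : G.Walk f v) (hp : IsMaxlevelPath M p) :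
    ∃! e, e ∈ p.edges ∧ IsBridgeEdge M e ∧ edgeTenacity M e = (2 * n + 1 : ℕ) := by
  classical
  obtain ⟨h1, h2, h3⟩ := freePath_of_isLevelPath (K := K) hp.1
  have hs := sum_of_tenacity (K := K) hv
  obtain ⟨hb, ht, hU⟩ := W.tight_of_tau hs p h1 h2 h3
  have hc := (W.countP_bridges hK p h1 ht).1
  have hmax := maxlevelPath_length (K := K) hp
  have hne := W.ne_level v
  have hd : Down (eLv M K) (oLv M K) n B p.length v := by
    unfold Down
    rcases Nat.mod_two_eq_zero_or_one p.length with h | h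
    · have := h2 h
      simp only [hb, forall_const]
      omega
    · have := h3 h
      simp only [hb, forall_const]
      omega
  rw [ind_neg (by simp [hb]), ind_pos hd, hU n le_rfl, Set.ncard_empty] at hc
  obtain ⟨a, ha, hu⟩ := existsUnique_of_countP_eq_one hc
  exact ⟨a, ⟨ha.1, by simpa [IsBridgeOfTenacity] using ha.2⟩,
    fun b hb => hu b ⟨hb.1, by simpa [IsBridgeOfTenacity] using hb.2⟩⟩

end Bridges

/-! ### Bases, blossoms and the splitting of level paths -/

section Bases

variable {V : Type*} {G : SimpleGraph V} {M : G.Subgraph} {n : ℕ} {B : ℕ → V → V} {K : ℕ}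
  {x : V}

/-- The final parts from `b` and from `c` are both suffixes of the support, so one contains the
other, and the longer one has only one vertex of large tenacity. -/
lemma IsBaseOn.eq {f v b c : V} {p : G.Walk f v} (hb : IsBaseOn M p b) (hc : IsBaseOn M p c) :
    b = c := by
  obtain ⟨h1, q, r, rfl, h2⟩ := hb
  obtain ⟨h3, q', r', h4, h5⟩ := hc
  have e1 : r.support <:+ (q.append r).support := by
    rw [Walk.support_append_eq_support_dropLast_append]
    exact List.suffix_append _ _
  have e2 : r'.support <:+ (q.append r).support := by
    rw [h4, Walk.support_append_eq_support_dropLast_append]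
    exact List.suffix_append _ _
  rcases List.suffix_or_suffix_of_suffix e1 e2 with h | h
  · exact h5 b (h.subset r.start_mem_support) h1
  · exact (h2 c (h.subset r'.start_mem_support) h3).symm

variable [Finite V]

namespace Setting

variable (W : Setting M K (eLv M K) (oLv M K) n B)
include W

omit [Finite V] in
lemma lt_tenacity {j : ℕ} (hj : j ≤ n) (h : B j x = x) : ((2 * j : ℕ) : ℕ∞) < tenacity M x := by
  have h1 := le_tenacity_of_le (W.tau hj h)
  exact lt_of_lt_of_le (by exact_mod_cast Nat.lt_succ_self _) h1

lemma isBaseOn {j : ℕ} (hj : j ≤ n) (hx : eLv M K x + oLv M K x + 1 = 2 * j) {f : V}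
    {p : G.Walk f x} (hp : IsLevelPath M p) : IsBaseOn M p (B j x) := by
  have hlarge := W.large
  have hne := W.stage.ten_iff j hj x hx.le
  obtain ⟨h1, h2, h3⟩ := freePath_of_isLevelPath (K := K) hp
  obtain ⟨q, r, h4, h5, h6⟩ := W.split hj hne p h1 h2 h3
  have ht : tenacity M x = (2 * j - 1 : ℕ) := by
    rw [tenacity_of_lt (K := K) (by omega)]
    congr 1
    omega
  refine ⟨?_, q, r, h4, fun z hz hlt => ?_⟩
  · refine lt_of_le_of_lt ?_ (W.lt_tenacity hj (W.stage.idem j hj x))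
    rw [ht]
    exact_mod_cast Nat.sub_le _ _
  · by_contra hzb
    have hz' : B j z ≠ z := by rw [h6 z hz]; exact Ne.symm hzb
    have h7 := W.tau_le hj hz'
    rw [ht, tenacity_of_lt (K := K) (by omega)] at hlt
    have : 2 * j - 1 < eLv M K z + oLv M K z := by exact_mod_cast hlt
    omega

omit [Finite V] in
lemma exists_evenlevelPath {k : ℕ} (hx : eLv M K x ≤ k) (hk : k < 2 * K) :
    ∃ (f : V) (p : G.Walk f x), FreePath M p ∧ p.length = eLv M K x ∧ IsEvenlevelPath M p := by
  obtain ⟨f, p, hp, hl⟩ := W.level.e_att x (by omega)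
  exact ⟨f, p, hp, hl, isEvenlevelPath_of hp hl (by omega)⟩

lemma hasBase {j : ℕ} (hj : j ≤ n) (hx : eLv M K x + oLv M K x + 1 = 2 * j) :
    HasBase M x (B j x) := by
  have hlarge := W.large
  ext c
  constructor
  · rintro ⟨f, p, hp, hc⟩
    exact hc.eq (W.isBaseOn hj hx hp)
  · intro hc
    obtain rfl : c = B j x := hc
    obtain ⟨f, p, -, -, hp⟩ := W.exists_evenlevelPath (x := x) (k := 2 * j) (by omega) (by omega)
    exact ⟨f, p, Or.inl hp, W.isBaseOn hj hx (Or.inl hp)⟩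

lemma eq_of_hasBase {j : ℕ} (hj : j ≤ n) (hx : eLv M K x + oLv M K x + 1 = 2 * j) {b : V}
    (hb : HasBase M x b) : B j x = b := by
  have h := W.hasBase hj hx
  unfold HasBase at h hb
  rw [hb] at h
  exact (Set.singleton_eq_singleton_iff.1 h).symm

/-- Blossoms are the classes without their bases. -/
lemma blossom_eq (hn : 1 ≤ n) {k : ℕ} (hk : k + 1 ≤ n) :
    ∀ b, B (k + 1) b = b → blossom M (2 * k + 1) b = {x | B (k + 1) x = b ∧ x ≠ b} := by
  have hlarge := W.large
  induction k with
  | zero =>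
    intro b hb
    ext x
    simp only [Nat.zero_add, blossom, Set.mem_empty_iff_false, Set.mem_ofPred_eq,
      false_iff, not_and, not_not]
    intro hx
    by_contra hxb
    -- A vertex moved by `B 1` would have tenacity at most one, hence be unmatched with odd level
    -- one; `1 ≤ n` excludes this.
    have h1 := W.tau_le hk (x := x) (by rw [hx]; exact Ne.symm hxb)
    have h2 := W.level.o_mod x
    have h3 := W.free x (W.level.free_of_e (by omega) (by omega))
    omega
  | succ k ih =>
    have ih := ih (by omega)
    intro b hb
    have hcore : ∀ x, x ∈ blossomCore M b (2 * k + 1 + 2) ↔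
        eLv M K x + oLv M K x = 2 * k + 3 ∧ B (k + 2) x = b := by
      intro x
      constructor
      · rintro ⟨h1, h2⟩
        have h3 := sum_of_tenacity (K := K) h1
        exact ⟨h3, W.eq_of_hasBase hk (by omega) h2⟩
      · rintro ⟨h1, h2⟩
        refine ⟨?_, h2 ▸ W.hasBase hk (by omega)⟩
        rw [tenacity_of_lt (K := K) (by omega)]
        congr 1
    have hmid : ∀ x, B (k + 1) x = x → B (k + 2) x ≠ x → eLv M K x + oLv M K x = 2 * k + 3 := by
      intro x h1 h2
      have := W.tau (by omega) h1
      have := W.tau_le hk h2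
      omega
    have hbb : B (k + 1) b = b := by
      by_contra h
      exact W.stage.mono (k + 1) (k + 2) (by omega) hk b h hb
    ext x
    rw [show 2 * (k + 1) + 1 = 2 * k + 1 + 2 by ring, blossom]
    simp only [Set.mem_union, Set.mem_iUnion, Set.mem_ofPred_eq, Set.mem_singleton_iff, hcore]
    constructor
    · rintro (⟨h1, h2⟩ | ⟨v, ⟨hv, -⟩, hx⟩)
      · refine ⟨h2, fun h3 => ?_⟩
        have := W.tau hk hb
        rw [← h3] at this
        omega
      · have hvb : B (k + 2) v = b := by
          rcases hv with h | rfl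
          exacts [h.2, hb]
        have hv1 : B (k + 1) v = v := by
          rcases hv with h | rfl
          · by_contra h'
            have := W.tau_le (by omega) h'
            omega
          · exact hbb
        rw [ih v hv1] at hx
        obtain ⟨h1, h2⟩ := hx
        refine ⟨?_, fun h3 => ?_⟩
        · rw [← W.stage.nested (k + 1) (k + 2) (by omega) hk x, h1, hvb]
        · rw [h3, hbb] at h1
          exact h2 (h3.trans h1)
    · rintro ⟨h1, h2⟩
      by_cases hx : B (k + 1) x = x
      · exact Or.inl ⟨hmid x hx (by rw [show k + 2 = k + 1 + 1 from rfl, h1]; exact Ne.symm h2), h1⟩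
      · right
        -- A vertex moved earlier lies in the smaller blossom of its earlier base, which is outer
        -- and either is `b` or belongs to the core.
        have hw : B (k + 1) (B (k + 1) x) = B (k + 1) x := W.stage.idem _ (by omega) x
        have hwb : B (k + 2) (B (k + 1) x) = b := by
          rw [W.stage.nested (k + 1) (k + 2) (by omega) hk x]; exact h1
        have hout := W.base_outer (by omega) hx
        refine ⟨B (k + 1) x, ⟨?_, ?_⟩, ?_⟩
        · by_cases h3 : B (k + 1) x = b
          · exact Or.inr h3
          · exact Or.inl ⟨hmid _ hw (by rw [hwb]; exact Ne.symm h3), hwb⟩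
        · unfold IsOuter
          rw [evenlevel_of_lt (K := K) (by omega)]
          rcases oddlevel_cases M K (B (k + 1) x) with h | ⟨h, -⟩
          · rw [h]
            exact_mod_cast (by omega : eLv M K (B (k + 1) x) < oLv M K (B (k + 1) x))
          · rw [h]
            exact ENat.natCast_lt_top _
        · rw [ih _ hw]
          exact ⟨rfl, fun h => hx h.symm⟩

/-- Blossoms are fibres minus their bases, and by `nested` a fibre of an earlier class function lies
in a single fibre of a later one. -/
lemma isLaminar (hn : 1 ≤ n) {t : ℕ} (ht : t + 1 ≤ 2 * n) : IsLaminar (blossomFamily M t) := by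
  have hbase : ∀ k b, k + 1 ≤ n → ((2 * k + 1 : ℕ) : ℕ∞) < tenacity M b → B (k + 1) b = b := by
    intro k b hk h
    by_contra h'
    have h1 := W.tau_le hk h'
    have := W.large
    rw [tenacity_of_lt (K := K) (by omega)] at h
    have : 2 * k + 1 < eLv M K b + oLv M K b := by exact_mod_cast h
    omega
  have key : ∀ k l b c, k ≤ l → l + 1 ≤ n → B (k + 1) b = b → B (l + 1) c = c →
      Disjoint (blossom M (2 * k + 1) b) (blossom M (2 * l + 1) c) ∨
        blossom M (2 * k + 1) b ⊆ blossom M (2 * l + 1) c := by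
    intro k l b c hkl hl hb hc
    rw [W.blossom_eq hn (by omega) b hb, W.blossom_eq hn hl c hc]
    by_cases h : B (l + 1) b = c
    · right
      rintro x ⟨h1, h2⟩
      refine ⟨by rw [← W.stage.nested (k + 1) (l + 1) (by omega) hl x, h1, h], ?_⟩
      rintro rfl
      exact W.stage.mono (k + 1) (l + 1) (by omega) hl x (by rw [h1]; exact Ne.symm h2) hc
    · left
      rw [Set.disjoint_left]
      rintro x ⟨h1, -⟩ ⟨h2, -⟩
      exact h (by rw [← h2, ← W.stage.nested (k + 1) (l + 1) (by omega) hl x, h1])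
  rintro _ ⟨b, t₁, ⟨k, rfl⟩, h1, -, h2, rfl⟩ _ ⟨c, t₂, ⟨l, rfl⟩, h3, -, h4, rfl⟩
  have hb := hbase k b (by omega) h2
  have hc := hbase l c (by omega) h4
  rcases le_total k l with h | h
  · exact (key k l b c h (by omega) hb hc).imp id Or.inl
  · exact (key l k c b h (by omega) hc hb).imp (fun h => h.symm) Or.inr

/-- Alternating paths from the base of a class to one of its members. -/
lemma from_base (hx : B n x ≠ x) (r : G.Walk (B n x) x) (hr : IsAltPathUnmatchedStart M r) :
    eLv M K (B n x) + r.length ≥ lev (eLv M K) (oLv M K) r.length x ∧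
      (eLv M K (B n x) + r.length = lev (eLv M K) (oLv M K) r.length x →
        Tight n B (eBd n B (eLv M K) (oLv M K)) (oBd n B (eLv M K) (oLv M K)) r) := by
  rw [isAltPathUnmatchedStart_iff] at hr
  have hb : ∀ j ≤ n, B j (B n x) = B n x := fun j hj =>
    W.stage.base_of_le hj (W.stage.idem n le_rfl x)
  have h1 := W.dual.bound r hb hr.1 hr.2
  have h2 : eBd n B (eLv M K) (oLv M K) (B n x) = eLv M K (B n x) :=
    W.eBd_of_class (W.stage.idem n le_rfl x) hx
  have h3 : lev (eBd n B (eLv M K) (oLv M K)) (oBd n B (eLv M K) (oLv M K)) r.length x =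
      lev (eLv M K) (oLv M K) r.length x := by
    unfold lev
    rw [eBd_ne hx, oBd_ne hx]
  rw [h2, h3] at h1
  refine ⟨by omega, fun h => ?_⟩
  unfold Tight
  rw [h2, h3]
  omega

omit W [Finite V] in
lemma split_from_base {j : ℕ} {f : V} {q : G.Walk f (B j x)} {r : G.Walk (B j x) x}
    (hp : FreePath M (q.append r)) (hq : q.length % 2 = 0) : IsAltPathUnmatchedStart M r := by
  rw [isAltPathUnmatchedStart_iff]
  have := ((alt_append _ _ _).1 hp.2.2).2
  rw [(bodd_false_iff _).2 hq] at this
  exact ⟨hp.2.1.of_append_right, this⟩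

lemma evenlevel_split (hx : B n x ≠ x) {f : V} (p : G.Walk f x) (hp : IsEvenlevelPath M p) :
    ∃ (q : G.Walk f (B n x)) (r : G.Walk (B n x) x), p = q.append r ∧ IsEvenlevelPath M q ∧
      IsEvenlevelPathFrom M r := by
  have hlarge := W.large
  obtain ⟨h1, h2, h3⟩ := freePath_of_isLevelPath (K := K) (Or.inl hp)
  obtain ⟨q, r, rfl, h4, h5⟩ := W.split le_rfl hx p h1 h2 h3
  have hm := W.level.e_mod (B n x)
  have hr := split_from_base h1 (by omega)
  have hl := Walk.length_append q r
  have hpar := Nat.even_iff.1 hp.2.1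
  have ht := W.base_outer le_rfl hx
  refine ⟨q, r, rfl, isEvenlevelPath_of h1.prefix h4 (by omega), hr, Nat.even_iff.2 (by omega),
    fun r' hr' hev => ?_⟩
  have h6 := (W.from_base hx r' hr').1
  rw [lev_even (Nat.even_iff.1 hev)] at h6
  have := h2 hpar
  omega

lemma oddlevel_split (hx : B n x ≠ x) {f : V} (p : G.Walk f x) (hp : IsOddlevelPath M p) :
    ∃ (q : G.Walk f (B n x)) (r : G.Walk (B n x) x), p = q.append r ∧ IsEvenlevelPath M q ∧
      IsOddlevelPathFrom M r := by
  have hlarge := W.large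
  obtain ⟨h1, h2, h3⟩ := freePath_of_isLevelPath (K := K) (Or.inr hp)
  obtain ⟨q, r, rfl, h4, h5⟩ := W.split le_rfl hx p h1 h2 h3
  have hm := W.level.e_mod (B n x)
  have hr := split_from_base h1 (by omega)
  have hl := Walk.length_append q r
  have hpar := Nat.odd_iff.1 hp.2.1
  have ht := W.base_outer le_rfl hx
  refine ⟨q, r, rfl, isEvenlevelPath_of h1.prefix h4 (by omega), hr, Nat.odd_iff.2 (by omega),
    fun r' hr' hev => ?_⟩
  have h6 := (W.from_base hx r' hr').1
  rw [lev_odd (Nat.odd_iff.1 hev)] at h6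
  have := h3 hpar
  omega

/-- Shortest paths from the base of a class are tight. -/
lemma tight_from_base (hx : B n x ≠ x) (r : G.Walk (B n x) x)
    (hr : IsEvenlevelPathFrom M r ∨ IsOddlevelPathFrom M r) :
    r.IsPath ∧ Alt M false r ∧
      Tight n B (eBd n B (eLv M K) (oLv M K)) (oBd n B (eLv M K) (oLv M K)) r := by
  have hlarge := W.large
  have ht := W.tau_le le_rfl hx
  have ho := W.base_outer le_rfl hx
  have hem := W.level.e_mod x
  have hom := W.level.o_mod x
  have hmb := W.level.e_mod (B n x)
  rcases hr with ⟨h1, h2, h3⟩ | ⟨h1, h2, h3⟩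
  · obtain ⟨h4, h5⟩ := W.from_base hx r h1
    refine ⟨h1.1.1, ((isAltPathUnmatchedStart_iff r).1 h1).2, h5 (le_antisymm ?_ h4)⟩
    obtain ⟨f, p, hp, hl⟩ := W.level.e_att x (by omega)
    obtain ⟨q, r', rfl, h6, h7⟩ := W.split le_rfl hx p hp (by omega) (by omega)
    have hl' := Walk.length_append q r'
    have := h3 r' (split_from_base hp (by omega)) (Nat.even_iff.2 (by omega))
    rw [lev_even (Nat.even_iff.1 h2)]
    omega
  · obtain ⟨h4, h5⟩ := W.from_base hx r h1
    refine ⟨h1.1.1, ((isAltPathUnmatchedStart_iff r).1 h1).2, h5 (le_antisymm ?_ h4)⟩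
    obtain ⟨f, p, hp, hl⟩ := W.level.o_att x (by omega)
    obtain ⟨q, r', rfl, h6, h7⟩ := W.split le_rfl hx p hp (by omega) (by omega)
    have hl' := Walk.length_append q r'
    have := h3 r' (split_from_base hp (by omega)) (Nat.odd_iff.2 (by omega))
    rw [lev_odd (Nat.odd_iff.1 h2)]
    omega

/-- Edges of tight paths inside a class have small tenacity. -/
lemma edgeTenacity_le {b y : V} (p : G.Walk b y) (hb : ∀ j ≤ n, B j b = b) (hp : p.IsPath)
    (ha : Alt M false p)
    (ht : Tight n B (eBd n B (eLv M K) (oLv M K)) (oBd n B (eLv M K) (oLv M K)) p)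
    (hcl : ∀ z ∈ p.support, B n z = b) :
    ∀ e ∈ p.edges, edgeTenacity M e + 1 ≤ ((2 * n : ℕ) : ℕ∞) := by
  have hlarge := W.large
  induction p using Walk.concatRec with
  | Hnil => simp
  | @Hconcat u v w p h ih =>
    have ht' := W.dual.tight_of_concat hb hp ha ht
    have hv : B n v = u := hcl v ((mem_support_concat _ _).2 (Or.inl p.end_mem_support))
    have hw : B n w = u := hcl w (Walk.end_mem_support _)
    intro e he
    rw [Walk.edges_concat, List.concat_eq_append, List.mem_append, List.mem_singleton] at he
    rcases he with he | rfl
    · exact ih hb ((Walk.concat_isPath_iff h).1 hp).1 ((alt_concat _ _ _).1 ha).1 ht'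
        (fun z hz => hcl z ((mem_support_concat _ _).2 (Or.inl hz))) e he
    rcases Nat.mod_two_eq_zero_or_one p.length with hl | hl
    · obtain ⟨hn, hE⟩ := W.tight_edge hb hp ha ht hl
      have h1 := W.class_edge (hv.trans hw.symm) h.ne hE
      rw [edgeTenacity_unmatched hn, evenlevel_of_lt (K := K) (by omega),
        evenlevel_of_lt (K := K) (x := w) (by omega)]
      exact_mod_cast (by omega : eLv M K v + eLv M K w + 1 + 1 ≤ 2 * n)
    · obtain ⟨hm, -, -⟩ := W.dual.tight_matched hb hp ha ht hl
      -- Since `w` is not the base, it is moved; the tenacity of its matched edge equals the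
      -- tenacity of `w`.
      have hwu : w ≠ u := fun h' => ((Walk.concat_isPath_iff h).1 hp).2 (h' ▸ p.start_mem_support)
      have h1 := W.tau_le le_rfl (x := w) (by rw [hw]; exact Ne.symm hwu)
      have h2 := W.level.mate W.matching (by omega) hm
      rw [edgeTenacity_matched hm, oddlevel_of_lt (K := K) (by omega),
        oddlevel_of_lt (K := K) (x := w) (by omega)]
      exact_mod_cast (by omega : oLv M K v + oLv M K w + 1 + 1 ≤ 2 * n)

/-- The path is tight and starts at the base of its final class, so the part before the base is
trivial and all the rest stays in the class. -/
lemma from_base_mem (hx : B n x ≠ x) (r : G.Walk (B n x) x)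
    (hr : IsEvenlevelPathFrom M r ∨ IsOddlevelPathFrom M r) :
    (∀ z ∈ r.support, B n z = B n x) ∧
      ∀ e ∈ r.edges, edgeTenacity M e + 1 ≤ ((2 * n : ℕ) : ℕ∞) := by
  obtain ⟨h1, h2, h3⟩ := W.tight_from_base hx r hr
  have hb : ∀ j ≤ n, B j (B n x) = B n x := fun j hj =>
    W.stage.base_of_le hj (W.stage.idem n le_rfl x)
  obtain ⟨q, r', h4, h5⟩ := W.dual.exists_split r hb h1 h2 h3 le_rfl r.start_mem_support
  have hcl : ∀ z ∈ r.support, B n z = B n x := by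
    intro z hz
    rw [h4] at hz h1
    rcases (Walk.mem_support_append_iff _ _).1 hz with hz | hz
    · have hnil := Walk.isPath_iff_nil.1 h1.of_append_left
      rw [Walk.nil_iff_support_eq.1 hnil, List.mem_singleton] at hz
      rw [hz]
      exact W.stage.idem n le_rfl x
    · exact h5 z hz
  exact ⟨hcl, W.edgeTenacity_le r hb h1 h2 h3 hcl⟩

/-- No class of any index is unbased on `p`, so the base of `u` is on `p`. If it occurs up to the
base of `x`, it is that base, since the initial part meets the class only there. -/
lemma bases_mem (hx : B n x ≠ x) {f : V} (p : G.Walk f x) (hp : IsLevelPath M p) :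
    ∃ (q : G.Walk f (B n x)) (r : G.Walk (B n x) x), p = q.append r ∧
      ∀ u ∈ r.support, u ≠ B n x → ∃ c, HasBase M u c ∧ c ∈ r.support := by
  obtain ⟨h1, h2, h3⟩ := freePath_of_isLevelPath (K := K) hp
  obtain ⟨-, hU⟩ := W.tight_of_ne hx p h1 h2 h3
  obtain ⟨q, r, h4, h5, h6⟩ := W.split le_rfl hx p h1 h2 h3
  refine ⟨q, r, h4, fun u hu hne => ?_⟩
  have hu' : B n u ≠ u := by rw [h6 u hu]; exact Ne.symm hne
  have ht := W.tau_le le_rfl hu'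
  have hem := W.level.e_mod u
  have hom := W.level.o_mod u
  obtain ⟨j, hj⟩ : ∃ j, eLv M K u + oLv M K u + 1 = 2 * j :=
    ⟨(eLv M K u + oLv M K u + 1) / 2, by omega⟩
  have hjn : j ≤ n := by omega
  refine ⟨B j u, W.hasBase hjn hj, ?_⟩
  subst h4
  have hup : u ∈ vset (q.append r) := (Walk.mem_support_append_iff _ _).2 (Or.inr hu)
  rcases (Walk.mem_support_append_iff _ _).1 (mem_of_unbased_eq_empty (hU j hjn) hup) with h | h
  · have := W.eq_base_of_mem le_rfl hx q h1.prefix h5 h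
      (by rw [W.stage.nested j n hjn le_rfl u, h6 u hu])
    rw [this]
    exact r.start_mem_support
  · exact h

end Setting

lemma exists_setting_of_le_lm (hM : M.IsMatching) {n : ℕ} (hn : ((2 * n : ℕ) : ℕ∞) ≤ lm M) :
    ∃ K B, Nat.card V ≤ K ∧ Setting M K (eLv M K) (oLv M K) n B := by
  refine ⟨Nat.card V + (n + 2), ?_⟩
  obtain ⟨B, hB⟩ := exists_setting (levelData M (Nat.card V + (n + 2))) hM n (by omega)
    fun f hf => le_oLv_of_le_lm hn (by omega) hf
  exact ⟨B, by omega, hB⟩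

end Bases

end MV

/-! ### Assembly of the theorem -/

open MV in
theorem mainTheorem1 {V : Type*} [Finite V] (G : SimpleGraph V) (M : G.Subgraph)
    (hM : M.IsMatching) :
    (∀ t : ℕ, MV.Eligible M t → ∀ v : V, MV.tenacity M v = t →
      -- Statement 1
      ((∀ (f : V) (p : G.Walk f v), MV.IsLevelPath M p → ∃! b, MV.IsBaseOn M p b) ∧
        ∃ b, MV.baseSet M v = {b}) ∧
      -- Statement 2
      (∀ (f : V) (p : G.Walk f v), MV.IsMaxlevelPath M p →
        ∃! e, e ∈ p.edges ∧ MV.IsBridgeEdge M e ∧ MV.edgeTenacity M e = t) ∧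
      -- Statement 3
      MV.IsLaminar (MV.blossomFamily M t) ∧
      -- Statement 4
      (∀ b, MV.HasBase M v b → ∀ u ∈ MV.blossom M t b,
        (∀ (f : V) (p : G.Walk f u), MV.IsEvenlevelPath M p →
          ∃ (q : G.Walk f b) (r : G.Walk b u), p = q.append r ∧
            MV.IsEvenlevelPath M q ∧ MV.IsEvenlevelPathFrom M r) ∧
        (∀ (f : V) (p : G.Walk f u), MV.IsOddlevelPath M p →
          ∃ (q : G.Walk f b) (r : G.Walk b u), p = q.append r ∧
            MV.IsEvenlevelPath M q ∧ MV.IsOddlevelPathFrom M r) ∧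
        (∀ r : G.Walk b u, MV.IsEvenlevelPathFrom M r ∨ MV.IsOddlevelPathFrom M r →
          (∀ x ∈ r.support, x ∈ MV.blossom M t b ∪ {b}) ∧
          (∀ e ∈ r.edges, MV.edgeTenacity M e ≤ t))) ∧
      -- Statement 5
      (∀ b, MV.HasBase M v b → ∀ (f : V) (p : G.Walk f v), MV.IsLevelPath M p →
        ∃ (q : G.Walk f b) (r : G.Walk b v), p = q.append r ∧
          ∀ u ∈ r.support, u ≠ b → ∃ c, MV.HasBase M u c ∧ c ∈ r.support)) ∧
    -- Statement 2 at tenacity `l_m`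
    (∀ v : V, MV.tenacity M v = MV.lm M → ∀ (f : V) (p : G.Walk f v), MV.IsMaxlevelPath M p →
      ∃! e, e ∈ p.edges ∧ MV.IsBridgeEdge M e ∧ MV.edgeTenacity M e = MV.lm M) := by
  constructor
  · rintro t ⟨⟨i, rfl⟩, -, hlt⟩ v hv
    have hle : ((2 * (i + 1) : ℕ) : ℕ∞) ≤ lm M := by
      have := Order.add_one_le_of_lt hlt
      exact_mod_cast this
    -- For `t = 2i + 1` stage `i + 1` is used, where `v` is moved to its base; `t < l_m` is exactly
    -- what it needs.
    obtain ⟨K, B, hK, W⟩ := exists_setting_of_le_lm hM hle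
    have hlarge := W.large
    have hs := sum_of_tenacity (K := K) hv
    have hvb : B (i + 1) v ≠ v := W.stage.ten_iff (i + 1) le_rfl v (by omega)
    have hbase : ∀ b, HasBase M v b → B (i + 1) v = b := fun b hb =>
      W.eq_of_hasBase le_rfl (by omega) hb
    refine ⟨⟨fun f p hp => ?_, _, W.hasBase le_rfl (by omega)⟩, fun f p hp => ?_,
      W.isLaminar (by omega) (by omega), fun b hb u hu => ?_, fun b hb f p hp => ?_⟩
    · have h := W.isBaseOn (j := i + 1) le_rfl (by omega) hp
      exact ⟨_, h, fun c hc => hc.eq h⟩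
    -- Bridges are counted one stage earlier, while `v` is still fixed.
    · obtain ⟨K', B', hK', W'⟩ := exists_setting_of_le_lm (n := i) hM
        (le_trans (by exact_mod_cast (by omega : 2 * i ≤ 2 * (i + 1))) hle)
      exact W'.existsUnique_bridge hK' hv p hp
    · have hbb : B (i + 1) b = b := by
        rw [← hbase b hb]
        exact W.stage.idem _ le_rfl v
      rw [W.blossom_eq (by omega) le_rfl b hbb] at hu ⊢
      obtain ⟨rfl, hub⟩ := hu
      refine ⟨fun f p hp => W.evenlevel_split hub.symm p hp,
        fun f p hp => W.oddlevel_split hub.symm p hp, fun r hr => ?_⟩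
      obtain ⟨h1, h2⟩ := W.from_base_mem hub.symm r hr
      refine ⟨fun x hx => ?_, fun e he => ?_⟩
      · by_cases hxb : x = B (i + 1) u
        · exact Or.inr hxb
        · exact Or.inl ⟨h1 x hx, hxb⟩
      · have h3 := h2 e he
        rw [show ((2 * (i + 1) : ℕ) : ℕ∞) = ((2 * i + 1 : ℕ) : ℕ∞) + 1 by push_cast; ring] at h3
        exact (ENat.add_le_add_iff_right ENat.one_ne_top).1 h3
    · obtain rfl := hbase b hb
      exact W.bases_mem hvb p hp
  · intro v hv f p hp
    -- A maxlevel path has finite length, so its existence makes both levels, and hence `l_m`,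
    -- finite.
    have hfin : evenlevel M v ≠ ⊤ ∧ oddlevel M v ≠ ⊤ := by
      have h1 := hp.2
      constructor
      · intro h; simp [maxlevel, h] at h1
      · intro h; simp [maxlevel, h] at h1
    obtain ⟨g₁, p₁, -, h1, h2⟩ := evenlevel_att hfin.1
    obtain ⟨g₂, p₂, -, h3, h4⟩ := oddlevel_att hfin.2
    obtain ⟨n, hn⟩ : ∃ n, p₁.length + p₂.length = 2 * n + 1 :=
      ⟨(p₁.length + p₂.length) / 2, by omega⟩
    have ht : tenacity M v = (2 * n + 1 : ℕ) := by
      rw [tenacity, h2, h4, ← hn]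
      push_cast; rfl
    rw [← hv, ht]
    have hle : ((2 * n : ℕ) : ℕ∞) ≤ lm M := by
      rw [← hv, ht]
      exact_mod_cast Nat.le_succ _
    obtain ⟨K, B, hK, W⟩ := exists_setting_of_le_lm hM hle
    exact W.existsUnique_bridge hK ht p hp
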